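/- For a triangulation, let $\gamma$ bound its chunkiness: every triangle $K$ contains a ball of radius $\rho>0$ with $h_K:=\operatorname{diam}K\le\gamma\rho$. For every $\gamma$ there is a constant $C>0$ depending only on $\gamma$ such that the following holds. Let $\Omega\subset\mathbb R^2$ be an open convex polygon, $f\in L^2(\Omega)$, and let $u\in H^1_0(\Omega)$ be the weak solution of $-\Delta u=f$, i.e. $\int_\Omega\nabla u\cdot\nabla v=\int_\Omega fv$ for all $v\in H^1_0(\Omega)$, with $u\in H^2(\Omega)$. Let $\tau_h$ be a conforming triangulation of $\Omega$ with chunkiness bound $\gamma$ and mesh size $h=\max_{K\in\tau_h}h_K$. Define - $V_h^1$: the piecewise affine functions that are continuous at the midpoints of the interior edges and vanish at the midpoints of the boundary edges; - $V_h^2$: the functions, continuous on $\overline\Omega$ and zero on $\partial\Omega$, whose restriction to each $K\in\tau_h$ lies in $D_K^2=\operatorname{span}\{\hat\phi_i\circ F_K^{-1}: i=1,2,3\}$, where $F_K$ is an affine map of the reference triangle with vertices $(0,0),(1,0),(0,1)$ onto $K$ and $\hat\phi_1=(-1+2x+2y)(-1+x+y)$, $\hat\phi_2=(2x-1)x$,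 $\hat\phi_3=(2y-1)y$; - $P_h^2$: the continuous piecewise quadratic functions on $\overline\Omega$ that vanish on $\partial\Omega$. Let the NC1-C2 space $V_h$ be either $V_h^1+V_h^2$ or $V_h^1+P_h^2$. With $a_h(v,w)=\sum_{K\in\tau_h}\int_K\nabla v\cdot\nabla w$ and $\|v\|_h=\sqrt{a_h(v,v)}$, there is exactly one $u_h\in V_h$ with $$a_h(u_h,w)=\sum_{K\in\tau_h}\int_K f w\qquad\text{for all } w\in V_h,$$ and it satisfies $$\|u-u_h\|_h\le C\,h\,|u|_{H^2(\Omega)},\qquad |u|_{H^2(\Omega)}^2=\sum_{|\alpha|=2}\|\partial^\alpha u\|_{L^2(\Omega)}^2 .$$ -/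

import Mathlib

open MeasureTheory Filter Topology
open scoped ContDiff ENNReal

noncomputable section

namespace NC1C2

/-- The Euclidean plane. -/
abbrev Plane : Type := EuclideanSpace ℝ (Fin 2)

/-! ### Sobolev spaces on an open subset of the plane -/

/-- Classical partial derivative in the `i`-th coordinate direction. -/
def partialDeriv (i : Fin 2) (φ : Plane → ℝ) (x : Plane) : ℝ :=
  fderiv ℝ φ x (EuclideanSpace.single i 1)

/-- `φ ∈ C_c^∞(Ω)`. -/
def IsTestFun (Ω : Set Plane) (φ : Plane → ℝ) : Prop :=
  ContDiff ℝ ∞ φ ∧ HasCompactSupport φ ∧ tsupport φ ⊆ Ω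

/-- `g` is a weak `i`-th partial derivative of `u` on the open set `Ω`. -/
def HasWeakDeriv (Ω : Set Plane) (i : Fin 2) (u g : Plane → ℝ) : Prop :=
  LocallyIntegrableOn u Ω ∧ LocallyIntegrableOn g Ω ∧
    ∀ φ, IsTestFun Ω φ → ∫ x in Ω, u x * partialDeriv i φ x = -∫ x in Ω, g x * φ x

open Classical in
/-- The weak `i`-th partial derivative of `u` on `Ω` (unique almost everywhere in `Ω`), and `0` if
there is none. -/
def weakDeriv (Ω : Set Plane) (i : Fin 2) (u : Plane → ℝ) : Plane → ℝ :=
  if h : ∃ g, HasWeakDeriv Ω i u g then h.choose else 0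

/-- `u ∈ L²(Ω)`. -/
def MemL2 (Ω : Set Plane) (u : Plane → ℝ) : Prop :=
  MemLp u 2 (volume.restrict Ω)

/-- `u ∈ H¹(Ω)`. -/
def MemH1 (Ω : Set Plane) (u : Plane → ℝ) : Prop :=
  MemL2 Ω u ∧ ∀ i, (∃ g, HasWeakDeriv Ω i u g) ∧ MemL2 Ω (weakDeriv Ω i u)

/-- `u ∈ H²(Ω)`. -/
def MemH2 (Ω : Set Plane) (u : Plane → ℝ) : Prop :=
  MemH1 Ω u ∧ ∀ i, MemH1 Ω (weakDeriv Ω i u)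

/-- `u ∈ H¹₀(Ω)`, the closure of `C_c^∞(Ω)` in `H¹(Ω)`. -/
def MemH10 (Ω : Set Plane) (u : Plane → ℝ) : Prop :=
  MemH1 Ω u ∧ ∃ φ : ℕ → Plane → ℝ, (∀ n, IsTestFun Ω (φ n)) ∧
    Tendsto (fun n => eLpNorm (fun x => u x - φ n x) 2 (volume.restrict Ω)) atTop (𝓝 0) ∧
    ∀ i, Tendsto (fun n => eLpNorm (fun x => weakDeriv Ω i u x - partialDeriv i (φ n) x) 2
      (volume.restrict Ω)) atTop (𝓝 0)

/-- The seminorm `|u|_{H²(Ω)} = (∑_{|α| = 2} ‖∂^α u‖²_{L²(Ω)})^{1/2}`. -/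
def seminormH2 (Ω : Set Plane) (u : Plane → ℝ) : ℝ :=
  Real.sqrt ((∫ x in Ω, weakDeriv Ω 0 (weakDeriv Ω 0 u) x ^ 2) +
    (∫ x in Ω, weakDeriv Ω 1 (weakDeriv Ω 0 u) x ^ 2) +
    ∫ x in Ω, weakDeriv Ω 1 (weakDeriv Ω 1 u) x ^ 2)

/-! ### The continuous problem -/

/-- `Ω` is an (open) convex polygon. -/
def IsConvexPolygon (Ω : Set Plane) : Prop :=
  Ω.Nonempty ∧ ∃ S : Finset Plane, Ω = interior (convexHull ℝ (S : Set Plane))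

/-- `u ∈ H¹₀(Ω)` and `∫_Ω ∇u·∇v = ∫_Ω f v` for all `v ∈ H¹₀(Ω)`. -/
def IsWeakSolution (Ω : Set Plane) (f u : Plane → ℝ) : Prop :=
  MemH10 Ω u ∧ ∀ v, MemH10 Ω v →
    ∫ x in Ω, ∑ i, weakDeriv Ω i u x * weakDeriv Ω i v x = ∫ x in Ω, f x * v x

/-! ### Triangulations -/

/-- A conforming triangulation of `Ω`. A triangle is given by its set of three vertices; two
triangles meet exactly in the hull of their common vertices (nothing, a vertex or an edge). -/
structure Triangulation (Ω : Set Plane) where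
  cells : Finset (Finset Plane)
  card_eq : ∀ K ∈ cells, K.card = 3
  indep : ∀ K ∈ cells, AffineIndependent ℝ ((↑) : K → Plane)
  inter_eq : ∀ K ∈ cells, ∀ L ∈ cells,
    convexHull ℝ (K : Set Plane) ∩ convexHull ℝ (L : Set Plane) =
      convexHull ℝ ((K : Set Plane) ∩ (L : Set Plane))
  cover : (⋃ K ∈ cells, convexHull ℝ (K : Set Plane)) = closure Ω

variable {Ω : Set Plane}

/-- The mesh size `h`, the largest diameter of a triangle. -/
def Triangulation.meshSize (τ : Triangulation Ω) : ℝ :=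
  ⨆ K : τ.cells, Metric.diam (convexHull ℝ (K.1 : Set Plane))

/-- Every triangle `K` has chunkiness parameter at most `γ`, that is `h_K ≤ γ ρ` for the radius
`ρ` of some ball in `K` (the convex set `K` is star-shaped with respect to each such ball). -/
def Triangulation.ShapeRegular (τ : Triangulation Ω) (γ : ℝ) : Prop :=
  ∀ K ∈ τ.cells, ∃ (x : Plane) (ρ : ℝ), 0 < ρ ∧
    Metric.ball x ρ ⊆ convexHull ℝ (K : Set Plane) ∧
    Metric.diam (convexHull ℝ (K : Set Plane)) ≤ γ * ρ

/-- Piecewise functions: on each triangle `K` a function `v K`, of which only the restriction to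
`K` matters. For a discrete function, `v K` is the polynomial that `v` is equal to on `K`. -/
abbrev Piecewise (τ : Triangulation Ω) : Type := τ.cells → Plane → ℝ

/-- The open triangle. -/
def Triangulation.cell (τ : Triangulation Ω) (K : τ.cells) : Set Plane :=
  interior (convexHull ℝ (K.1 : Set Plane))

/-! ### The finite element spaces -/

/-- Polynomial functions on the plane of total degree at most `k`. -/
def polySpace (k : ℕ) : Submodule ℝ (Plane → ℝ) where
  carrier := {q | ∃ p : MvPolynomial (Fin 2) ℝ, p.totalDegree ≤ k ∧
    ∀ x : Plane, q x = MvPolynomial.eval (fun i => x i) p}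
  add_mem' := by
    rintro a b ⟨p, hp, hpa⟩ ⟨q, hq, hqb⟩
    exact ⟨p + q, (MvPolynomial.totalDegree_add p q).trans (max_le hp hq), fun x => by
      simp [hpa x, hqb x]⟩
  zero_mem' := ⟨0, by simp, fun x => by simp⟩
  smul_mem' := by
    rintro c a ⟨p, hp, hpa⟩
    exact ⟨c • p, (MvPolynomial.totalDegree_smul_le c p).trans hp, fun x => by
      simp [hpa x, MvPolynomial.smul_eval]⟩

/-- The `P¹`-nonconforming space `V_h¹`: affine on each triangle, continuous at the midpoints of
the interior edges, zero at the midpoints of the boundary edges. -/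
def spaceNC1 (τ : Triangulation Ω) : Submodule ℝ (Piecewise τ) where
  carrier := {v | (∀ K, v K ∈ polySpace 1) ∧
    (∀ K L : τ.cells, ∀ a b : Plane, a ≠ b → a ∈ K.1 → b ∈ K.1 → a ∈ L.1 → b ∈ L.1 →
      v K (midpoint ℝ a b) = v L (midpoint ℝ a b)) ∧
    (∀ K : τ.cells, ∀ a b : Plane, a ≠ b → a ∈ K.1 → b ∈ K.1 →
      segment ℝ a b ⊆ frontier Ω → v K (midpoint ℝ a b) = 0)}
  add_mem' := by
    rintro v w ⟨h1, h2, h3⟩ ⟨k1, k2, k3⟩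
    refine ⟨fun K => add_mem (h1 K) (k1 K), fun K L a b hab h4 h5 h6 h7 => ?_,
      fun K a b hab h4 h5 h6 => ?_⟩
    · simp [h2 K L a b hab h4 h5 h6 h7, k2 K L a b hab h4 h5 h6 h7]
    · simp [h3 K a b hab h4 h5 h6, k3 K a b hab h4 h5 h6]
  zero_mem' := ⟨fun K => zero_mem _, fun _ _ _ _ _ _ _ _ _ => rfl, fun _ _ _ _ _ _ _ => rfl⟩
  smul_mem' := by
    rintro c v ⟨h1, h2, h3⟩
    refine ⟨fun K => Submodule.smul_mem _ c (h1 K), fun K L a b hab h4 h5 h6 h7 => ?_,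
      fun K a b hab h4 h5 h6 => ?_⟩
    · simp [h2 K L a b hab h4 h5 h6 h7]
    · simp [h3 K a b hab h4 h5 h6]

/-- Piecewise functions that lie in `D K` on each triangle `K`, are continuous on the closure of
`Ω`, and vanish on the boundary of `Ω`. -/
def conformingSpace (τ : Triangulation Ω) (D : τ.cells → Submodule ℝ (Plane → ℝ)) :
    Submodule ℝ (Piecewise τ) where
  carrier := {v | (∀ K, v K ∈ D K) ∧
    (∀ K L : τ.cells, ∀ x ∈ convexHull ℝ (K.1 : Set Plane), x ∈ convexHull ℝ (L.1 : Set Plane) →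
      v K x = v L x) ∧
    (∀ K : τ.cells, ∀ x ∈ convexHull ℝ (K.1 : Set Plane), x ∈ frontier Ω → v K x = 0)}
  add_mem' := by
    rintro v w ⟨h1, h2, h3⟩ ⟨k1, k2, k3⟩
    refine ⟨fun K => add_mem (h1 K) (k1 K), fun K L x hx hx' => ?_, fun K x hx hx' => ?_⟩
    · simp [h2 K L x hx hx', k2 K L x hx hx']
    · simp [h3 K x hx hx', k3 K x hx hx']
  zero_mem' := ⟨fun K => zero_mem _, fun _ _ _ _ _ => rfl, fun _ _ _ _ => rfl⟩
  smul_mem' := by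
    rintro c v ⟨h1, h2, h3⟩
    refine ⟨fun K => Submodule.smul_mem _ c (h1 K), fun K L x hx hx' => ?_, fun K x hx hx' => ?_⟩
    · simp [h2 K L x hx hx']
    · simp [h3 K x hx hx']

/-- The vertices `(0,0)`, `(1,0)`, `(0,1)` of the reference triangle. -/
def refVertex : Fin 3 → Plane := ![!₂[0, 0], !₂[1, 0], !₂[0, 1]]

/-- The quadratic basis functions of the reference triangle that belong to its vertices. -/
def refBasis : Fin 3 → Plane → ℝ :=
  ![fun x => (-1 + 2 * x 0 + 2 * x 1) * (-1 + x 0 + x 1),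
    fun x => (2 * x 0 - 1) * x 0,
    fun x => (2 * x 1 - 1) * x 1]

/-- `D_K²`, spanned by the functions `φ̂ᵢ ∘ F⁻¹`, where `F` is an affine map of the reference
triangle onto `K` (all choices of `F` give the same three functions). -/
def vertexQuadratics (K : Finset Plane) : Submodule ℝ (Plane → ℝ) :=
  Submodule.span ℝ {q | ∃ (F : Plane ≃ᵃ[ℝ] Plane) (i : Fin 3),
    (∀ j, F (refVertex j) ∈ K) ∧ q = refBasis i ∘ F.symm}

/-- `V_h²`: continuous, in `D_K²` on each triangle `K`, zero on the boundary. -/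
def spaceVertexQuad (τ : Triangulation Ω) : Submodule ℝ (Piecewise τ) :=
  conformingSpace τ fun K => vertexQuadratics K.1

/-- `P_h²`, the conforming piecewise quadratic space with zero boundary values. -/
def spaceC2 (τ : Triangulation Ω) : Submodule ℝ (Piecewise τ) :=
  conformingSpace τ fun _ => polySpace 2

/-! ### The discrete problem -/

/-- `a_h(v, w) = ∑_K ∫_K ∇v·∇w`. -/
def brokenForm (τ : Triangulation Ω) (v w : Piecewise τ) : ℝ :=
  ∑ K : τ.cells, ∫ x in τ.cell K,
    ∑ i, weakDeriv (τ.cell K) i (v K) x * weakDeriv (τ.cell K) i (w K) x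

/-- `F_h(w) = ∑_K ∫_K f w`. -/
def brokenLoad (τ : Triangulation Ω) (f : Plane → ℝ) (w : Piecewise τ) : ℝ :=
  ∑ K : τ.cells, ∫ x in τ.cell K, f x * w K x

/-- The broken energy norm `‖v‖_h = √(a_h(v, v))`. -/
def energyNorm (τ : Triangulation Ω) (v : Piecewise τ) : ℝ :=
  Real.sqrt (brokenForm τ v v)

/-- `u_h ∈ V_h` and `a_h(u_h, w) = F_h(w)` for all `w ∈ V_h`. -/
def IsDiscreteSolution (τ : Triangulation Ω) (Vh : Submodule ℝ (Piecewise τ))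
    (f : Plane → ℝ) (uh : Piecewise τ) : Prop :=
  uh ∈ Vh ∧ ∀ w ∈ Vh, brokenForm τ uh w = brokenLoad τ f w

end NC1C2

end

open MeasureTheory Filter Topology
open scoped ContDiff ENNReal

noncomputable section

namespace NC1C2

section

/-! ### Square-integrable functions -/

/-! The proof is Strang's second lemma, arranged so that no trace theorem is needed. The gradient of
`u` and the broken gradients of discrete functions are elements of one inner product space,
`GradSpace`. There `norm_sub_le_of_consistency` bounds the error by twice the distance from `u` to
any discrete function plus the consistency error, that is, the norm on `V_h` of the functional `v ↦
a_h(u, v) - F_h(v)`. Of the two choices of `V_h` only the properties in `Admissible` matter: the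
space contains `V_h¹`, its members are piecewise quadratic, and their means over edges agree across
interior edges and vanish on boundary edges.

Edge means enter through volume integrals. For a vertex `a_i` of `K` the field `(x - a_i) g` is
tangential to the two sides at `a_i`, so the integral of its divergence `2 g + (x - a_i)·∇g` over
`K` is `2|K|` times the mean of `g` over the opposite side (`sideInt_eq`). The volume integral makes
sense for `g ∈ H¹` and is continuous there. The gradient of the barycentric coordinate `λ_i` is a
multiple of the normal to that side, so Gauss' formula on `K` becomes an algebraic identity
(`integral_partialDeriv_tri`). Testing it with a bump function at the midpoint of an edge shows that
the weighted normals cancel at interior edges (`sum_normal_eq_zero`). Hence the edge means of a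
discrete function, multiplied by the fluxes of an `H¹` function, sum to zero (`sum_sideInt`, by
density of smooth functions).

Adding this zero to the consistency error, with `f = -Δu` inserted, splits it into one defect per
triangle, morally `∑_e ∫_e (w - mean_e w) ∂_n u`. The defect is unchanged if constants are
subtracted from `w` or from `∇u`, so the Poincaré inequality and shape regularity bound it by `h
|u|_{H²(K)} ‖∇w‖_K` (`abs_cellDefect_le`).

For the approximation error, the interpolant with prescribed edge means has as gradient the mean of
the gradient over each cell. Interpolants of test functions converging to `u` therefore have errors
converging to the deviation of `∇u` from its cell means, which Poincaré bounds
(`exists_approximation`). Unique solvability follows because a piecewise constant function with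
consistent edge means is zero (`eq_zero_of_partialDeriv_eq_zero`). -/

lemma integrable_mul_of_memLp {α : Type*} [MeasurableSpace α] {μ : Measure α} {f g : α → ℝ}
    (hf : MemLp f 2 μ) (hg : MemLp g 2 μ) : Integrable (fun x => f x * g x) μ :=
  MemLp.integrable_mul hf hg

lemma inner_toLp {α : Type*} [MeasurableSpace α] {μ : Measure α} {f g : α → ℝ}
    (hf : MemLp f 2 μ) (hg : MemLp g 2 μ) :
    inner ℝ (hf.toLp f) (hg.toLp g) = ∫ x, f x * g x ∂μ := by
  rw [L2.inner_def]
  refine integral_congr_ae ?_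
  filter_upwards [hf.coeFn_toLp, hg.coeFn_toLp] with x h1 h2
  rw [h1, h2]
  simp [mul_comm]

lemma norm_toLp_two {α : Type*} [MeasurableSpace α] {μ : Measure α} {f : α → ℝ}
    (hf : MemLp f 2 μ) : ‖hf.toLp f‖ = √(∫ x, f x ^ 2 ∂μ) := by
  rw [norm_eq_sqrt_real_inner, inner_toLp]
  simp [sq]

/-- The Cauchy–Schwarz inequality for integrals. -/
lemma abs_integral_mul_le {α : Type*} [MeasurableSpace α] {μ : Measure α} {f g : α → ℝ}
    (hf : MemLp f 2 μ) (hg : MemLp g 2 μ) :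
    |∫ x, f x * g x ∂μ| ≤ √(∫ x, f x ^ 2 ∂μ) * √(∫ x, g x ^ 2 ∂μ) := by
  rw [← inner_toLp hf hg, ← norm_toLp_two hf, ← norm_toLp_two hg]
  exact abs_real_inner_le_norm _ _

/-- Convergence in `L²(μ)`. -/
def TendstoL2 {α : Type*} [MeasurableSpace α] (μ : Measure α) (f : ℕ → α → ℝ) (g : α → ℝ) : Prop :=
  Tendsto (fun n => eLpNorm (fun x => g x - f n x) 2 μ) atTop (𝓝 0)

lemma TendstoL2.tendsto_toLp {α : Type*} [MeasurableSpace α] {μ : Measure α}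
    {f : ℕ → α → ℝ} {g : α → ℝ} (h : TendstoL2 μ f g) (hf : ∀ n, MemLp (f n) 2 μ)
    (hg : MemLp g 2 μ) : Tendsto (fun n => (hf n).toLp (f n)) atTop (𝓝 (hg.toLp g)) := by
  rw [Lp.tendsto_Lp_iff_tendsto_eLpNorm'']
  refine h.congr fun n => ?_
  rw [eLpNorm_sub_comm]
  rfl

lemma TendstoL2.integral_mul {α : Type*} [MeasurableSpace α] {μ : Measure α}
    {f f' : ℕ → α → ℝ} {g g' : α → ℝ} (h : TendstoL2 μ f g) (hf : ∀ n, MemLp (f n) 2 μ)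
    (hg : MemLp g 2 μ) (h' : TendstoL2 μ f' g') (hf' : ∀ n, MemLp (f' n) 2 μ)
    (hg' : MemLp g' 2 μ) :
    Tendsto (fun n => ∫ x, f n x * f' n x ∂μ) atTop (𝓝 (∫ x, g x * g' x ∂μ)) := by
  simp_rw [← fun n => inner_toLp (hf n) (hf' n), ← inner_toLp hg hg']
  exact (h.tendsto_toLp hf hg).inner (h'.tendsto_toLp hf' hg')

lemma tendstoL2_const {α : Type*} [MeasurableSpace α] (μ : Measure α) (g : α → ℝ) :
    TendstoL2 μ (fun _ => g) g := by
  simp [TendstoL2]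

lemma TendstoL2.integral_mul_const {α : Type*} [MeasurableSpace α] {μ : Measure α}
    {f : ℕ → α → ℝ} {g k : α → ℝ} (h : TendstoL2 μ f g) (hf : ∀ n, MemLp (f n) 2 μ)
    (hg : MemLp g 2 μ) (hk : MemLp k 2 μ) :
    Tendsto (fun n => ∫ x, f n x * k x ∂μ) atTop (𝓝 (∫ x, g x * k x ∂μ)) :=
  h.integral_mul hf hg (tendstoL2_const μ k) (fun _ => hk) hk

lemma TendstoL2.integral {α : Type*} [MeasurableSpace α] {μ : Measure α} [IsFiniteMeasure μ]
    {f : ℕ → α → ℝ} {g : α → ℝ} (h : TendstoL2 μ f g) (hf : ∀ n, MemLp (f n) 2 μ)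
    (hg : MemLp g 2 μ) :
    Tendsto (fun n => ∫ x, f n x ∂μ) atTop (𝓝 (∫ x, g x ∂μ)) := by
  simpa using h.integral_mul_const hf hg (memLp_const (1 : ℝ))

lemma TendstoL2.integral_sq {α : Type*} [MeasurableSpace α] {μ : Measure α}
    {f : ℕ → α → ℝ} {g : α → ℝ} (h : TendstoL2 μ f g) (hf : ∀ n, MemLp (f n) 2 μ)
    (hg : MemLp g 2 μ) :
    Tendsto (fun n => ∫ x, f n x ^ 2 ∂μ) atTop (𝓝 (∫ x, g x ^ 2 ∂μ)) := by
  simpa [sq] using h.integral_mul hf hg h hf hg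

lemma TendstoL2.mono_measure {α : Type*} [MeasurableSpace α] {μ ν : Measure α}
    {f : ℕ → α → ℝ} {g : α → ℝ} (h : TendstoL2 μ f g) (hν : ν ≤ μ) : TendstoL2 ν f g :=
  tendsto_of_tendsto_of_tendsto_of_le_of_le tendsto_const_nhds h (fun _ => zero_le)
    fun _ => eLpNorm_mono_measure _ hν

lemma memLp_two_of_continuous {U : Set Plane} (hb : Bornology.IsBounded U) {g : Plane → ℝ}
    (hg : Continuous g) : MemLp g 2 (volume.restrict U) := by
  obtain ⟨C, hC⟩ := hb.isCompact_closure.exists_bound_of_continuousOn hg.continuousOn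
  have : IsFiniteMeasure (volume.restrict (closure U)) :=
    ⟨by simpa using hb.isCompact_closure.measure_lt_top⟩
  have h : MemLp g 2 (volume.restrict (closure U)) :=
    MemLp.of_bound hg.aestronglyMeasurable C
      ((ae_restrict_iff' measurableSet_closure).2 (Eventually.of_forall hC))
  exact h.mono_measure (Measure.restrict_mono subset_closure le_rfl)

lemma integrableOn_of_continuous {U : Set Plane} (hb : Bornology.IsBounded U) {g : Plane → ℝ}
    (hg : Continuous g) : IntegrableOn g U :=
  (hg.continuousOn.integrableOn_compact hb.isCompact_closure).mono_set subset_closure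

/-! ### Weak derivatives -/

lemma continuous_partialDeriv {φ : Plane → ℝ} (hφ : ContDiff ℝ 1 φ) (i : Fin 2) :
    Continuous (partialDeriv i φ) :=
  (hφ.continuous_fderiv one_ne_zero).clm_apply continuous_const

lemma isTestFun_partialDeriv {Ω : Set Plane} {φ : Plane → ℝ} (h : IsTestFun Ω φ) (i : Fin 2) :
    IsTestFun Ω (partialDeriv i φ) := by
  obtain ⟨h1, h2, h3⟩ := h
  have hs : tsupport (partialDeriv i φ) ⊆ tsupport φ :=
    closure_minimal ((fun x hx => by
      by_contra hc
      exact hx (by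
        have := image_eq_zero_of_notMem_tsupport (fun h => hc (tsupport_fderiv_subset ℝ h))
        simp [partialDeriv, this]))) (isClosed_tsupport φ)
  exact ⟨(h1.fderiv_right (m := ∞) le_rfl).clm_apply contDiff_const,
    h2.of_isClosed_subset (isClosed_tsupport _) hs, hs.trans h3⟩

lemma IsTestFun.mono {Ω U : Set Plane} {φ : Plane → ℝ} (h : IsTestFun U φ) (hU : U ⊆ Ω) :
    IsTestFun Ω φ := ⟨h.1, h.2.1, h.2.2.trans hU⟩

lemma IsTestFun.eq_zero {Ω : Set Plane} {φ : Plane → ℝ} (h : IsTestFun Ω φ) {x : Plane}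
    (hx : x ∉ Ω) : φ x = 0 := image_eq_zero_of_notMem_tsupport fun h' => hx (h.2.2 h')

lemma IsTestFun.integrable_mul {Ω : Set Plane} {φ g : Plane → ℝ} (h : IsTestFun Ω φ)
    (hg : LocallyIntegrableOn g Ω) : IntegrableOn (fun x => g x * φ x) Ω := by
  have h1 : IntegrableOn g (tsupport φ) := hg.integrableOn_compact_subset h.2.2 h.2.1
  have h2 : IntegrableOn (fun x => g x * φ x) (tsupport φ) :=
    h1.mul_continuousOn h.1.continuous.continuousOn h.2.1
  exact (IntegrableOn.of_forall_sdiff_eq_zero h2 MeasurableSet.univ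
    fun x hx => by simp [image_eq_zero_of_notMem_tsupport hx.2]).mono_set
    (Set.subset_univ _)

/-- The fundamental lemma of the calculus of variations. Since `weakDeriv` is an arbitrary choice,
this is what allows it to be replaced by a known representative. -/
lemma HasWeakDeriv.ae_eq {Ω : Set Plane} (hΩ : IsOpen Ω) {i : Fin 2} {u g g' : Plane → ℝ}
    (h : HasWeakDeriv Ω i u g) (h' : HasWeakDeriv Ω i u g') : g =ᵐ[volume.restrict Ω] g' := by
  rw [Filter.EventuallyEq, ae_restrict_iff' hΩ.measurableSet]
  have := hΩ.ae_eq_zero_of_integral_contDiff_smul_eq_zero (h.2.1.sub h'.2.1) (μ := volume)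
    fun φ h1 h2 h3 => by
      have ht : IsTestFun Ω φ := ⟨h1, h2, h3⟩
      rw [← setIntegral_eq_integral_of_forall_compl_eq_zero (s := Ω)
        fun x hx => by simp [ht.eq_zero hx]]
      have e : ∀ x, φ x • (g - g') x = g x * φ x - g' x * φ x := fun x => by
        simp; ring
      simp_rw [e]
      rw [integral_sub (ht.integrable_mul h.2.1) (ht.integrable_mul h'.2.1)]
      linarith [h.2.2 φ ht, h'.2.2 φ ht]
  filter_upwards [this] with x hx hxΩ
  simpa [sub_eq_zero] using hx hxΩ

lemma hasWeakDeriv_weakDeriv {Ω : Set Plane} {i : Fin 2} {u : Plane → ℝ}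
    (h : ∃ g, HasWeakDeriv Ω i u g) : HasWeakDeriv Ω i u (weakDeriv Ω i u) := by
  rw [weakDeriv, dif_pos h]
  exact h.choose_spec

lemma HasWeakDeriv.weakDeriv_ae_eq {Ω : Set Plane} (hΩ : IsOpen Ω) {i : Fin 2} {u g : Plane → ℝ}
    (h : HasWeakDeriv Ω i u g) : weakDeriv Ω i u =ᵐ[volume.restrict Ω] g :=
  (hasWeakDeriv_weakDeriv ⟨g, h⟩).ae_eq hΩ h

lemma HasWeakDeriv.mono {Ω U : Set Plane} {i : Fin 2} {u g : Plane → ℝ}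
    (h : HasWeakDeriv Ω i u g) (hU : U ⊆ Ω) : HasWeakDeriv U i u g := by
  refine ⟨h.1.mono_set hU, h.2.1.mono_set hU, fun φ hφ => ?_⟩
  have := h.2.2 φ (hφ.mono hU)
  have hd := isTestFun_partialDeriv hφ i
  rw [setIntegral_eq_integral_of_forall_compl_eq_zero fun x hx => by
      simp [hd.eq_zero (fun h => hx (hU h))], setIntegral_eq_integral_of_forall_compl_eq_zero
      fun x hx => by simp [hφ.eq_zero (fun h => hx (hU h))]] at this
  rw [setIntegral_eq_integral_of_forall_compl_eq_zero fun x hx => by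
      simp [hd.eq_zero hx], setIntegral_eq_integral_of_forall_compl_eq_zero
      fun x hx => by simp [hφ.eq_zero hx], this]

lemma HasWeakDeriv.sub {Ω : Set Plane} {i : Fin 2} {u v g k : Plane → ℝ}
    (h : HasWeakDeriv Ω i u g) (h' : HasWeakDeriv Ω i v k) :
    HasWeakDeriv Ω i (fun x => u x - v x) (fun x => g x - k x) := by
  refine ⟨h.1.sub h'.1, h.2.1.sub h'.2.1, fun φ hφ => ?_⟩
  have hd := isTestFun_partialDeriv hφ i
  simp_rw [sub_mul]
  rw [integral_sub (hd.integrable_mul h.1) (hd.integrable_mul h'.1),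
    integral_sub (hφ.integrable_mul h.2.1) (hφ.integrable_mul h'.2.1), h.2.2 φ hφ, h'.2.2 φ hφ]
  ring

lemma hasWeakDeriv_of_contDiff (Ω : Set Plane) (i : Fin 2) {φ : Plane → ℝ}
    (hφ : ContDiff ℝ 1 φ) : HasWeakDeriv Ω i φ (partialDeriv i φ) := by
  have hc := continuous_partialDeriv hφ i
  refine ⟨hφ.continuous.locallyIntegrable.locallyIntegrableOn _,
    hc.locallyIntegrable.locallyIntegrableOn _, fun ψ hψ => ?_⟩
  have hd := isTestFun_partialDeriv hψ i
  rw [setIntegral_eq_integral_of_forall_compl_eq_zero fun x hx => by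
      simp [hd.eq_zero hx], setIntegral_eq_integral_of_forall_compl_eq_zero
      fun x hx => by simp [hψ.eq_zero hx]]
  refine integral_mul_fderiv_eq_neg_fderiv_mul_of_integrable ?_ ?_ ?_ ?_ ?_
  · exact (hc.mul hψ.1.continuous).integrable_of_hasCompactSupport hψ.2.1.mul_left
  · exact (hφ.continuous.mul hd.1.continuous).integrable_of_hasCompactSupport hd.2.1.mul_left
  · exact (hφ.continuous.mul hψ.1.continuous).integrable_of_hasCompactSupport hψ.2.1.mul_left
  · exact fun x _ => hφ.differentiable one_ne_zero x
  · exact fun x _ => hψ.1.differentiable (by simp) x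

lemma partialDeriv_comm {φ : Plane → ℝ} (hφ : ContDiff ℝ ∞ φ) (i j : Fin 2) :
    partialDeriv i (partialDeriv j φ) = partialDeriv j (partialDeriv i φ) := by
  funext x
  have h2 : ContDiffAt ℝ 2 φ x := (hφ.of_le (WithTop.coe_le_coe.2 (le_top : (2 : ℕ∞) ≤ ⊤))).contDiffAt
  have hs := h2.isSymmSndFDerivAt (by simp)
  have hd : DifferentiableAt ℝ (fderiv ℝ φ) x :=
    (hφ.fderiv_right (m := ∞) le_rfl).differentiable (by simp) x
  have e : ∀ k l : Fin 2, partialDeriv k (partialDeriv l φ) x =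
      fderiv ℝ (fderiv ℝ φ) x (EuclideanSpace.single k 1) (EuclideanSpace.single l 1) := by
    intro k l
    unfold partialDeriv
    rw [fderiv_clm_apply hd (differentiableAt_const _)]
    simp
  rw [e, e, hs]

/-- Mixed second weak derivatives commute. -/
lemma HasWeakDeriv.comm {Ω : Set Plane} {i j : Fin 2} {u ui uj g : Plane → ℝ}
    (hi : HasWeakDeriv Ω i u ui) (hj : HasWeakDeriv Ω j u uj) (h : HasWeakDeriv Ω j ui g) :
    HasWeakDeriv Ω i uj g := by
  refine ⟨hj.2.1, h.2.1, fun φ hφ => ?_⟩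
  -- Both identities test `u` against the same mixed derivative of `φ`, so symmetry of second
  -- derivatives is needed only for smooth functions.
  have h1 := hj.2.2 _ (isTestFun_partialDeriv hφ i)
  have h2 := hi.2.2 _ (isTestFun_partialDeriv hφ j)
  rw [partialDeriv_comm hφ.1] at h1
  linarith [h.2.2 φ hφ]

end

section

/-! ### Density of smooth functions in `H¹` of a bounded convex open set -/

/-- Convolution with a normalised bump function. -/
def mollify (φ : ContDiffBump (0 : Plane)) (G : Plane → ℝ) : Plane → ℝ :=
  convolution (φ.normed volume) G (ContinuousLinearMap.lsmul ℝ ℝ) volume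

lemma mollify_apply (φ : ContDiffBump (0 : Plane)) (G : Plane → ℝ) (x : Plane) :
    mollify φ G x = ∫ t, φ.normed volume t * G (x - t) := rfl

lemma contDiff_mollify (φ : ContDiffBump (0 : Plane)) {G : Plane → ℝ}
    (hG : LocallyIntegrable G) : ContDiff ℝ ∞ (mollify φ G) :=
  φ.hasCompactSupport_normed.contDiff_convolution_left _ (φ.contDiff_normed (n := (⊤ : ℕ∞))) hG

/-- Jensen's inequality, obtained from nonnegativity of the variance of `t ↦ G (x - t)` under the
probability density `φ.normed volume`. -/
lemma mollify_sq_le (φ : ContDiffBump (0 : Plane)) {G : Plane → ℝ} (hG : MemLp G 2) (x : Plane) :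
    mollify φ G x ^ 2 ≤ mollify φ (fun y => G y ^ 2) x := by
  have h1 : Integrable fun t => φ.normed volume t * G (x - t) :=
    φ.hasCompactSupport_normed.convolutionExists_left (ContinuousLinearMap.lsmul ℝ ℝ)
      φ.continuous_normed (hG.locallyIntegrable (by norm_num)) x
  have h2 : Integrable fun t => φ.normed volume t * G (x - t) ^ 2 :=
    φ.hasCompactSupport_normed.convolutionExists_left (ContinuousLinearMap.lsmul ℝ ℝ)
      φ.continuous_normed hG.integrable_sq.locallyIntegrable x
  have h3 : Integrable fun t : Plane => φ.normed volume t := φ.integrable_normed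
  rw [mollify_apply, mollify_apply]
  set m := ∫ t, φ.normed volume t * G (x - t) with hm
  have h4 : 0 ≤ ∫ t, φ.normed volume t * (G (x - t) - m) ^ 2 :=
    integral_nonneg fun t => mul_nonneg (φ.nonneg_normed t) (sq_nonneg _)
  have e : ∀ t, φ.normed volume t * (G (x - t) - m) ^ 2 = φ.normed volume t * G (x - t) ^ 2 -
      2 * m * (φ.normed volume t * G (x - t)) + m ^ 2 * φ.normed volume t := fun t => by ring
  simp_rw [e] at h4
  have h5 : Integrable fun t => φ.normed volume t * G (x - t) ^ 2 -
      2 * m * (φ.normed volume t * G (x - t)) := h2.sub (h1.const_mul _)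
  rw [integral_add h5 (h3.const_mul _), integral_sub h2 (h1.const_mul _),
    integral_const_mul, integral_const_mul, φ.integral_normed, ← hm] at h4
  nlinarith

lemma mollify_sub (φ : ContDiffBump (0 : Plane)) {G H : Plane → ℝ} (hG : LocallyIntegrable G)
    (hH : LocallyIntegrable H) (x : Plane) :
    mollify φ (G - H) x = mollify φ G x - mollify φ H x := by
  have h1 : Integrable fun t => φ.normed volume t * G (x - t) :=
    φ.hasCompactSupport_normed.convolutionExists_left (ContinuousLinearMap.lsmul ℝ ℝ)
      φ.continuous_normed hG x
  have h2 : Integrable fun t => φ.normed volume t * H (x - t) :=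
    φ.hasCompactSupport_normed.convolutionExists_left (ContinuousLinearMap.lsmul ℝ ℝ)
      φ.continuous_normed hH x
  simp only [mollify_apply, Pi.sub_apply, mul_sub]
  exact integral_sub h1 h2

/-- The contraction of ratio `1 - s` towards `x₀`. -/
def contraction (s : ℝ) (x₀ : Plane) (y : Plane) : Plane := (1 - s) • y + s • x₀

lemma eLpNorm_two_eq {α : Type*} [MeasurableSpace α] {μ : Measure α} {f : α → ℝ}
    (hf : MemLp f 2 μ) : eLpNorm f 2 μ = ENNReal.ofReal √(∫ x, f x ^ 2 ∂μ) := by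
  rw [← norm_toLp_two hf, Lp.norm_toLp, ENNReal.ofReal_toReal hf.2.ne]

lemma contDiff_contraction (s : ℝ) (x₀ : Plane) : ContDiff ℝ ∞ (contraction s x₀) := by
  unfold contraction; fun_prop

lemma integrable_comp_contraction {s : ℝ} (hs : s < 1) (x₀ : Plane) {F : Plane → ℝ}
    (hF : Integrable F) : Integrable (fun y => F (contraction s x₀ y)) :=
  (hF.comp_add_right (s • x₀)).comp_smul (R := 1 - s) (by linarith)

lemma integral_comp_contraction (s : ℝ) (x₀ : Plane) (F : Plane → ℝ) :
    ∫ y, F (contraction s x₀ y) = ((1 - s) ^ 2)⁻¹ * ∫ y, F y := by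
  have := Measure.integral_comp_smul volume (fun y => F (y + s • x₀)) (1 - s)
  rw [integral_add_right_eq_self (μ := (volume : Measure Plane)) F] at this
  simp only [contraction]
  rw [this]
  simp

/-- By Jensen the square is dominated by the mollified square, whose integral is that of `G ^ 2`.
The contraction costs the Jacobian `(1 - s)⁻² ≤ 4`, hence the factor `2` in the norm, uniform in `φ`
and `s`. -/
lemma eLpNorm_mollify_contraction_le (φ : ContDiffBump (0 : Plane)) {s : ℝ} (hs : s ≤ 1 / 2)
    (x₀ : Plane) {G : Plane → ℝ} (hG : MemLp G 2) :
    MemLp (fun y => mollify φ G (contraction s x₀ y)) 2 ∧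
    eLpNorm (fun y => mollify φ G (contraction s x₀ y)) 2 volume ≤ 2 * eLpNorm G 2 volume := by
  have hc : Continuous (mollify φ G) :=
    (contDiff_mollify φ (hG.locallyIntegrable (by norm_num))).continuous
  have hi : Integrable (mollify φ fun y => G y ^ 2) :=
    Integrable.integrable_convolution _ φ.integrable_normed hG.integrable_sq
  have h2 : ∫ x, mollify φ (fun y => G y ^ 2) x = ∫ x, G x ^ 2 := by
    unfold mollify
    rw [integral_convolution _ φ.integrable_normed hG.integrable_sq, φ.integral_normed]
    simp
  have hi2 := integrable_comp_contraction (by linarith : s < 1) x₀ hi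
  have hcc : Continuous fun y => mollify φ G (contraction s x₀ y) :=
    hc.comp (contDiff_contraction s x₀).continuous
  have hI : Integrable fun y => mollify φ G (contraction s x₀ y) ^ 2 :=
    hi2.mono' (hcc.pow 2).aestronglyMeasurable (Eventually.of_forall fun y => by
      rw [Real.norm_of_nonneg (sq_nonneg _)]; exact mollify_sq_le φ hG _)
  have hm : MemLp (fun y => mollify φ G (contraction s x₀ y)) 2 :=
    (memLp_two_iff_integrable_sq hcc.aestronglyMeasurable).2 hI
  refine ⟨hm, ?_⟩
  rw [eLpNorm_two_eq hm, eLpNorm_two_eq hG]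
  have h3 : (2 : ℝ≥0∞) = ENNReal.ofReal 2 := by simp
  refine le_of_le_of_eq ?_ (congrArg (· * _) h3.symm)
  beta_reduce
  rw [← ENNReal.ofReal_mul (by norm_num)]
  refine ENNReal.ofReal_le_ofReal ?_
  rw [show (2 : ℝ) = √(2 ^ 2) by simp, ← Real.sqrt_mul (by positivity)]
  refine Real.sqrt_le_sqrt ?_
  calc ∫ y, mollify φ G (contraction s x₀ y) ^ 2
      ≤ ∫ y, mollify φ (fun y => G y ^ 2) (contraction s x₀ y) :=
        integral_mono hI hi2 fun y => mollify_sq_le φ hG _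
    _ = ((1 - s) ^ 2)⁻¹ * ∫ x, G x ^ 2 := by
        rw [integral_comp_contraction s x₀ (mollify φ fun y => G y ^ 2), h2]
    _ ≤ 2 ^ 2 * ∫ x, G x ^ 2 := by
        refine mul_le_mul_of_nonneg_right ?_ (integral_nonneg fun x => sq_nonneg (G x))
        rw [inv_le_comm₀ (by nlinarith) (by norm_num)]
        nlinarith

/-- The bump function of radius `s * r`. -/
def scaledBump (r s : ℝ) (hr : 0 < r) (hs : 0 < s) : ContDiffBump (0 : Plane) where
  rIn := s * r / 2
  rOut := s * r
  rIn_pos := by positivity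
  rIn_lt_rOut := by have := mul_pos hs hr; linarith

lemma dist_contraction_le (s : ℝ) (x₀ y : Plane) : dist (contraction s x₀ y) y = |s| * dist x₀ y := by
  rw [dist_eq_norm, dist_eq_norm, ← Real.norm_eq_abs, ← norm_smul]
  congr 1
  simp only [contraction]
  module

/-- The operators are uniformly bounded on `L²`, so convergence need only be checked on continuous
functions of compact support, where it is uniform. -/
lemma tendstoL2_mollify {Ω : Set Plane} (hb : Bornology.IsBounded Ω) (hΩ : MeasurableSet Ω)
    {r : ℝ} (hr : 0 < r) (x₀ : Plane)
    {s : ℕ → ℝ} (hs0 : ∀ n, 0 < s n) (hs : ∀ n, s n ≤ 1 / 2) (hst : Tendsto s atTop (𝓝 0))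
    {G : Plane → ℝ} (hG : MemLp G 2) :
    TendstoL2 (volume.restrict Ω)
      (fun n y => mollify (scaledBump r (s n) hr (hs0 n)) G (contraction (s n) x₀ y)) G := by
  obtain ⟨R, hR⟩ := hb.subset_closedBall x₀
  have hfin : volume Ω < ⊤ := hb.measure_lt_top
  rw [TendstoL2, ENNReal.tendsto_nhds_zero]
  intro ε hε
  -- With `S` the smoothing operator and `H` the continuous approximation, the budget is `δ` for `G
  -- - H`, `δ` for `H - S H`, and `2 δ` for `S (G - H)`.
  obtain ⟨δ, hδ0, hδ⟩ : ∃ δ : ℝ≥0∞, 0 < δ ∧ 4 * δ ≤ ε := by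
    refine ⟨ε / 4, ENNReal.div_pos hε.ne' (by simp), ?_⟩
    exact ENNReal.mul_div_le
  obtain ⟨H, hHc, hGH, hHcont, hHm⟩ := hG.exists_hasCompactSupport_eLpNorm_sub_le
    (by norm_num) hδ0.ne'
  have hHu := hHc.uniformContinuous_of_continuous hHcont
  obtain ⟨η, hη, hη'⟩ : ∃ η : ℝ, 0 < η ∧
      volume Ω ^ (2 : ℝ≥0∞).toReal⁻¹ * ENNReal.ofReal η ≤ δ := by
    have ht : Tendsto (fun η : ℝ => volume Ω ^ (2 : ℝ≥0∞).toReal⁻¹ * ENNReal.ofReal η)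
        (𝓝[>] 0) (𝓝 0) := by
      have h1 : Tendsto (fun η : ℝ => ENNReal.ofReal η) (𝓝[>] 0) (𝓝 0) := by
        have := (ENNReal.continuous_ofReal.tendsto (0 : ℝ)).mono_left
          (nhdsWithin_le_nhds (s := Set.Ioi 0))
        simpa using this
      simpa using ENNReal.Tendsto.const_mul h1
        (Or.inr (ENNReal.rpow_ne_top_of_nonneg (by simp) hfin.ne))
    have := (ENNReal.tendsto_nhds_zero.1 ht δ hδ0).and self_mem_nhdsWithin
    obtain ⟨η, h1, h2⟩ := this.exists
    exact ⟨η, h2, h1⟩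
  obtain ⟨d, hd, hd'⟩ := Metric.uniformContinuous_iff.1 hHu (η / 2) (by positivity)
  -- One bound for two displacements: at most `s n * R` from the contraction and `s n * r` from the
  -- bump.
  have hsmall : ∀ᶠ n in atTop, s n * (r + R + 1) < d := by
    have := hst.mul_const (r + R + 1)
    rw [zero_mul] at this
    exact this.eventually_lt_const hd
  filter_upwards [hsmall] with n hn
  set φ := scaledBump r (s n) hr (hs0 n)
  set S : (Plane → ℝ) → Plane → ℝ := fun F y => mollify φ F (contraction (s n) x₀ y) with hS
  have hGl := hG.locallyIntegrable (μ := volume) (by norm_num)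
  have hHl := hHm.locallyIntegrable (μ := volume) (by norm_num)
  have e : (fun y => G y - S G y) = fun y => ((G - H) y + (H y - S H y)) - S (G - H) y := by
    funext y
    simp only [hS, mollify_sub φ hGl hHl]
    simp
  have b1 : eLpNorm (G - H) 2 (volume.restrict Ω) ≤ δ :=
    (eLpNorm_mono_measure _ Measure.restrict_le_self).trans hGH
  obtain ⟨m3, b3⟩ := eLpNorm_mollify_contraction_le φ (hs n) x₀ (hG.sub hHm)
  have b3' : eLpNorm (S (G - H)) 2 (volume.restrict Ω) ≤ 2 * δ :=
    (eLpNorm_mono_measure _ Measure.restrict_le_self).trans (b3.trans (by gcongr))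
  have b2 : eLpNorm (fun y => H y - S H y) 2 (volume.restrict Ω) ≤ δ := by
    have : ∀ᵐ y ∂(volume.restrict Ω), ‖H y - S H y‖ ≤ η := by
      refine (ae_restrict_iff' hΩ).2 (Eventually.of_forall fun y hy => ?_)
      have hdist := φ.dist_normed_convolution_le (μ := volume) (g := H)
        (x₀ := contraction (s n) x₀ y) (ε := η / 2) hHcont.aestronglyMeasurable (by
          intro z hz
          refine (hd' ?_).le
          refine (Metric.mem_ball.1 hz).trans_le ?_
          change s n * r ≤ d
          have h0 : 0 ≤ R := dist_nonneg.trans (Metric.mem_closedBall.1 (hR hy))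
          nlinarith [hs0 n])
      have h2 : dist (H (contraction (s n) x₀ y)) (H y) ≤ η / 2 := by
        refine (hd' ?_).le
        rw [dist_contraction_le, abs_of_pos (hs0 n), dist_comm]
        have h0 := Metric.mem_closedBall.1 (hR hy)
        nlinarith [hs0 n]
      rw [← dist_eq_norm, dist_comm]
      refine (dist_triangle _ (H (contraction (s n) x₀ y)) _).trans ?_
      have : dist (S H y) (H (contraction (s n) x₀ y)) ≤ η / 2 := hdist
      linarith
    refine (eLpNorm_le_of_ae_bound this).trans ?_
    simpa using hη'
  have c2 : AEStronglyMeasurable (fun y => H y - S H y) (volume.restrict Ω) := by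
    refine Continuous.aestronglyMeasurable ?_
    exact hHcont.sub ((contDiff_mollify φ hHl).continuous.comp
      (contDiff_contraction _ _).continuous)
  have c1 : AEStronglyMeasurable (G - H) (volume.restrict Ω) := (hG.sub hHm).1.restrict
  have c3 : AEStronglyMeasurable (S (G - H)) (volume.restrict Ω) := m3.1.restrict
  calc eLpNorm (fun y => G y - S G y) 2 (volume.restrict Ω)
      ≤ eLpNorm (fun y => (G - H) y + (H y - S H y)) 2 (volume.restrict Ω) +
        eLpNorm (S (G - H)) 2 (volume.restrict Ω) := by
        rw [e]; exact eLpNorm_sub_le (c1.add c2) c3 (by norm_num)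
    _ ≤ (eLpNorm (G - H) 2 (volume.restrict Ω) +
        eLpNorm (fun y => H y - S H y) 2 (volume.restrict Ω)) + 2 * δ := by
        gcongr
        exact eLpNorm_add_le c1 c2 (by norm_num)
    _ ≤ (δ + δ) + 2 * δ := by gcongr
    _ = 4 * δ := by ring
    _ ≤ ε := hδ

/-- Because the ball lies in `Ω`, the reflected bump `y ↦ φ (x - y)` is a test function on `Ω`. The
minus sign from differentiating in `y` cancels the one in the definition of the weak derivative. -/
lemma partialDeriv_mollify {Ω : Set Plane} (hΩ : MeasurableSet Ω) {i : Fin 2} {u g : Plane → ℝ}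
    (h : HasWeakDeriv Ω i u g) (φ : ContDiffBump (0 : Plane)) {x : Plane}
    (hu : LocallyIntegrable (Ω.indicator u))
    (hx : Metric.closedBall x φ.rOut ⊆ Ω) :
    partialDeriv i (mollify φ (Ω.indicator u)) x = mollify φ (Ω.indicator g) x := by
  have hf := φ.hasCompactSupport_normed.hasFDerivAt_convolution_left
    (ContinuousLinearMap.lsmul ℝ ℝ) (φ.contDiff_normed (μ := volume) (n := 1)) hu x
  set ψ : Plane → ℝ := fun y => φ.normed volume (x - y) with hψ
  have hts : tsupport ψ = (fun y => x - y) ⁻¹' tsupport (φ.normed volume) :=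
    tsupport_comp_eq_preimage (φ.normed volume) (Homeomorph.subLeft x)
  have htest : IsTestFun Ω ψ := by
    refine ⟨(φ.contDiff_normed (n := (⊤ : ℕ∞))).comp (contDiff_const.sub contDiff_id), ?_, ?_⟩
    · exact φ.hasCompactSupport_normed.comp_homeomorph (Homeomorph.subLeft x)
    · rw [hts, φ.tsupport_normed_eq]
      intro y hy
      apply hx
      simpa [dist_eq_norm, norm_sub_rev] using hy
  have key := h.2.2 ψ htest
  have hd : ∀ y, partialDeriv i ψ y = -partialDeriv i (φ.normed volume) (x - y) := by
    intro y
    have h1 : HasFDerivAt (φ.normed volume) (fderiv ℝ (φ.normed volume) (x - y)) (x - y) :=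
      ((φ.contDiff_normed (n := 1)).differentiable one_ne_zero _).hasFDerivAt
    have h2 := h1.comp y ((hasFDerivAt_const x y).sub (hasFDerivAt_id y))
    unfold partialDeriv
    rw [show ψ = φ.normed volume ∘ (fun y => x - y) from rfl]
    erw [h2.fderiv]
    simp
  have e1 : partialDeriv i (mollify φ (Ω.indicator u)) x =
      ∫ y, partialDeriv i (φ.normed volume) (x - y) * Ω.indicator u y := by
    unfold partialDeriv mollify
    rw [hf.fderiv, convolution_eq_swap]
    rw [ContinuousLinearMap.integral_apply]
    · rfl
    · have := ((φ.hasCompactSupport_normed (μ := volume)).fderiv ℝ).convolutionExists_left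
        (ContinuousLinearMap.precompL Plane (ContinuousLinearMap.lsmul ℝ ℝ))
        ((φ.contDiff_normed (n := 1)).continuous_fderiv one_ne_zero) hu x
      exact this.integrable_swap
  have e2 : ∀ y, partialDeriv i (φ.normed volume) (x - y) * Ω.indicator u y =
      Ω.indicator (fun y => -(u y * partialDeriv i ψ y)) y := by
    intro y
    by_cases hy : y ∈ Ω <;> simp [hy, hd, mul_comm]
  rw [e1]
  simp_rw [e2]
  rw [integral_indicator hΩ, integral_neg, key, neg_neg, mollify, convolution_eq_swap,
    ← integral_indicator hΩ]
  refine integral_congr_ae (Eventually.of_forall fun y => ?_)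
  by_cases hy : y ∈ Ω <;> simp [hy, hψ, mul_comm]

/-- Smooth functions on the plane are dense in `H¹` of a bounded convex open set. -/
theorem exists_smooth_tendsto {Ω : Set Plane} (ho : IsOpen Ω) (hc : Convex ℝ Ω)
    (hb : Bornology.IsBounded Ω) {u : Plane → ℝ} {g : Fin 2 → Plane → ℝ} (hu : MemL2 Ω u)
    (hg : ∀ i, MemL2 Ω (g i)) (h : ∀ i, HasWeakDeriv Ω i u (g i)) :
    ∃ v : ℕ → Plane → ℝ, (∀ n, ContDiff ℝ ∞ (v n)) ∧ TendstoL2 (volume.restrict Ω) v u ∧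
      ∀ i, TendstoL2 (volume.restrict Ω) (fun n => partialDeriv i (v n)) (g i) := by
  have hm := ho.measurableSet
  rcases Ω.eq_empty_or_nonempty with rfl | ⟨x₀, hx₀⟩
  · exact ⟨fun _ _ => 0, fun _ => contDiff_const, by simp [TendstoL2], by simp [TendstoL2]⟩
  obtain ⟨r, hr, hball⟩ := Metric.isOpen_iff.1 ho x₀ hx₀
  have hr2 : 0 < r / 2 := by positivity
  set s : ℕ → ℝ := fun n => 1 / ((n : ℝ) + 2) with hs
  have hs0 : ∀ n, 0 < s n := fun n => by positivity
  have hs1 : ∀ n, s n ≤ 1 / 2 := fun n => by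
    simp only [hs]; gcongr; have : (0 : ℝ) ≤ n := n.cast_nonneg
    linarith
  have hst : Tendsto s atTop (𝓝 0) := by
    have := (tendsto_add_atTop_iff_nat 1).2 (tendsto_one_div_add_atTop_nhds_zero_nat (𝕜 := ℝ))
    refine this.congr fun n => ?_
    simp only [hs]; push_cast; ring
  have hind : ∀ {f : Plane → ℝ}, MemL2 Ω f → MemLp (Ω.indicator f) 2 := fun hf =>
    (memLp_indicator_iff_restrict hm).2 hf
  have hcong : ∀ {F : ℕ → Plane → ℝ} {f : Plane → ℝ},
      TendstoL2 (volume.restrict Ω) F (Ω.indicator f) → TendstoL2 (volume.restrict Ω) F f := by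
    intro F f hF
    refine hF.congr fun n => eLpNorm_congr_ae ?_
    refine (ae_restrict_iff' hm).2 (Eventually.of_forall fun y hy => ?_)
    simp [hy]
  set φ : ℕ → ContDiffBump (0 : Plane) := fun n => scaledBump (r / 2) (s n) hr2 (hs0 n) with hφ
  have hul : LocallyIntegrable (Ω.indicator u) :=
    (hind hu).locallyIntegrable (by norm_num)
  -- Convexity enters here: a point of this ball is `(1 - s) y + s (x₀ + w)` with `‖w‖ < r`.
  -- Contracting towards `x₀` thus makes room for the mollifier, even for `y` near the boundary.
  have hsub : ∀ n, ∀ y ∈ Ω,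
      Metric.closedBall (contraction (s n) x₀ y) (φ n).rOut ⊆ Ω := by
    intro n y hy z hz
    have hz' : dist z (contraction (s n) x₀ y) ≤ s n * (r / 2) := hz
    set w := (s n)⁻¹ • (z - contraction (s n) x₀ y) with hw
    have hwn : ‖w‖ < r := by
      rw [hw, norm_smul, Real.norm_of_nonneg (inv_nonneg.2 (hs0 n).le), ← dist_eq_norm,
        inv_mul_lt_iff₀ (hs0 n)]
      nlinarith [hs0 n]
    have hz2 : z = (1 - s n) • y + s n • (x₀ + w) := by
      rw [smul_add, hw, smul_smul, mul_inv_cancel₀ (hs0 n).ne', one_smul, contraction]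
      module
    rw [hz2]
    exact hc hy (hball (by simpa [dist_eq_norm] using hwn)) (by linarith [hs1 n]) (hs0 n).le
      (by ring)
  refine ⟨fun n y => mollify (φ n) (Ω.indicator u) (contraction (s n) x₀ y), fun n => ?_,
    hcong (tendstoL2_mollify hb hm hr2 x₀ hs0 hs1 hst (hind hu)), fun i => ?_⟩
  · exact (contDiff_mollify _ hul).comp (contDiff_contraction _ _)
  · have hd : ∀ n, ∀ y ∈ Ω,
        partialDeriv i (fun y => mollify (φ n) (Ω.indicator u) (contraction (s n) x₀ y)) y =
        (1 - s n) * mollify (φ n) (Ω.indicator (g i)) (contraction (s n) x₀ y) := by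
      intro n y hy
      rw [← partialDeriv_mollify hm (h i) (φ n) hul (hsub n y hy)]
      have h1 := ((contDiff_mollify (φ n) hul).differentiable (by simp)
        (contraction (s n) x₀ y)).hasFDerivAt
      have h2 : HasFDerivAt (contraction (s n) x₀)
          ((1 - s n) • ContinuousLinearMap.id ℝ Plane) y :=
        ((hasFDerivAt_id y).const_smul (1 - s n)).add_const _
      have h3 := (h1.comp y h2).fderiv
      unfold partialDeriv
      rw [show (fun y => mollify (φ n) (Ω.indicator u) (contraction (s n) x₀ y)) =
        mollify (φ n) (Ω.indicator u) ∘ contraction (s n) x₀ from rfl, h3]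
      simp
    have hT := hcong (tendstoL2_mollify hb hm hr2 x₀ hs0 hs1 hst (hind (hg i)))
    have hL := fun n => eLpNorm_mollify_contraction_le (φ n) (hs1 n) x₀ (hind (hg i))
    set S : ℕ → Plane → ℝ :=
      fun n y => mollify (φ n) (Ω.indicator (g i)) (contraction (s n) x₀ y) with hS
    -- The chain rule produces the factor `1 - s n`. The excess term has norm at most `s n` times a
    -- fixed constant and disappears in the limit.
    have hbound : ∀ n, eLpNorm (fun x => g i x -
        partialDeriv i (fun y => mollify (φ n) (Ω.indicator u) (contraction (s n) x₀ y)) x) 2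
        (volume.restrict Ω) ≤ eLpNorm (fun x => g i x - S n x) 2 (volume.restrict Ω) +
        ENNReal.ofReal (s n) * (2 * eLpNorm (Ω.indicator (g i)) 2 volume) := by
      intro n
      have hcg : eLpNorm (fun x => g i x -
          partialDeriv i (fun y => mollify (φ n) (Ω.indicator u) (contraction (s n) x₀ y)) x) 2
          (volume.restrict Ω) = eLpNorm ((fun x => g i x - S n x) + s n • S n) 2
          (volume.restrict Ω) := by
        refine eLpNorm_congr_ae ((ae_restrict_iff' hm).2 (Eventually.of_forall fun y hy => ?_))
        simp only [hd n y hy, hS, Pi.add_apply, Pi.smul_apply, smul_eq_mul]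
        ring
      rw [hcg]
      refine (eLpNorm_add_le ((hg i).1.sub (hL n).1.1.restrict)
        ((hL n).1.1.restrict.const_smul _) (by norm_num)).trans ?_
      refine add_le_add le_rfl ?_
      rw [eLpNorm_const_smul, Real.enorm_of_nonneg (hs0 n).le]
      gcongr
      exact (eLpNorm_mono_measure _ Measure.restrict_le_self).trans (hL n).2
    refine tendsto_of_tendsto_of_tendsto_of_le_of_le tendsto_const_nhds ?_ (fun _ => zero_le)
      hbound
    have h1 : Tendsto (fun n => ENNReal.ofReal (s n)) atTop (𝓝 0) := by
      simpa [Function.comp_def] using (ENNReal.continuous_ofReal.tendsto _).comp hst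
    have h2 := ENNReal.Tendsto.mul_const (b := 2 * eLpNorm (Ω.indicator (g i)) 2 volume) h1
      (Or.inr (ENNReal.mul_ne_top (by simp) (hind (hg i)).2.ne))
    simpa using hT.add h2

end

section

/-! ### The Poincaré inequality on convex sets -/

/-- The squared Euclidean length of the gradient. -/
def gradSq (g : Plane → ℝ) (x : Plane) : ℝ := ∑ i, partialDeriv i g x ^ 2

lemma continuous_gradSq {g : Plane → ℝ} (hg : ContDiff ℝ 1 g) : Continuous (gradSq g) :=
  continuous_finsetSum _ fun i _ => (continuous_partialDeriv hg i).pow 2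

lemma fderiv_apply_eq_sum (g : Plane → ℝ) (x v : Plane) :
    fderiv ℝ g x v = ∑ i, v i * partialDeriv i g x := by
  have h : v = ∑ i, v i • (EuclideanSpace.single i (1 : ℝ) : Plane) := by
    ext j; fin_cases j <;> simp
  conv_lhs => rw [h]
  simp [partialDeriv]

/-- Fundamental theorem of calculus along the segment, then Jensen in `t`, then Cauchy–Schwarz for
the directional derivative. -/
lemma sq_sub_le_integral {g : Plane → ℝ} (hg : ContDiff ℝ 1 g) (x y : Plane) :
    (g x - g y) ^ 2 ≤ dist x y ^ 2 * ∫ t in (0 : ℝ)..1, gradSq g (y + t • (x - y)) := by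
  have hline : ∀ t : ℝ, HasDerivAt (fun t : ℝ => y + t • (x - y)) (x - y) t := fun t => by
    simpa using ((hasDerivAt_id t).smul_const (x - y)).const_add y
  have hder : ∀ t : ℝ, HasDerivAt (fun t : ℝ => g (y + t • (x - y)))
      (fderiv ℝ g (y + t • (x - y)) (x - y)) t := fun t =>
    ((hg.differentiable one_ne_zero _).hasFDerivAt).comp_hasDerivAt t (hline t)
  have hlc : Continuous fun t : ℝ => y + t • (x - y) := by fun_prop
  have hcont : Continuous fun t : ℝ => fderiv ℝ g (y + t • (x - y)) (x - y) :=
    ((hg.continuous_fderiv one_ne_zero).comp hlc).clm_apply continuous_const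
  have hftc := intervalIntegral.integral_eq_sub_of_hasDerivAt (a := 0) (b := 1)
    (fun t _ => hder t) (hcont.intervalIntegrable 0 1)
  simp only [one_smul, zero_smul, add_zero, add_sub_cancel] at hftc
  rw [← hftc]
  set f : ℝ → ℝ := fun t => fderiv ℝ g (y + t • (x - y)) (x - y) with hf
  set m := ∫ t in (0 : ℝ)..1, f t with hm
  have h1 : m ^ 2 ≤ ∫ t in (0 : ℝ)..1, f t ^ 2 := by
    have h0 : 0 ≤ ∫ t in (0 : ℝ)..1, (f t - m) ^ 2 :=
      intervalIntegral.integral_nonneg zero_le_one fun t _ => sq_nonneg _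
    have e : ∀ t, (f t - m) ^ 2 = f t ^ 2 - 2 * m * f t + m ^ 2 := fun t => by ring
    simp_rw [e] at h0
    rw [intervalIntegral.integral_add
      (Continuous.intervalIntegrable (by fun_prop) _ _) (by simp),
      intervalIntegral.integral_sub
      (Continuous.intervalIntegrable (by fun_prop) _ _)
      (Continuous.intervalIntegrable (by fun_prop) _ _),
      intervalIntegral.integral_const_mul, ← hm] at h0
    simp at h0
    nlinarith
  refine h1.trans ?_
  rw [← intervalIntegral.integral_const_mul]
  have hgc : Continuous fun t : ℝ => gradSq g (y + t • (x - y)) := (continuous_gradSq hg).comp hlc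
  refine intervalIntegral.integral_mono_on zero_le_one
    (Continuous.intervalIntegrable (by fun_prop) _ _)
    (Continuous.intervalIntegrable (by fun_prop) _ _) fun t _ => ?_
  rw [hf]
  beta_reduce
  rw [fderiv_apply_eq_sum, dist_eq_norm, EuclideanSpace.norm_sq_eq, gradSq]
  simp only [Real.norm_eq_abs, sq_abs]
  exact Finset.sum_mul_sq_le_sq_mul_sq _ _ _

lemma lintegral_comp_contraction {s : ℝ} (hs : s < 1) (x₀ : Plane) {F : Plane → ℝ≥0∞}
    (hF : Measurable F) :
    ∫⁻ y, F (contraction s x₀ y) = ENNReal.ofReal ((1 - s) ^ 2)⁻¹ * ∫⁻ y, F y := by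
  have h1 : ∫⁻ y, F (contraction s x₀ y) =
      ∫⁻ y, F (y + s • x₀) ∂(Measure.map (fun y : Plane => (1 - s) • y) volume) := by
    rw [lintegral_map (f := fun y => F (y + s • x₀)) (hF.comp (measurable_add_const _))
      (measurable_const_smul _)]
    rfl
  rw [h1, Measure.map_addHaar_smul _ (by linarith), lintegral_smul_measure,
    lintegral_add_right_eq_self]
  simp only [finrank_euclideanSpace, Fintype.card_fin, smul_eq_mul]
  rw [abs_of_nonneg (by positivity)]

lemma lintegral_contraction_le {K : Set Plane} (hK : IsOpen K) (hc : Convex ℝ K) {s : ℝ}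
    (hs0 : 0 ≤ s) (hs : s ≤ 1 / 2) {y : Plane} (hy : y ∈ K) {F : Plane → ℝ≥0∞}
    (hF : Measurable F) :
    ∫⁻ x in K, F (contraction s y x) ≤ 4 * ∫⁻ x in K, F x := by
  have h1 : ∀ x, K.indicator (fun x => F (contraction s y x)) x ≤
      K.indicator F (contraction s y x) := by
    intro x
    by_cases hx : x ∈ K
    · have : contraction s y x ∈ K := hc hx hy (by linarith) hs0 (by ring)
      simp [hx, this]
    · simp [hx]
  rw [← lintegral_indicator hK.measurableSet, ← lintegral_indicator hK.measurableSet]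
  refine (lintegral_mono h1).trans ?_
  rw [lintegral_comp_contraction (by linarith) y (hF.indicator hK.measurableSet)]
  gcongr
  rw [show (4 : ℝ≥0∞) = ENNReal.ofReal 4 by simp]
  refine ENNReal.ofReal_le_ofReal ?_
  rw [inv_le_comm₀ (by nlinarith) (by norm_num)]
  nlinarith

/-- For fixed `t` the point `y + t (x - y)` is a contraction of `y` towards `x` with ratio `1 - t`,
and of `x` towards `y` with ratio `t`. Substituting in the variable whose ratio is at least `1/2`
keeps the Jacobian at most `4`; convexity keeps the image in `K`. -/
lemma lintegral_segment_le {K : Set Plane} (hK : IsOpen K) (hc : Convex ℝ K) {t : ℝ}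
    (ht0 : 0 ≤ t) (ht1 : t ≤ 1) {F : Plane → ℝ≥0∞} (hF : Measurable F) :
    ∫⁻ x in K, ∫⁻ y in K, F (y + t • (x - y)) ≤ 4 * volume K * ∫⁻ x in K, F x := by
  have hb : ∀ c : ℝ≥0∞, ∫⁻ _ in K, c = volume K * c := fun c => by
    rw [setLIntegral_const, mul_comm]
  rcases le_total t (1 / 2) with h | h
  · calc ∫⁻ x in K, ∫⁻ y in K, F (y + t • (x - y)) ≤ ∫⁻ x in K, 4 * ∫⁻ x in K, F x := by
          refine setLIntegral_mono measurable_const fun x hx => ?_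
          refine le_trans (le_of_eq ?_) (lintegral_contraction_le hK hc ht0 h hx hF)
          congr 1; funext y; congr 1; simp only [contraction]; module
      _ = _ := by rw [hb]; ring
  · have hm : Measurable (Function.uncurry fun x y : Plane => F (y + t • (x - y))) :=
      hF.comp (Continuous.measurable (by fun_prop))
    rw [lintegral_lintegral_swap hm.aemeasurable]
    calc ∫⁻ y in K, ∫⁻ x in K, F (y + t • (x - y)) ≤ ∫⁻ x in K, 4 * ∫⁻ x in K, F x := by
          refine setLIntegral_mono measurable_const fun y hy => ?_
          refine le_trans (le_of_eq ?_)
            (lintegral_contraction_le hK hc (s := 1 - t) (by linarith) (by linarith) hy hF)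
          congr 1; funext x; congr 1; simp only [contraction]; module
      _ = _ := by rw [hb]; ring

/-- The segment bound is integrated over both endpoints, with the integral over `t` moved outside.
In `ℝ≥0∞` the exchange of integrals requires only measurability. -/
lemma lintegral_sq_sub_le {K : Set Plane} (hK : IsOpen K) (hc : Convex ℝ K) {d : ℝ}
    (hd : ∀ x ∈ K, ∀ y ∈ K, dist x y ≤ d) {g : Plane → ℝ} (hg : ContDiff ℝ 1 g) :
    ∫⁻ x in K, ∫⁻ y in K, ENNReal.ofReal ((g x - g y) ^ 2) ≤
      ENNReal.ofReal (d ^ 2) * (4 * volume K * ∫⁻ x in K, ENNReal.ofReal (gradSq g x)) := by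
  have hGc := continuous_gradSq hg
  set F : Plane → ℝ≥0∞ := fun x => ENNReal.ofReal (gradSq g x) with hF
  have hFm : Measurable F := hGc.measurable.ennreal_ofReal
  have hpt : ∀ x ∈ K, ∀ y ∈ K, ENNReal.ofReal ((g x - g y) ^ 2) ≤
      ENNReal.ofReal (d ^ 2) * ∫⁻ t in Set.Ioc (0 : ℝ) 1, F (y + t • (x - y)) := by
    intro x hx y hy
    have hnn : ∀ z, 0 ≤ gradSq g z := fun z => Finset.sum_nonneg fun i _ => sq_nonneg _
    have hlc : Continuous fun t : ℝ => gradSq g (y + t • (x - y)) :=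
      hGc.comp (by fun_prop)
    rw [hF, ← ofReal_integral_eq_lintegral_ofReal
      (hlc.integrableOn_Icc.mono_set Set.Ioc_subset_Icc_self)
      (Eventually.of_forall fun t => hnn _), ← ENNReal.ofReal_mul (sq_nonneg _)]
    refine ENNReal.ofReal_le_ofReal ((sq_sub_le_integral hg x y).trans ?_)
    rw [intervalIntegral.integral_of_le zero_le_one]
    refine mul_le_mul_of_nonneg_right ?_ (integral_nonneg fun t => hnn _)
    exact pow_le_pow_left₀ dist_nonneg (hd x hx y hy) 2
  have m3 : Measurable (fun p : (Plane × Plane) × ℝ => F (p.1.2 + p.2 • (p.1.1 - p.1.2))) :=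
    hFm.comp (g := F) (f := fun p : (Plane × Plane) × ℝ => p.1.2 + p.2 • (p.1.1 - p.1.2))
        (Continuous.measurable (by fun_prop))
  have m2 : Measurable (fun p : Plane × Plane =>
      ∫⁻ t in Set.Ioc (0 : ℝ) 1, F (p.2 + t • (p.1 - p.2))) := m3.lintegral_prod_right'
  have m2' : ∀ x : Plane, Measurable fun y : Plane =>
      ∫⁻ t in Set.Ioc (0 : ℝ) 1, F (y + t • (x - y)) := fun x =>
    m2.comp (f := fun y : Plane => (x, y)) measurable_prodMk_left
  have m1 : Measurable fun x : Plane =>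
      ∫⁻ y in K, ∫⁻ t in Set.Ioc (0 : ℝ) 1, F (y + t • (x - y)) := m2.lintegral_prod_right'
  calc ∫⁻ x in K, ∫⁻ y in K, ENNReal.ofReal ((g x - g y) ^ 2)
      ≤ ∫⁻ x in K, ∫⁻ y in K,
          ENNReal.ofReal (d ^ 2) * ∫⁻ t in Set.Ioc (0 : ℝ) 1, F (y + t • (x - y)) := by
        refine setLIntegral_mono ?_ fun x hx => ?_
        · exact (m2.const_mul (ENNReal.ofReal (d ^ 2))).lintegral_prod_right'
        · exact setLIntegral_mono ((m2' x).const_mul _)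
            fun y hy => hpt x hx y hy
    _ = ENNReal.ofReal (d ^ 2) *
          ∫⁻ x in K, ∫⁻ y in K, ∫⁻ t in Set.Ioc (0 : ℝ) 1, F (y + t • (x - y)) := by
        have e1 : ∀ x : Plane, ∫⁻ y in K, ENNReal.ofReal (d ^ 2) *
            ∫⁻ t in Set.Ioc (0 : ℝ) 1, F (y + t • (x - y)) = ENNReal.ofReal (d ^ 2) *
            ∫⁻ y in K, ∫⁻ t in Set.Ioc (0 : ℝ) 1, F (y + t • (x - y)) := fun x =>
          lintegral_const_mul _ (m2' x)
        simp_rw [e1]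
        exact lintegral_const_mul _ m1
    _ = ENNReal.ofReal (d ^ 2) *
          ∫⁻ t in Set.Ioc (0 : ℝ) 1, ∫⁻ x in K, ∫⁻ y in K, F (y + t • (x - y)) := by
        congr 1
        have e1 : ∀ x : Plane, ∫⁻ y in K, ∫⁻ t in Set.Ioc (0 : ℝ) 1, F (y + t • (x - y)) =
            ∫⁻ t in Set.Ioc (0 : ℝ) 1, ∫⁻ y in K, F (y + t • (x - y)) := by
          intro x
          have hm : Measurable (Function.uncurry fun (y : Plane) (t : ℝ) =>
              F (y + t • (x - y))) :=
            hFm.comp (g := F) (f := fun p : Plane × ℝ => p.1 + p.2 • (x - p.1))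
              (Continuous.measurable (by fun_prop))
          exact lintegral_lintegral_swap hm.aemeasurable
        simp_rw [e1]
        have m4 : Measurable (fun p : (Plane × ℝ) × Plane => F (p.2 + p.1.2 • (p.1.1 - p.2))) :=
          hFm.comp (g := F) (f := fun p : (Plane × ℝ) × Plane => p.2 + p.1.2 • (p.1.1 - p.2))
            (Continuous.measurable (by fun_prop))
        have m5 : Measurable (Function.uncurry fun (x : Plane) (t : ℝ) =>
            ∫⁻ y in K, F (y + t • (x - y))) := m4.lintegral_prod_right'
        exact lintegral_lintegral_swap m5.aemeasurable
    _ ≤ ENNReal.ofReal (d ^ 2) *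
          ∫⁻ t in Set.Ioc (0 : ℝ) 1, 4 * volume K * ∫⁻ x in K, F x := by
        refine mul_le_mul_right (setLIntegral_mono measurable_const fun t ht => ?_) _
        exact lintegral_segment_le hK hc ht.1.le ht.2 hFm
    _ = _ := by simp

/-- The double integral of `(g x - g y) ^ 2` is exactly twice the left-hand side, so the factor `4`
of the segment bound becomes `2`. -/
lemma poincare_smooth {K : Set Plane} (hK : IsOpen K) (hc : Convex ℝ K)
    (hb : Bornology.IsBounded K) {d : ℝ}
    (hd : ∀ x ∈ K, ∀ y ∈ K, dist x y ≤ d) {g : Plane → ℝ} (hg : ContDiff ℝ 1 g) :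
    volume.real K * (∫ x in K, g x ^ 2) - (∫ x in K, g x) ^ 2 ≤
      2 * d ^ 2 * volume.real K * ∫ x in K, gradSq g x := by
  have hGc := continuous_gradSq hg
  have hfin : volume K ≠ ⊤ := hb.measure_lt_top.ne
  have hgc := hg.continuous
  have i1 : Integrable g (volume.restrict K) := integrableOn_of_continuous hb hgc
  have i2 : Integrable (fun x => g x ^ 2) (volume.restrict K) :=
    integrableOn_of_continuous hb (hgc.pow 2)
  have : IsFiniteMeasure (volume.restrict K) := ⟨by simpa using hb.measure_lt_top⟩
  set V := volume.real K with hV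
  set A := ∫ x in K, g x with hA
  set B := ∫ x in K, g x ^ 2 with hB
  have e1 : ∀ x, ∫ y in K, (g x - g y) ^ 2 = V * g x ^ 2 - 2 * g x * A + B := by
    intro x
    have e : ∀ y, (g x - g y) ^ 2 = g x ^ 2 - 2 * g x * g y + g y ^ 2 := fun y => by ring
    simp_rw [e]
    have i3 : Integrable (fun y => g x ^ 2 - 2 * g x * g y) (volume.restrict K) :=
      (integrable_const _).sub (i1.const_mul _)
    rw [integral_add i3 i2, integral_sub (integrable_const _) (i1.const_mul _),
      integral_const_mul, setIntegral_const, smul_eq_mul]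
  have e2 : ∫ x in K, (V * g x ^ 2 - 2 * g x * A + B) = 2 * (V * B - A ^ 2) := by
    have e : ∀ x, V * g x ^ 2 - 2 * g x * A + B = V * g x ^ 2 - 2 * A * g x + B :=
      fun x => by ring
    simp_rw [e]
    have i3 : Integrable (fun y => V * g y ^ 2 - 2 * A * g y) (volume.restrict K) :=
      (i2.const_mul _).sub (i1.const_mul _)
    rw [integral_add i3 (integrable_const _), integral_sub (i2.const_mul _) (i1.const_mul _),
      integral_const_mul, integral_const_mul, setIntegral_const, smul_eq_mul]
    ring
  have h := lintegral_sq_sub_le hK hc hd hg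
  have e3 : ∀ x, ∫⁻ y in K, ENNReal.ofReal ((g x - g y) ^ 2) =
      ENNReal.ofReal (V * g x ^ 2 - 2 * g x * A + B) := by
    intro x
    rw [← e1, ofReal_integral_eq_lintegral_ofReal
      (integrableOn_of_continuous hb (by fun_prop)) (Eventually.of_forall fun y => sq_nonneg _)]
  have hnn : ∀ x, 0 ≤ V * g x ^ 2 - 2 * g x * A + B := fun x => by
    rw [← e1]; exact integral_nonneg fun y => sq_nonneg _
  simp_rw [e3] at h
  rw [← ofReal_integral_eq_lintegral_ofReal
      (integrableOn_of_continuous hb (by fun_prop)) (Eventually.of_forall hnn), e2,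
    ← ofReal_integral_eq_lintegral_ofReal (integrableOn_of_continuous hb hGc)
      (Eventually.of_forall fun x => Finset.sum_nonneg fun i _ => sq_nonneg _),
    ← ENNReal.ofReal_toReal hfin, show (4 : ℝ≥0∞) = ENNReal.ofReal 4 by simp,
    ← ENNReal.ofReal_mul (by norm_num), ← ENNReal.ofReal_mul (by positivity),
    ← ENNReal.ofReal_mul (by positivity)] at h
  have hG0 : 0 ≤ ∫ x in K, gradSq g x :=
    integral_nonneg fun x => Finset.sum_nonneg fun i _ => sq_nonneg _
  rw [ENNReal.ofReal_le_ofReal_iff (by positivity)] at h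
  change 2 * (V * B - A ^ 2) ≤ d ^ 2 * (4 * V * _) at h
  linarith

/-- The Poincaré inequality on a bounded convex open set. -/
theorem poincare {K : Set Plane} (hK : IsOpen K) (hc : Convex ℝ K)
    (hb : Bornology.IsBounded K) {d : ℝ}
    (hd : ∀ x ∈ K, ∀ y ∈ K, dist x y ≤ d) {u : Plane → ℝ} {g : Fin 2 → Plane → ℝ}
    (hu : MemL2 K u) (hg : ∀ i, MemL2 K (g i)) (h : ∀ i, HasWeakDeriv K i u (g i)) :
    ∫ x in K, (u x - (∫ y in K, u y) / volume.real K) ^ 2 ≤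
      2 * d ^ 2 * ∑ i, ∫ x in K, g i x ^ 2 := by
  have : IsFiniteMeasure (volume.restrict K) := ⟨by simpa using hb.measure_lt_top⟩
  set V := volume.real K with hV
  -- In this form, free of division, both sides are continuous under convergence in `H¹`.
  have key : V * (∫ x in K, u x ^ 2) - (∫ x in K, u x) ^ 2 ≤
      2 * d ^ 2 * V * ∑ i, ∫ x in K, g i x ^ 2 := by
    obtain ⟨v, hv, hvu, hvg⟩ := exists_smooth_tendsto hK hc hb hu hg h
    have hv1 : ∀ n, ContDiff ℝ 1 (v n) := fun n => (hv n).of_le (by simp)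
    have m0 : ∀ n, MemLp (v n) 2 (volume.restrict K) := fun n =>
      memLp_two_of_continuous hb (hv n).continuous
    have m1 : ∀ i n, MemLp (partialDeriv i (v n)) 2 (volume.restrict K) := fun i n =>
      memLp_two_of_continuous hb (continuous_partialDeriv (hv1 n) i)
    refine le_of_tendsto_of_tendsto'
      (((hvu.integral_sq m0 hu).const_mul V).sub ((hvu.integral m0 hu).pow 2))
      ((tendsto_finsetSum Finset.univ fun i _ =>
        (hvg i).integral_sq (m1 i) (hg i)).const_mul (2 * d ^ 2 * V)) fun n => ?_
    refine (poincare_smooth hK hc hb hd (hv1 n)).trans (le_of_eq ?_)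
    congr 1
    exact integral_finsetSum _ fun i _ => (m1 i n).integrable_sq
  have i1 : Integrable u (volume.restrict K) := hu.integrable (by norm_num)
  have i2 : Integrable (fun x => u x ^ 2) (volume.restrict K) := hu.integrable_sq
  rcases (measureReal_nonneg (μ := volume) (s := K)).eq_or_lt with h0 | hpos
  · have hz : volume K = 0 := by
      rw [measureReal_def, eq_comm, ENNReal.toReal_eq_zero_iff] at h0
      exact h0.resolve_right hb.measure_lt_top.ne
    rw [Measure.restrict_eq_zero.2 hz]
    simp
  · set A := ∫ y in K, u y with hA
    have e : ∀ x, (u x - A / V) ^ 2 = u x ^ 2 - 2 * (A / V) * u x + (A / V) ^ 2 :=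
      fun x => by ring
    simp_rw [e]
    have i3 : Integrable (fun y => u y ^ 2 - 2 * (A / V) * u y) (volume.restrict K) :=
      i2.sub (i1.const_mul _)
    rw [integral_add i3 (integrable_const _), integral_sub i2 (i1.const_mul _),
      integral_const_mul, setIntegral_const, smul_eq_mul, ← hA]
    have hVp : 0 < V := hpos
    refine le_of_mul_le_mul_left ?_ hVp
    refine le_of_eq_of_le ?_ (key.trans (le_of_eq (by ring)))
    change V * (_ - _ + V * _) = _
    field_simp
    ring

end

section

/-! ### Integrals over a triangle -/

/-- The mean of `g` over the segment from `b` to `c`. -/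
def edgeAvg (b c : Plane) (g : Plane → ℝ) : ℝ := ∫ t in (0 : ℝ)..1, g (AffineMap.lineMap b c t)

lemma edgeAvg_symm (b c : Plane) (g : Plane → ℝ) : edgeAvg b c g = edgeAvg c b g := by
  unfold edgeAvg
  have := intervalIntegral.integral_comp_sub_left (a := 0) (b := 1)
    (fun t : ℝ => g (AffineMap.lineMap c b t)) 1
  simp only [sub_self, sub_zero] at this
  rw [← this]
  simp only [AffineMap.lineMap_apply_one_sub]

lemma edgeAvg_congr {b c : Plane} {g k : Plane → ℝ}
    (h : ∀ x ∈ segment ℝ b c, g x = k x) : edgeAvg b c g = edgeAvg b c k := by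
  refine intervalIntegral.integral_congr fun t ht => h _ ?_
  rw [segment_eq_image_lineMap]
  exact ⟨t, by simpa using ht, rfl⟩

/-- The reference triangle in the product plane. -/
def refTriangle : Set (ℝ × ℝ) := {p | 0 < p.1 ∧ 0 < p.2 ∧ p.1 + p.2 < 1}

lemma measurableSet_refTriangle : MeasurableSet refTriangle := by
  refine (measurableSet_lt measurable_const measurable_fst).inter
    ((measurableSet_lt measurable_const measurable_snd).inter
      (measurableSet_lt (measurable_fst.add measurable_snd) measurable_const))

lemma integrableOn_refTriangle {F : ℝ × ℝ → ℝ} (hF : Continuous F) :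
    IntegrableOn F refTriangle := by
  have hc : IsCompact (Set.Icc (0 : ℝ) 1 ×ˢ Set.Icc (0 : ℝ) 1) := isCompact_Icc.prod isCompact_Icc
  refine (hF.continuousOn.integrableOn_compact hc).mono_set ?_
  rintro ⟨u, v⟩ ⟨h1, h2, h3⟩
  simp only at h1 h2 h3
  exact ⟨⟨h1.le, by simp only; linarith⟩, ⟨h2.le, by simp only; linarith⟩⟩

lemma integral_refTriangle_slice (f : ℝ → ℝ) (v : ℝ) :
    ∫ u, {u : ℝ | 0 < u ∧ 0 < v ∧ u + v < 1}.indicator f u =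
      (Set.Ioc (0 : ℝ) 1).indicator (fun v => ∫ u in (0 : ℝ)..(1 - v), f u) v := by
  by_cases hv : v ∈ Set.Ioc (0 : ℝ) 1
  · have hs : {u : ℝ | 0 < u ∧ 0 < v ∧ u + v < 1} = Set.Ioo 0 (1 - v) := by
      ext u
      simp only [Set.mem_ofPred_eq, Set.mem_Ioo]
      exact ⟨fun h => ⟨h.1, by linarith [h.2.2]⟩, fun h => ⟨h.1, hv.1, by linarith [h.2]⟩⟩
    rw [hs, integral_indicator measurableSet_Ioo, Set.indicator_of_mem hv,
      intervalIntegral.integral_of_le (by linarith [hv.2]), integral_Ioc_eq_integral_Ioo]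
  · have hs : {u : ℝ | 0 < u ∧ 0 < v ∧ u + v < 1} = ∅ := by
      ext u
      simp only [Set.mem_ofPred_eq, Set.mem_empty_iff_false, iff_false, not_and, not_lt]
      intro h1 h2
      by_contra h3
      exact hv ⟨h2, by linarith⟩
    simp [hs, hv]

lemma integral_refTriangle_snd {F : ℝ × ℝ → ℝ} (hF : Continuous F) :
    ∫ p in refTriangle, F p = ∫ v in (0 : ℝ)..1, ∫ u in (0 : ℝ)..(1 - v), F (u, v) := by
  have hi := (integrable_indicator_iff measurableSet_refTriangle).2 (integrableOn_refTriangle hF)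
  rw [← integral_indicator measurableSet_refTriangle, Measure.volume_eq_prod]
  rw [Measure.volume_eq_prod] at hi
  rw [integral_prod_symm _ hi, intervalIntegral.integral_of_le zero_le_one,
    ← integral_indicator measurableSet_Ioc]
  refine integral_congr_ae (Eventually.of_forall fun v => ?_)
  exact integral_refTriangle_slice (fun u => F (u, v)) v

lemma integral_refTriangle_fst {F : ℝ × ℝ → ℝ} (hF : Continuous F) :
    ∫ p in refTriangle, F p = ∫ u in (0 : ℝ)..1, ∫ v in (0 : ℝ)..(1 - u), F (u, v) := by
  have hi := (integrable_indicator_iff measurableSet_refTriangle).2 (integrableOn_refTriangle hF)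
  rw [← integral_indicator measurableSet_refTriangle, Measure.volume_eq_prod]
  rw [Measure.volume_eq_prod] at hi
  rw [integral_prod _ hi, intervalIntegral.integral_of_le zero_le_one,
    ← integral_indicator measurableSet_Ioc]
  refine integral_congr_ae (Eventually.of_forall fun u => ?_)
  refine Eq.trans ?_ (integral_refTriangle_slice (fun v => F (u, v)) u)
  refine integral_congr_ae (Eventually.of_forall fun v => ?_)
  have hiff : (u, v) ∈ refTriangle ↔ v ∈ {v : ℝ | 0 < v ∧ 0 < u ∧ v + u < 1} := by
    simp only [refTriangle, Set.mem_ofPred_eq]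
    rw [add_comm u v]
    tauto
  by_cases h : (u, v) ∈ refTriangle
  · have h' := hiff.1 h
    simp only [Set.indicator_of_mem h, Set.indicator_of_mem h']
  · have h' := fun k => h (hiff.2 k)
    simp only [Set.indicator_of_notMem h, Set.indicator_of_notMem h']

/-- The divergence theorem for the field `p ↦ h p • p`, which is tangential to the two legs, so only
the hypotenuse contributes. The two partial derivatives are integrated in opposite orders; their
boundary terms carry the weights `1 - t` and `t`, which add up to `1`. -/
lemma integral_refTriangle_div {h : ℝ × ℝ → ℝ} (hh : ContDiff ℝ 1 h) :
    ∫ p in refTriangle, (2 * h p + fderiv ℝ h p p) = ∫ t in (0 : ℝ)..1, h (1 - t, t) := by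
  have hc := hh.continuous
  have hdc : ∀ w : ℝ × ℝ, Continuous fun p => fderiv ℝ h p w := fun w =>
    (hh.continuous_fderiv one_ne_zero).clm_apply continuous_const
  have h1c := hdc (1, 0)
  have h2c := hdc (0, 1)
  have hd : ∀ p : ℝ × ℝ, HasFDerivAt h (fderiv ℝ h p) p := fun p =>
    (hh.differentiable one_ne_zero p).hasFDerivAt
  have c1 : Continuous fun p : ℝ × ℝ => h p + p.1 * fderiv ℝ h p (1, 0) := by fun_prop
  have c2 : Continuous fun p : ℝ × ℝ => h p + p.2 * fderiv ℝ h p (0, 1) := by fun_prop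
  have e : ∀ p : ℝ × ℝ, 2 * h p + fderiv ℝ h p p =
      (h p + p.1 * fderiv ℝ h p (1, 0)) + (h p + p.2 * fderiv ℝ h p (0, 1)) := by
    intro p
    have : p = p.1 • ((1, 0) : ℝ × ℝ) + p.2 • ((0, 1) : ℝ × ℝ) := by ext <;> simp
    have h3 : fderiv ℝ h p p = p.1 * fderiv ℝ h p (1, 0) + p.2 * fderiv ℝ h p (0, 1) := by
      conv_lhs => rw [this, map_add, map_smul, map_smul]
      rw [← this]
      simp
    rw [h3]; ring
  simp_rw [e]
  rw [integral_add (integrableOn_refTriangle c1) (integrableOn_refTriangle c2),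
    integral_refTriangle_snd c1, integral_refTriangle_fst c2]
  have i1 : ∀ v : ℝ, ∫ u in (0 : ℝ)..(1 - v), (h (u, v) + u * fderiv ℝ h (u, v) (1, 0)) =
      (1 - v) * h (1 - v, v) := by
    intro v
    have hder : ∀ u : ℝ, HasDerivAt (fun u => u * h (u, v))
        (1 * h (u, v) + u * fderiv ℝ h (u, v) (1, 0)) u := fun u =>
      (hasDerivAt_id u).mul ((hd (u, v)).comp_hasDerivAt u
        ((hasDerivAt_id u).prodMk (hasDerivAt_const u v)))
    simp only [one_mul] at hder
    rw [intervalIntegral.integral_eq_sub_of_hasDerivAt (fun u _ => hder u)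
      (Continuous.intervalIntegrable (c1.comp (f := fun u : ℝ => (u, v)) (by fun_prop)) _ _)]
    simp
  have i2 : ∀ u : ℝ, ∫ v in (0 : ℝ)..(1 - u), (h (u, v) + v * fderiv ℝ h (u, v) (0, 1)) =
      (1 - u) * h (u, 1 - u) := by
    intro u
    have hder : ∀ v : ℝ, HasDerivAt (fun v => v * h (u, v))
        (1 * h (u, v) + v * fderiv ℝ h (u, v) (0, 1)) v := fun v =>
      (hasDerivAt_id v).mul ((hd (u, v)).comp_hasDerivAt v
        ((hasDerivAt_const v u).prodMk (hasDerivAt_id v)))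
    simp only [one_mul] at hder
    rw [intervalIntegral.integral_eq_sub_of_hasDerivAt (fun u _ => hder u)
      (Continuous.intervalIntegrable (c2.comp (f := fun v : ℝ => (u, v)) (by fun_prop)) _ _)]
    simp
  simp only [i1, i2]
  have hflip := intervalIntegral.integral_comp_sub_left (a := 0) (b := 1)
    (fun u : ℝ => (1 - u) * h (u, 1 - u)) 1
  simp only [sub_self, sub_zero, sub_sub_cancel] at hflip
  rw [← hflip, ← intervalIntegral.integral_add
    (Continuous.intervalIntegrable (by fun_prop) _ _)
    (Continuous.intervalIntegrable (by fun_prop) _ _)]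
  congr 1
  funext t
  ring

/-- The open triangle spanned by an affine basis. -/
def tri (B : AffineBasis (Fin 3) ℝ Plane) : Set Plane := interior (convexHull ℝ (Set.range B))

/-- The area of the triangle. -/
def area (B : AffineBasis (Fin 3) ℝ Plane) : ℝ := volume.real (tri B)

/-- The `j`-th partial derivative of the `i`-th barycentric coordinate. -/
def baryDeriv (B : AffineBasis (Fin 3) ℝ Plane) (i : Fin 3) (j : Fin 2) : ℝ :=
  (B.coord i).linear (EuclideanSpace.single j 1)

/-! ### Barycentric coordinates and the change of variables to the reference triangle -/

section Triangle

variable (B : AffineBasis (Fin 3) ℝ Plane)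

lemma mem_tri_iff {x : Plane} : x ∈ tri B ↔ ∀ i, 0 < B.coord i x := by
  rw [tri, AffineBasis.interior_convexHull]; rfl

lemma isOpen_tri : IsOpen (tri B) := isOpen_interior

lemma convex_tri : Convex ℝ (tri B) := (convex_convexHull ℝ _).interior

lemma isBounded_tri : Bornology.IsBounded (tri B) :=
  (isBounded_convexHull.2 (Set.finite_range B).isBounded).subset interior_subset

lemma nonempty_tri : (tri B).Nonempty := ⟨_, B.centroid_mem_interior_convexHull⟩

instance : IsFiniteMeasure (volume.restrict (tri B)) :=
  ⟨by simpa using (isBounded_tri B).measure_lt_top⟩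

lemma area_pos : 0 < area B :=
  ENNReal.toReal_pos ((isOpen_tri B).measure_pos _ (nonempty_tri B)).ne'
    (isBounded_tri B).measure_lt_top.ne

lemma sum_coord_linear (v : Plane) : ∑ i, (B.coord i).linear v = 0 := by
  have h1 : ∑ i, B.coord i (v +ᵥ (0 : Plane)) = 1 := B.sum_coord_apply_eq_one _
  have h2 : ∑ i, B.coord i (0 : Plane) = 1 := B.sum_coord_apply_eq_one _
  simp_rw [AffineMap.map_vadd, vadd_eq_add, Finset.sum_add_distrib, h2] at h1
  linarith

lemma sum_coord_linear_smul (v : Plane) : ∑ i, (B.coord i).linear v • B i = v := by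
  have h1 : ∑ i, B.coord i (v +ᵥ (0 : Plane)) • B i = v +ᵥ (0 : Plane) := B.linear_combination_coord_eq_self _
  have h2 : ∑ i, B.coord i (0 : Plane) • B i = 0 := B.linear_combination_coord_eq_self _
  simp_rw [AffineMap.map_vadd, vadd_eq_add, add_smul, Finset.sum_add_distrib, h2] at h1
  simpa using h1

lemma sum_baryDeriv (j : Fin 2) : ∑ i, baryDeriv B i j = 0 := sum_coord_linear B _

/-- The derivative in direction `j` of the `k`-th component of `∑ λ_i(x) a_i = x`. Together with
`sum_baryDeriv` it yields Gauss' formula on a triangle. -/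
lemma sum_baryDeriv_mul (j k : Fin 2) : ∑ i, baryDeriv B i j * B i k = if j = k then 1 else 0 := by
  have := congrArg (fun v : Plane => v k)
    (sum_coord_linear_smul B (EuclideanSpace.single j 1))
  simp only [PiLp.smul_apply, smul_eq_mul, WithLp.ofLp_sum, Finset.sum_apply] at this
  refine Eq.trans ?_ (this.trans ?_)
  · simp [baryDeriv]
  · simp [eq_comm]

lemma coord_linear_sub (i j k : Fin 3) :
    (B.coord i).linear (B j - B k) = (if i = j then 1 else 0) - (if i = k then 1 else 0) := by
  rw [← vsub_eq_sub, AffineMap.linearMap_vsub, vsub_eq_sub, B.coord_apply, B.coord_apply]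

/-- The linear coordinates with respect to the sides starting at the vertex `i`. -/
def sideEquiv (i : Fin 3) : (ℝ × ℝ) ≃ₗ[ℝ] Plane where
  toFun p := p.1 • (B (i + 1) - B i) + p.2 • (B (i + 2) - B i)
  map_add' p q := by simp only [Prod.fst_add, Prod.snd_add]; module
  map_smul' r p := by
    simp only [Prod.smul_fst, Prod.smul_snd, smul_eq_mul, RingHom.id_apply]; module
  invFun v := ((B.coord (i + 1)).linear v, (B.coord (i + 2)).linear v)
  left_inv p := by
    simp only [map_add, map_smul, coord_linear_sub]
    fin_cases i <;> simp
  right_inv v := by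
    have h1 := sum_coord_linear B v
    have h2 := sum_coord_linear_smul B v
    rw [Fin.sum_univ_three] at h1 h2
    conv_rhs => rw [← h2]
    have : ∀ x y z : ℝ, x + y + z = 0 → x = -y - z := fun x y z h => by linarith
    fin_cases i
    · rw [this _ _ _ h1]
      simp only [Fin.zero_eta, zero_add]
      module
    · have h1' : (B.coord 1).linear v = -(B.coord 2).linear v - (B.coord 0).linear v := by linarith
      rw [h1']
      simp only [Fin.mk_one, show (1 : Fin 3) + 1 = 2 from rfl, show (1 : Fin 3) + 2 = 0 from rfl]
      module
    · have h1' : (B.coord 2).linear v = -(B.coord 0).linear v - (B.coord 1).linear v := by linarith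
      rw [h1']
      simp only [Fin.reduceFinMk, show (2 : Fin 3) + 1 = 0 from rfl,
        show (2 : Fin 3) + 2 = 1 from rfl]
      module

lemma mem_tri_sideEquiv (i : Fin 3) (p : ℝ × ℝ) :
    sideEquiv B i p + B i ∈ tri B ↔ p ∈ refTriangle := by
  have hc : ∀ j, B.coord j (sideEquiv B i p + B i) = p.1 * ((if j = i + 1 then 1 else 0) -
      (if j = i then 1 else 0)) + p.2 * ((if j = i + 2 then 1 else 0) -
      (if j = i then 1 else 0)) + (if j = i then 1 else 0) := by
    intro j
    rw [← vadd_eq_add, AffineMap.map_vadd, B.coord_apply]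
    simp only [sideEquiv, LinearEquiv.coe_mk, LinearMap.coe_mk, AddHom.coe_mk, map_add, map_smul,
      coord_linear_sub, smul_eq_mul, vadd_eq_add]
  rw [mem_tri_iff]
  simp_rw [hc, refTriangle, Set.mem_ofPred_eq]
  constructor
  · intro h
    have h0 := h i
    have h1 := h (i + 1)
    have h2 := h (i + 2)
    fin_cases i <;> simp at h0 h1 h2 <;> exact ⟨h1, h2, by linarith⟩
  · rintro ⟨h1, h2, h3⟩ j
    fin_cases i <;> fin_cases j <;> simp <;> linarith

/-- Change of variables to the reference triangle, with an unspecified constant factor. -/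
lemma exists_integral_tri (i : Fin 3) : ∃ c : ℝ, ∀ F : Plane → ℝ,
    ∫ p in refTriangle, F (sideEquiv B i p + B i) = c * ∫ x in tri B, F x := by
  set L := (sideEquiv B i).toContinuousLinearEquiv with hL
  have hhaar : (Measure.map L (volume : Measure (ℝ × ℝ))).IsAddHaarMeasure :=
    L.isAddHaarMeasure_map volume
  set c := Measure.addHaarScalarFactor (Measure.map L (volume : Measure (ℝ × ℝ))) volume with hc
  have hmap : Measure.map L (volume : Measure (ℝ × ℝ)) = c • (volume : Measure Plane) :=
    Measure.isAddLeftInvariant_eq_smul _ _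
  refine ⟨c, fun F => ?_⟩
  have h1 : ∫ p in refTriangle, F (sideEquiv B i p + B i) =
      ∫ p, (tri B).indicator F (L p + B i) := by
    rw [← integral_indicator measurableSet_refTriangle]
    congr 1
    funext p
    by_cases hp : p ∈ refTriangle
    · have := (mem_tri_sideEquiv B i p).2 hp
      rw [Set.indicator_of_mem hp, Set.indicator_of_mem (by exact this)]
      rfl
    · have := fun h => hp ((mem_tri_sideEquiv B i p).1 h)
      rw [Set.indicator_of_notMem hp, Set.indicator_of_notMem (by exact this)]
  have h2 : ∫ p, (tri B).indicator F (L p + B i) =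
      ∫ x, (tri B).indicator F (x + B i) ∂(Measure.map L (volume : Measure (ℝ × ℝ))) :=
    (L.toHomeomorph.measurableEmbedding.integral_map
      (fun x => (tri B).indicator F (x + B i))).symm
  rw [h1, h2, hmap, integral_smul_nnreal_measure,
    integral_add_right_eq_self (fun x => (tri B).indicator F x),
    integral_indicator (isOpen_tri B).measurableSet]
  rfl

/-- The integral over a triangle that gives the mean of a function over the side opposite to
the vertex `i`, in terms of the function `g` and its gradient `G`. -/
def sideInt (i : Fin 3) (g : Plane → ℝ) (G : Fin 2 → Plane → ℝ) : ℝ :=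
  ∫ x in tri B, (2 * g x + ∑ k, (x k - B i k) * G k x)

/-- The integrand is the divergence of `(x - B i) g`, a field tangential to the two sides through `B
i`. Thus a volume integral, meaningful for `H¹` functions, replaces the trace on the opposite side.
-/
theorem sideInt_eq (i : Fin 3) {g : Plane → ℝ} (hg : ContDiff ℝ 1 g) :
    sideInt B i g (fun k => partialDeriv k g) =
      2 * area B * edgeAvg (B (i + 1)) (B (i + 2)) g := by
  obtain ⟨c, hc⟩ := exists_integral_tri B i
  have key : ∀ {g : Plane → ℝ}, ContDiff ℝ 1 g → c * ∫ x in tri B,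
      (2 * g x + fderiv ℝ g x (x - B i)) = edgeAvg (B (i + 1)) (B (i + 2)) g := by
    intro g hg
    rw [← hc fun x => 2 * g x + fderiv ℝ g x (x - B i)]
    set L := (sideEquiv B i).toContinuousLinearEquiv with hL
    have hLc : ContDiff ℝ 1 fun p : ℝ × ℝ => L p + B i := L.contDiff.add contDiff_const
    have hh : ContDiff ℝ 1 fun p : ℝ × ℝ => g (L p + B i) := hg.comp hLc
    have hd : ∀ p : ℝ × ℝ, fderiv ℝ (fun p : ℝ × ℝ => g (L p + B i)) p p =
        fderiv ℝ g (L p + B i) (L p) := by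
      intro p
      have h1 := (hg.differentiable one_ne_zero (L p + B i)).hasFDerivAt
      have h2 : HasFDerivAt (fun p : ℝ × ℝ => L p + B i) (L : (ℝ × ℝ) →L[ℝ] Plane) p :=
        L.hasFDerivAt.add_const _
      have h3 := h1.comp p h2
      exact congrArg (fun A : (ℝ × ℝ) →L[ℝ] ℝ => A p) h3.fderiv
    have := integral_refTriangle_div hh
    simp_rw [hd] at this
    refine Eq.trans ?_ (this.trans ?_)
    · refine integral_congr_ae (Eventually.of_forall fun p => ?_)
      simp only [add_sub_cancel_right]
      rfl
    · unfold edgeAvg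
      congr 1
      funext t
      congr 1
      change (1 - t) • (B (i + 1) - B i) + t • (B (i + 2) - B i) + B i = _
      rw [AffineMap.lineMap_apply_module]
      module
  -- The constant function `1` identifies the unknown factor of the change of variables: `2 c |K| =
  -- 1`.
  have h1 := key (contDiff_const (c := (1 : ℝ)))
  have h2 := key hg
  have h3 : c * (2 * area B) = 1 := by
    have e1 : edgeAvg (B (i + 1)) (B (i + 2)) (fun _ => (1 : ℝ)) = 1 := by simp [edgeAvg]
    rw [e1] at h1
    rw [← h1]
    simp [area, mul_comm]
  rw [← h2]
  have h4 : sideInt B i g (fun k => partialDeriv k g) =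
      ∫ x in tri B, (2 * g x + fderiv ℝ g x (x - B i)) := by
    unfold sideInt
    simp_rw [fderiv_apply_eq_sum]
    rfl
  rw [h4]
  linear_combination (-∫ x in tri B, (2 * g x + fderiv ℝ g x (x - B i))) * h3

end Triangle

end

section

/-! ### The cells and edges of a triangulation -/

lemma IsConvexPolygon.isOpen {Ω : Set Plane} (h : IsConvexPolygon Ω) : IsOpen Ω := by
  obtain ⟨-, S, rfl⟩ := h; exact isOpen_interior

lemma IsConvexPolygon.convex {Ω : Set Plane} (h : IsConvexPolygon Ω) : Convex ℝ Ω := by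
  obtain ⟨-, S, rfl⟩ := h; exact (convex_convexHull ℝ _).interior

lemma IsConvexPolygon.isBounded {Ω : Set Plane} (h : IsConvexPolygon Ω) :
    Bornology.IsBounded Ω := by
  obtain ⟨-, S, rfl⟩ := h
  exact (isBounded_convexHull.2 S.finite_toSet.isBounded).subset interior_subset

variable {Ω : Set Plane} (τ : Triangulation Ω)

lemma exists_cellBasis (K : τ.cells) :
    ∃ B : AffineBasis (Fin 3) ℝ Plane, Set.range B = (K.1 : Set Plane) := by
  have e : Fin 3 ≃ K.1 := (Finset.equivFinOfCardEq (τ.card_eq K.1 K.2)).symm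
  have hi : AffineIndependent ℝ (fun i => (e i : Plane)) :=
    (τ.indep K.1 K.2).comp_embedding e.toEmbedding
  refine ⟨⟨fun i => (e i : Plane), hi, ?_⟩, ?_⟩
  · rw [hi.affineSpan_eq_top_iff_card_eq_finrank_add_one]
    simp
  · ext x
    change x ∈ Set.range (fun i => (e i : Plane)) ↔ _
    constructor
    · rintro ⟨i, rfl⟩
      exact (e i).2
    · intro hx
      exact ⟨e.symm ⟨x, hx⟩, by simp⟩

/-- The vertices of a cell, as an affine basis of the plane. -/
def cellBasis (K : τ.cells) : AffineBasis (Fin 3) ℝ Plane := (exists_cellBasis τ K).choose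

lemma range_cellBasis (K : τ.cells) : Set.range (cellBasis τ K) = (K.1 : Set Plane) :=
  (exists_cellBasis τ K).choose_spec

lemma tri_cellBasis (K : τ.cells) : tri (cellBasis τ K) = τ.cell K := by
  rw [tri, range_cellBasis, Triangulation.cell]

lemma cellBasis_mem (K : τ.cells) (i : Fin 3) : cellBasis τ K i ∈ K.1 := by
  have : cellBasis τ K i ∈ (K.1 : Set Plane) := by
    rw [← range_cellBasis]; exact Set.mem_range_self i
  exact this

lemma fin3_add_ne (i : Fin 3) : i + 1 ≠ i + 2 := by fin_cases i <;> decide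

lemma cellBasis_ne (K : τ.cells) (i : Fin 3) : cellBasis τ K (i + 1) ≠ cellBasis τ K (i + 2) :=
  fun h => fin3_add_ne i ((cellBasis τ K).ind.injective h)

/-- The edge of `K` opposite to the vertex with index `i`. -/
def cellEdge (p : τ.cells × Fin 3) : Finset Plane :=
  {cellBasis τ p.1 (p.2 + 1), cellBasis τ p.1 (p.2 + 2)}

/-- The midpoint of an edge. -/
def edgeMid (p : τ.cells × Fin 3) : Plane :=
  midpoint ℝ (cellBasis τ p.1 (p.2 + 1)) (cellBasis τ p.1 (p.2 + 2))

lemma cellEdge_subset (p : τ.cells × Fin 3) : cellEdge τ p ⊆ p.1.1 := by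
  intro x hx
  simp only [cellEdge, Finset.mem_insert, Finset.mem_singleton] at hx
  rcases hx with rfl | rfl <;> exact cellBasis_mem τ _ _

lemma cellEdge_card (p : τ.cells × Fin 3) : (cellEdge τ p).card = 2 :=
  Finset.card_pair (cellBasis_ne τ p.1 p.2)

lemma convexHull_cellEdge (p : τ.cells × Fin 3) : convexHull ℝ (cellEdge τ p : Set Plane) =
    segment ℝ (cellBasis τ p.1 (p.2 + 1)) (cellBasis τ p.1 (p.2 + 2)) := by
  simp only [cellEdge, Finset.coe_insert, Finset.coe_singleton]
  exact convexHull_pair _ _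

/-- By affine independence the hulls of `{b, c}` and `S` meet in the hull of `{b, c} ∩ S`. Were `b`
missing from `S`, the midpoint would have to be `c`. -/
lemma mem_of_midpoint_mem_convexHull {K S : Finset Plane}
    (hK : AffineIndependent ℝ ((↑) : K → Plane)) (hS : S ⊆ K) {b c : Plane} (hb : b ∈ K)
    (hc : c ∈ K) (hbc : b ≠ c) (h : midpoint ℝ b c ∈ convexHull ℝ (S : Set Plane)) :
    b ∈ S ∧ c ∈ S := by
  have key : ∀ {b c : Plane}, b ∈ K → c ∈ K → b ≠ c →
      midpoint ℝ b c ∈ convexHull ℝ (S : Set Plane) → b ∈ S := by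
    intro b c hb hc hbc h
    by_contra hbS
    have hsub : ({b, c} : Finset Plane) ⊆ K := by
      intro x hx
      simp only [Finset.mem_insert, Finset.mem_singleton] at hx
      rcases hx with rfl | rfl <;> assumption
    have hm : midpoint ℝ b c ∈ convexHull ℝ (({b, c} : Finset Plane) : Set Plane) := by
      simp only [Finset.coe_insert, Finset.coe_singleton]
      rw [convexHull_pair]
      exact midpoint_mem_segment b c
    have hI : midpoint ℝ b c ∈
        convexHull ℝ ((({b, c} : Finset Plane) : Set Plane) ∩ (S : Set Plane)) := by
      rw [hK.convexHull_inter hsub hS]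
      exact ⟨hm, h⟩
    have hs : ((({b, c} : Finset Plane) : Set Plane) ∩ (S : Set Plane)) ⊆ {c} := by
      rintro x ⟨hx, hxS⟩
      simp only [Finset.coe_insert, Finset.coe_singleton, Set.mem_insert_iff,
        Set.mem_singleton_iff] at hx ⊢
      rcases hx with rfl | rfl
      · exact absurd hxS hbS
      · rfl
    have := convexHull_mono (𝕜 := ℝ) hs hI
    rw [convexHull_singleton, Set.mem_singleton_iff, midpoint_eq_right_iff] at this
    exact hbc this
  exact ⟨key hb hc hbc h, key hc hb hbc.symm (by rwa [midpoint_comm])⟩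

lemma cellEdge_subset_of_edgeMid_mem (p : τ.cells × Fin 3) (L : τ.cells)
    (h : edgeMid τ p ∈ convexHull ℝ (L.1 : Set Plane)) : cellEdge τ p ⊆ L.1 := by
  classical
  have hK : edgeMid τ p ∈ convexHull ℝ (p.1.1 : Set Plane) := by
    refine convexHull_mono (𝕜 := ℝ) (Finset.coe_subset.2 (cellEdge_subset τ p)) ?_
    rw [convexHull_cellEdge]
    exact midpoint_mem_segment _ _
  have hI : edgeMid τ p ∈ convexHull ℝ ((p.1.1 ∩ L.1 : Finset Plane) : Set Plane) := by
    rw [Finset.coe_inter, ← τ.inter_eq _ p.1.2 _ L.2]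
    exact ⟨hK, h⟩
  have := mem_of_midpoint_mem_convexHull (τ.indep _ p.1.2) Finset.inter_subset_left
    (cellBasis_mem τ _ _) (cellBasis_mem τ _ _) (cellBasis_ne τ p.1 p.2) hI
  intro x hx
  simp only [cellEdge, Finset.mem_insert, Finset.mem_singleton] at hx
  rcases hx with rfl | rfl
  · exact (Finset.mem_inter.1 this.1).2
  · exact (Finset.mem_inter.1 this.2).2

/-- Conformity makes the midpoint of an edge lie on no other edge, so a small bump function there
sees a single edge. -/
lemma cellEdge_eq_of_edgeMid_mem (p q : τ.cells × Fin 3)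
    (h : edgeMid τ p ∈ convexHull ℝ (cellEdge τ q : Set Plane)) : cellEdge τ p = cellEdge τ q := by
  have hL : edgeMid τ p ∈ convexHull ℝ (q.1.1 : Set Plane) :=
    convexHull_mono (𝕜 := ℝ) (Finset.coe_subset.2 (cellEdge_subset τ q)) h
  have hsub := cellEdge_subset_of_edgeMid_mem τ p q.1 hL
  have := mem_of_midpoint_mem_convexHull (τ.indep _ q.1.2) (cellEdge_subset τ q)
    (hsub (Finset.mem_insert_self _ _))
    (hsub (Finset.mem_insert_of_mem (Finset.mem_singleton_self _))) (cellBasis_ne τ p.1 p.2) h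
  refine Finset.eq_of_subset_of_card_le ?_ (by rw [cellEdge_card, cellEdge_card])
  intro x hx
  simp only [cellEdge, Finset.mem_insert, Finset.mem_singleton] at hx
  rcases hx with rfl | rfl
  · exact this.1
  · exact this.2

/-- Mean over an edge of a cell. -/
def cellEdgeAvg (p : τ.cells × Fin 3) (g : Plane → ℝ) : ℝ :=
  edgeAvg (cellBasis τ p.1 (p.2 + 1)) (cellBasis τ p.1 (p.2 + 2)) g

lemma pair_cases {a b c d : Plane} (h : ({a, b} : Finset Plane) = {c, d}) :
    (a = c ∧ b = d) ∨ (a = d ∧ b = c) := by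
  have h' : ({a, b} : Set Plane) = {c, d} := by
    have := congrArg (fun s : Finset Plane => (s : Set Plane)) h
    simpa using this
  exact Set.pair_eq_pair_iff.1 h'

lemma cellEdgeAvg_congr {p q : τ.cells × Fin 3} (h : cellEdge τ p = cellEdge τ q)
    (g : Plane → ℝ) : cellEdgeAvg τ p g = cellEdgeAvg τ q g := by
  unfold cellEdgeAvg
  rcases pair_cases h with ⟨h1, h2⟩ | ⟨h1, h2⟩
  · rw [h1, h2]
  · rw [h1, h2, edgeAvg_symm]

/-! #### Integration over the cells -/

lemma isOpen_cell (K : τ.cells) : IsOpen (τ.cell K) := isOpen_interior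

lemma hull_subset_closure (K : τ.cells) : convexHull ℝ (K.1 : Set Plane) ⊆ closure Ω := by
  rw [← τ.cover]
  exact Set.subset_biUnion_of_mem (u := fun K : Finset Plane => convexHull ℝ (K : Set Plane)) K.2

lemma cell_subset (ho : IsOpen Ω) (hc : Convex ℝ Ω) (K : τ.cells) : τ.cell K ⊆ Ω := by
  rcases Ω.eq_empty_or_nonempty with rfl | hne
  · have := hull_subset_closure τ K
    rw [closure_empty] at this
    exact interior_subset.trans this
  · have h1 : τ.cell K ⊆ interior (closure Ω) := interior_mono (hull_subset_closure τ K)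
    rwa [hc.interior_closure_eq_interior_of_nonempty_interior (by rwa [ho.interior_eq]),
      ho.interior_eq] at h1

/-- Some vertex of `K` is not a vertex of `L`. Its barycentric coordinate vanishes on the hull of
the common vertices but is positive inside `K`. -/
lemma disjoint_cell {K L : τ.cells} (hKL : K ≠ L) : Disjoint (τ.cell K) (τ.cell L) := by
  rw [Set.disjoint_left]
  intro x hxK hxL
  obtain ⟨a, haK, haL⟩ : ∃ a ∈ K.1, a ∉ L.1 := by
    by_contra! hsub
    exact hKL (Subtype.ext (Finset.eq_of_subset_of_card_le hsub
      (by rw [τ.card_eq _ K.2, τ.card_eq _ L.2])))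
  have ha : a ∈ Set.range (cellBasis τ K) := by rw [range_cellBasis]; exact haK
  obtain ⟨i, rfl⟩ := ha
  have hpos : 0 < (cellBasis τ K).coord i x := by
    rw [← tri_cellBasis, mem_tri_iff] at hxK
    exact hxK i
  have hx : x ∈ convexHull ℝ ((K.1 : Set Plane) ∩ L.1) := by
    rw [← τ.inter_eq _ K.2 _ L.2]
    exact ⟨interior_subset hxK, interior_subset hxL⟩
  have hconv : Convex ℝ {y | (cellBasis τ K).coord i y = 0} :=
    (convex_singleton (0 : ℝ)).affine_preimage ((cellBasis τ K).coord i)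
  have hsub : ((K.1 : Set Plane) ∩ L.1) ⊆ {y | (cellBasis τ K).coord i y = 0} := by
    rintro y ⟨hyK, hyL⟩
    rw [← range_cellBasis] at hyK
    obtain ⟨j, rfl⟩ := hyK
    change (cellBasis τ K).coord i (cellBasis τ K j) = 0
    rw [AffineBasis.coord_apply, if_neg]
    rintro rfl
    exact haL hyL
  have : (cellBasis τ K).coord i x = 0 := convexHull_min hsub hconv hx
  linarith

/-- The closed triangles cover `Ω`, and the boundary of a convex set is a null set. -/
lemma iUnion_cell_ae_eq (ho : IsOpen Ω) (hc : Convex ℝ Ω) :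
    (⋃ K, τ.cell K) =ᵐ[volume] Ω := by
  have hnull : volume (⋃ K : τ.cells, frontier (convexHull ℝ (K.1 : Set Plane))) = 0 :=
    measure_iUnion_null fun K => (convex_convexHull ℝ _).addHaar_frontier volume
  have hsub : Ω ⊆ (⋃ K, τ.cell K) ∪ ⋃ K : τ.cells, frontier (convexHull ℝ (K.1 : Set Plane)) := by
    intro x hx
    have : x ∈ closure Ω := subset_closure hx
    rw [← τ.cover] at this
    simp only [Set.mem_iUnion] at this
    obtain ⟨K, hK, hxK⟩ := this
    by_cases hi : x ∈ interior (convexHull ℝ (K : Set Plane))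
    · exact Or.inl (Set.mem_iUnion.2 ⟨⟨K, hK⟩, hi⟩)
    · exact Or.inr (Set.mem_iUnion.2 ⟨⟨K, hK⟩, subset_closure hxK, hi⟩)
  refine (Set.iUnion_subset (cell_subset τ ho hc)).eventuallyLE.antisymm ?_
  have h2 : Ω ≤ᵐ[volume] ((⋃ K, τ.cell K) ∪
      ⋃ K : τ.cells, frontier (convexHull ℝ (K.1 : Set Plane)) : Set Plane) := hsub.eventuallyLE
  exact h2.trans (union_ae_eq_left_of_ae_eq_empty (ae_eq_empty.2 hnull)).le

lemma sum_integral_cell (ho : IsOpen Ω) (hc : Convex ℝ Ω) {F : Plane → ℝ}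
    (hF : IntegrableOn F Ω) : ∑ K, ∫ x in τ.cell K, F x = ∫ x in Ω, F x := by
  rw [← setIntegral_congr_set (iUnion_cell_ae_eq τ ho hc)]
  refine (integral_iUnion_fintype (fun K => (isOpen_cell τ K).measurableSet) ?_
    fun K => hF.mono_set (cell_subset τ ho hc K)).symm
  exact fun K L h => disjoint_cell τ h

/-! #### Cancellation of the edge normals -/

/-- Gauss' formula in algebraic form. The integrands already agree pointwise by `∑ ∂_j λ_i = 0` and
`∑ ∂_j λ_i a_i = e_j`, so `G` need not be the gradient of `g`. -/
lemma integral_partialDeriv_tri (B : AffineBasis (Fin 3) ℝ Plane) {g : Plane → ℝ}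
    {G : Fin 2 → Plane → ℝ} (hg : MemLp g 2 (volume.restrict (tri B)))
    (hG : ∀ k, MemLp (G k) 2 (volume.restrict (tri B))) (j : Fin 2) :
    ∫ x in tri B, G j x = -∑ i, baryDeriv B i j * sideInt B i g G := by
  have hx : ∀ (k : Fin 2) (a : ℝ),
      Integrable (fun x : Plane => (x k - a) * G k x) (volume.restrict (tri B)) := fun k a =>
    integrable_mul_of_memLp (memLp_two_of_continuous (g := fun x : Plane => x k - a)
      (isBounded_tri B) (by fun_prop)) (hG k)
  have hI : ∀ i, Integrable (fun x : Plane => 2 * g x + ∑ k, (x k - B i k) * G k x)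
      (volume.restrict (tri B)) := fun i =>
    ((hg.integrable (by norm_num)).const_mul 2).add (integrable_finsetSum _ fun k _ => hx k _)
  unfold sideInt
  simp_rw [← integral_const_mul]
  rw [← integral_finsetSum _ fun i _ => (hI i).const_mul _, ← integral_neg]
  refine integral_congr_ae (Eventually.of_forall fun x => ?_)
  beta_reduce
  have h0 := sum_baryDeriv B j
  have h1 := sum_baryDeriv_mul B j 0
  have h2 := sum_baryDeriv_mul B j 1
  rw [Fin.sum_univ_three] at h0 h1 h2 ⊢
  simp only [Fin.sum_univ_two]
  fin_cases j
  · simp at h1 h2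
    simp only [Fin.zero_eta] at *
    linear_combination (2 * g x + x 0 * G 0 x + x 1 * G 1 x) * h0 - G 0 x * h1 - G 1 x * h2
  · simp at h1 h2
    simp only [Fin.mk_one] at *
    linear_combination (2 * g x + x 0 * G 0 x + x 1 * G 1 x) * h0 - G 0 x * h1 - G 1 x * h2

lemma integral_partialDeriv_tri_smooth (B : AffineBasis (Fin 3) ℝ Plane) {g : Plane → ℝ}
    (hg : ContDiff ℝ 1 g) (j : Fin 2) :
    ∫ x in tri B, partialDeriv j g x =
      -∑ i, baryDeriv B i j * (2 * area B * edgeAvg (B (i + 1)) (B (i + 2)) g) := by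
  rw [integral_partialDeriv_tri B (memLp_two_of_continuous (isBounded_tri B) hg.continuous)
    (fun k => memLp_two_of_continuous (isBounded_tri B) (continuous_partialDeriv hg k)) j]
  simp_rw [sideInt_eq B _ hg]

lemma IsTestFun.integral_partialDeriv {φ : Plane → ℝ} (h : IsTestFun Ω φ) (j : Fin 2) :
    ∫ x in Ω, partialDeriv j φ x = 0 := by
  have := (hasWeakDeriv_of_contDiff Ω j (contDiff_const (c := (1 : ℝ)))).2.2 φ h
  simpa [partialDeriv] using this

/-- The outer normals of the cells at an interior edge, weighted by the length, add up to zero. -/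
lemma sum_normal_eq_zero (ho : IsOpen Ω) (hc : Convex ℝ Ω) (hb : Bornology.IsBounded Ω)
    (p : τ.cells × Fin 3) (hp : edgeMid τ p ∈ Ω) (j : Fin 2) [DecidableEq (Finset Plane)] :
    ∑ q with cellEdge τ q = cellEdge τ p,
      area (cellBasis τ q.1) * baryDeriv (cellBasis τ q.1) q.2 j = 0 := by
  -- A bump function on this ball has `∫_Ω ∂_j φ = 0`. Splitting that integral over the cells by
  -- Gauss' formula leaves only the terms of the given edge, all with the same positive mean. The
  -- number of cells at the edge is never needed.
  obtain ⟨r, hr, hrΩ, hrE⟩ : ∃ r > 0, Metric.closedBall (edgeMid τ p) r ⊆ Ω ∧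
      ∀ q, cellEdge τ q ≠ cellEdge τ p →
        Disjoint (Metric.closedBall (edgeMid τ p) r) (convexHull ℝ (cellEdge τ q : Set Plane)) := by
    have h1 : ∀ᶠ r in 𝓝[>] (0 : ℝ), Metric.closedBall (edgeMid τ p) r ⊆ Ω := by
      obtain ⟨ε, hε, h⟩ := Metric.nhds_basis_closedBall.mem_iff.1 (ho.mem_nhds hp)
      filter_upwards [Ioc_mem_nhdsGT hε] with r hr
      exact (Metric.closedBall_subset_closedBall hr.2).trans h
    have h2 : ∀ᶠ r in 𝓝[>] (0 : ℝ), ∀ q, cellEdge τ q ≠ cellEdge τ p →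
        Disjoint (Metric.closedBall (edgeMid τ p) r)
          (convexHull ℝ (cellEdge τ q : Set Plane)) := by
      rw [eventually_all]
      intro q
      by_cases hq : cellEdge τ q = cellEdge τ p
      · exact Eventually.of_forall fun r h => absurd hq h
      · have hcl : IsClosed (convexHull ℝ (cellEdge τ q : Set Plane)) :=
          ((cellEdge τ q).finite_toSet.isCompact_convexHull (𝕜 := ℝ)).isClosed
        have hmem : (convexHull ℝ (cellEdge τ q : Set Plane))ᶜ ∈ 𝓝 (edgeMid τ p) :=
          hcl.isOpen_compl.mem_nhds fun h => hq (cellEdge_eq_of_edgeMid_mem τ p q h).symm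
        obtain ⟨ε, hε, h⟩ := Metric.nhds_basis_closedBall.mem_iff.1 hmem
        filter_upwards [Ioc_mem_nhdsGT hε] with r hr _
        exact Set.disjoint_left.2 fun x hx =>
          h (Metric.closedBall_subset_closedBall hr.2 hx)
    obtain ⟨r, ⟨h1, h2⟩, h3⟩ := ((h1.and h2).and self_mem_nhdsWithin).exists
    exact ⟨r, h3, h1, h2⟩
  let φ : ContDiffBump (edgeMid τ p) :=
    { rIn := r / 2, rOut := r, rIn_pos := by positivity, rIn_lt_rOut := by linarith }
  have hφ : ContDiff ℝ ∞ φ := φ.contDiff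
  have hφ1 : ContDiff ℝ 1 φ := φ.contDiff
  have htest : IsTestFun Ω φ := ⟨hφ, φ.hasCompactSupport, by rw [φ.tsupport_eq]; exact hrΩ⟩
  have h0 := htest.integral_partialDeriv j
  rw [← sum_integral_cell τ ho hc
    (integrableOn_of_continuous hb (continuous_partialDeriv hφ1 j))] at h0
  have h1 : ∑ q : τ.cells × Fin 3, area (cellBasis τ q.1) * baryDeriv (cellBasis τ q.1) q.2 j *
      cellEdgeAvg τ q φ = 0 := by
    rw [Fintype.sum_prod_type]
    have e : ∀ K, ∫ x in τ.cell K, partialDeriv j φ x =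
        -2 * ∑ i, area (cellBasis τ K) * baryDeriv (cellBasis τ K) i j *
          cellEdgeAvg τ (K, i) φ := by
      intro K
      rw [← tri_cellBasis, integral_partialDeriv_tri_smooth _ hφ1, Finset.mul_sum,
        ← Finset.sum_neg_distrib]
      refine Finset.sum_congr rfl fun i _ => ?_
      simp only [cellEdgeAvg]
      ring
    simp_rw [e, ← Finset.mul_sum] at h0
    linarith
  have h2 : ∀ q, cellEdge τ q ≠ cellEdge τ p → cellEdgeAvg τ q φ = 0 := by
    intro q hq
    have : cellEdgeAvg τ q φ = cellEdgeAvg τ q (fun _ => 0) := by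
      refine edgeAvg_congr fun x hx => ?_
      rw [← convexHull_cellEdge] at hx
      have hx' : x ∉ Metric.closedBall (edgeMid τ p) r :=
        fun h => Set.disjoint_left.1 (hrE q hq) h hx
      exact φ.zero_of_le_dist (le_of_lt (by simpa using hx'))
    rw [this]
    simp [cellEdgeAvg, edgeAvg]
  have h3 : 0 < cellEdgeAvg τ p φ := by
    refine intervalIntegral.integral_pos zero_lt_one ?_ (fun t _ => φ.nonneg) ⟨1 / 2, by norm_num, ?_⟩
    · exact (φ.continuous.comp AffineMap.lineMap_continuous).continuousOn
    · have hmid : (AffineMap.lineMap (cellBasis τ p.1 (p.2 + 1)) (cellBasis τ p.1 (p.2 + 2)))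
          (1 / 2 : ℝ) = edgeMid τ p := by
        rw [edgeMid, midpoint]
        norm_num
      rw [hmid, φ.one_of_mem_closedBall (Metric.mem_closedBall_self φ.rIn_pos.le)]
      exact zero_lt_one
  rw [← Finset.sum_filter_add_sum_filter_not Finset.univ (fun q => cellEdge τ q = cellEdge τ p),
    Finset.sum_eq_zero (s := Finset.univ.filter fun q => ¬ cellEdge τ q = cellEdge τ p)
      fun q hq => by rw [h2 q (Finset.mem_filter.1 hq).2, mul_zero], add_zero,
    Finset.sum_congr rfl fun q hq => by
      rw [cellEdgeAvg_congr τ (Finset.mem_filter.1 hq).2 φ], ← Finset.sum_mul] at h1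
  exact (mul_eq_zero.1 h1).resolve_right h3.ne'

/-- Edge weights that agree on common edges and vanish on boundary edges. -/
def EdgeConsistent (m : τ.cells × Fin 3 → ℝ) : Prop :=
  (∀ p q, cellEdge τ p = cellEdge τ q → m p = m q) ∧ ∀ p, edgeMid τ p ∉ Ω → m p = 0

/-- The sum is grouped by edges, on each of which `m` is constant. At interior edges the normals
cancel; at boundary edges the weight vanishes. -/
lemma sum_edgeConsistent_normal (ho : IsOpen Ω) (hc : Convex ℝ Ω) (hb : Bornology.IsBounded Ω)
    {m : τ.cells × Fin 3 → ℝ} (hm : EdgeConsistent τ m) (j : Fin 2) :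
    ∑ q, m q * (area (cellBasis τ q.1) * baryDeriv (cellBasis τ q.1) q.2 j) = 0 := by
  classical
  rw [← Finset.sum_fiberwise_of_maps_to (g := cellEdge τ) (t := Finset.univ.image (cellEdge τ))
    fun q _ => Finset.mem_image_of_mem _ (Finset.mem_univ q)]
  refine Finset.sum_eq_zero fun e he => ?_
  obtain ⟨p, -, rfl⟩ := Finset.mem_image.1 he
  rw [Finset.sum_congr rfl fun q hq => by
    rw [hm.1 q p (Finset.mem_filter.1 hq).2], ← Finset.mul_sum]
  by_cases hp : edgeMid τ p ∈ Ω
  · rw [sum_normal_eq_zero τ ho hc hb p hp j, mul_zero]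
  · rw [hm.2 p hp, zero_mul]

/-- The products of consistent weights with the edge means of one global function are again
consistent weights. -/
lemma sum_sideInt_smooth (ho : IsOpen Ω) (hc : Convex ℝ Ω) (hb : Bornology.IsBounded Ω)
    {m : τ.cells × Fin 3 → ℝ} (hm : EdgeConsistent τ m) (j : Fin 2) {g : Plane → ℝ}
    (hg : ContDiff ℝ 1 g) :
    ∑ K, ∑ i, m (K, i) * baryDeriv (cellBasis τ K) i j *
      sideInt (cellBasis τ K) i g (fun k => partialDeriv k g) = 0 := by
  have h : EdgeConsistent τ (fun p => m p * (2 * cellEdgeAvg τ p g)) :=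
    ⟨fun p q hpq => by beta_reduce; rw [hm.1 p q hpq, cellEdgeAvg_congr τ hpq],
      fun p hp => by beta_reduce; rw [hm.2 p hp, zero_mul]⟩
  have := sum_edgeConsistent_normal τ ho hc hb h j
  rw [Fintype.sum_prod_type] at this
  rw [← this]
  refine Finset.sum_congr rfl fun K _ => Finset.sum_congr rfl fun i _ => ?_
  rw [sideInt_eq _ _ hg, cellEdgeAvg]
  ring

/-- `sideInt` consists of `L²` pairings of the function and its gradient with bounded functions.
This continuity is what carries the jump identity from smooth functions to `H¹`. -/
lemma TendstoL2.sideInt (B : AffineBasis (Fin 3) ℝ Plane) (i : Fin 3) {v : ℕ → Plane → ℝ}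
    {V : Fin 2 → ℕ → Plane → ℝ} {g : Plane → ℝ} {G : Fin 2 → Plane → ℝ}
    (hv : TendstoL2 (volume.restrict (tri B)) v g)
    (hV : ∀ k, TendstoL2 (volume.restrict (tri B)) (V k) (G k))
    (mv : ∀ n, MemLp (v n) 2 (volume.restrict (tri B)))
    (mV : ∀ k n, MemLp (V k n) 2 (volume.restrict (tri B)))
    (mg : MemLp g 2 (volume.restrict (tri B))) (mG : ∀ k, MemLp (G k) 2 (volume.restrict (tri B))) :
    Tendsto (fun n => NC1C2.sideInt B i (v n) (fun k => V k n)) atTop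
      (𝓝 (NC1C2.sideInt B i g G)) := by
  have hx : ∀ k : Fin 2, MemLp (fun x : Plane => x k - B i k) 2 (volume.restrict (tri B)) :=
    fun k => memLp_two_of_continuous (isBounded_tri B) (by fun_prop)
  have e : ∀ (g : Plane → ℝ) (G : Fin 2 → Plane → ℝ), MemLp g 2 (volume.restrict (tri B)) →
      (∀ k, MemLp (G k) 2 (volume.restrict (tri B))) → NC1C2.sideInt B i g G =
      2 * (∫ x in tri B, g x) + ∑ k, ∫ x in tri B, G k x * (x k - B i k) := by
    intro g G mg mG
    unfold NC1C2.sideInt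
    rw [integral_add ((mg.integrable (by norm_num)).const_mul 2)
      (integrable_finsetSum _ fun k _ => integrable_mul_of_memLp (hx k) (mG k)), integral_const_mul,
      integral_finsetSum _ fun k _ => integrable_mul_of_memLp (hx k) (mG k)]
    simp_rw [mul_comm]
  rw [e g G mg mG]
  simp_rw [fun n => e (v n) (fun k => V k n) (mv n) (fun k => mV k n)]
  exact ((hv.integral mv mg).const_mul 2).add (tendsto_finsetSum _ fun k _ =>
    (hV k).integral_mul_const (mV k) (mG k) (hx k))

/-- The jumps of a discrete function with consistent edge means are orthogonal to the normal
components of an `H¹` function. -/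
theorem sum_sideInt (ho : IsOpen Ω) (hc : Convex ℝ Ω) (hb : Bornology.IsBounded Ω)
    {m : τ.cells × Fin 3 → ℝ} (hm : EdgeConsistent τ m) (j : Fin 2) {g : Plane → ℝ}
    {G : Fin 2 → Plane → ℝ} (hg : MemL2 Ω g) (hG : ∀ k, MemL2 Ω (G k))
    (hw : ∀ k, HasWeakDeriv Ω k g (G k)) :
    ∑ K, ∑ i, m (K, i) * baryDeriv (cellBasis τ K) i j * sideInt (cellBasis τ K) i g G = 0 := by
  obtain ⟨v, hv, hvg, hvG⟩ := exists_smooth_tendsto ho hc hb hg hG hw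
  have hv1 : ∀ n, ContDiff ℝ 1 (v n) := fun n => (hv n).of_le (by simp)
  have hle : ∀ K, volume.restrict (tri (cellBasis τ K)) ≤ volume.restrict Ω := fun K =>
    Measure.restrict_mono (by rw [tri_cellBasis]; exact cell_subset τ ho hc K) le_rfl
  refine tendsto_nhds_unique (tendsto_finsetSum _ fun K _ => tendsto_finsetSum _ fun i _ =>
    (TendstoL2.sideInt (cellBasis τ K) i (hvg.mono_measure (hle K))
      (fun k => (hvG k).mono_measure (hle K))
      (fun n => memLp_two_of_continuous (isBounded_tri _) (hv n).continuous)
      (fun k n => memLp_two_of_continuous (isBounded_tri _) (continuous_partialDeriv (hv1 n) k))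
      (hg.mono_measure (hle K)) (fun k => (hG k).mono_measure (hle K))).const_mul _) ?_
  refine tendsto_const_nhds.congr fun n => ?_
  exact (sum_sideInt_smooth τ ho hc hb hm j (hv1 n)).symm

end

section

/-! ### Polynomial functions -/

lemma analyticOnNhd_of_mem_polySpace {k : ℕ} {v : Plane → ℝ} (hv : v ∈ polySpace k) :
    AnalyticOnNhd ℝ v Set.univ := by
  obtain ⟨p, -, hp⟩ := hv
  have h := AnalyticOnNhd.eval_continuousLinearMap' (𝕜 := ℝ) (E := Plane)
    (fun i : Fin 2 => EuclideanSpace.proj i) p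
  have e : v = fun x : Plane => MvPolynomial.eval (fun i => EuclideanSpace.proj (𝕜 := ℝ) i x) p :=
    funext fun x => by rw [hp]; rfl
  rw [e]
  exact h

lemma contDiff_of_mem_polySpace {k : ℕ} {n : WithTop ℕ∞} {v : Plane → ℝ} (hv : v ∈ polySpace k) :
    ContDiff ℝ n v := (analyticOnNhd_of_mem_polySpace hv).contDiff

lemma polySpace_mono {k l : ℕ} (h : k ≤ l) : polySpace k ≤ polySpace l := by
  rintro v ⟨p, hp, hv⟩
  exact ⟨p, hp.trans h, hv⟩

lemma mul_mem_polySpace {k l : ℕ} {v w : Plane → ℝ} (hv : v ∈ polySpace k)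
    (hw : w ∈ polySpace l) : (fun x => v x * w x) ∈ polySpace (k + l) := by
  obtain ⟨p, hp, hv⟩ := hv
  obtain ⟨q, hq, hw⟩ := hw
  exact ⟨p * q, (MvPolynomial.totalDegree_mul p q).trans (add_le_add hp hq),
    fun x => by simp [hv, hw]⟩

lemma const_mem_polySpace (k : ℕ) (c : ℝ) : (fun _ => c) ∈ polySpace k :=
  ⟨MvPolynomial.C c, by simp, fun x => by simp⟩

lemma affine_mem_polySpace (A : Plane →ᵃ[ℝ] ℝ) : (A : Plane → ℝ) ∈ polySpace 1 := by
  refine ⟨MvPolynomial.C (A 0) + ∑ i, MvPolynomial.C (A.linear (EuclideanSpace.single i 1)) *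
    MvPolynomial.X i, ?_, fun x => ?_⟩
  · refine (MvPolynomial.totalDegree_add _ _).trans (max_le (by simp) ?_)
    refine (MvPolynomial.totalDegree_finsetSum _ _).trans (Finset.sup_le fun i _ => ?_)
    refine (MvPolynomial.totalDegree_mul _ _).trans ?_
    simp
  · have hx : x = ∑ i, x i • (EuclideanSpace.single i (1 : ℝ) : Plane) := by
      ext j; fin_cases j <;> simp
    have h1 : A x = A.linear x + A 0 := by
      have := A.map_vadd 0 x
      simpa using this
    rw [h1]
    conv_lhs => rw [hx]
    simp [mul_comm, add_comm]

lemma coord_mem_polySpace (i : Fin 2) : (fun x : Plane => x i) ∈ polySpace 1 :=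
  ⟨MvPolynomial.X i, by simp, fun x => by simp⟩

lemma eq_affine_of_mem_polySpace_one {v : Plane → ℝ} (hv : v ∈ polySpace 1) :
    ∃ c d e : ℝ, ∀ x, v x = c + d * x 0 + e * x 1 := by
  obtain ⟨p, hp, hv⟩ := hv
  have key : ∀ S : Finset (Fin 2 →₀ ℕ), S ⊆ p.support → ∃ c d e : ℝ, ∀ x : Plane,
      ∑ s ∈ S, p.coeff s * ∏ i, x i ^ s i = c + d * x 0 + e * x 1 := by
    classical
    intro S
    induction S using Finset.induction_on with
    | empty => exact fun _ => ⟨0, 0, 0, fun x => by simp⟩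
    | insert s S hs ih =>
      intro hS
      obtain ⟨c, d, e, h⟩ := ih fun t ht => hS (Finset.mem_insert_of_mem ht)
      have hdeg : s 0 + s 1 ≤ 1 := by
        have := MvPolynomial.le_totalDegree (hS (Finset.mem_insert_self s S))
        have h2 := this.trans hp
        rwa [Finsupp.sum_fintype _ _ (fun _ => rfl), Fin.sum_univ_two] at h2
      have hcases : (s 0 = 0 ∧ s 1 = 0) ∨ (s 0 = 1 ∧ s 1 = 0) ∨ (s 0 = 0 ∧ s 1 = 1) := by omega
      rcases hcases with ⟨h0, h1⟩ | ⟨h0, h1⟩ | ⟨h0, h1⟩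
      · refine ⟨c + p.coeff s, d, e, fun x => ?_⟩
        rw [Finset.sum_insert hs, h, Fin.prod_univ_two, h0, h1]; ring
      · refine ⟨c, d + p.coeff s, e, fun x => ?_⟩
        rw [Finset.sum_insert hs, h, Fin.prod_univ_two, h0, h1]; ring
      · refine ⟨c, d, e + p.coeff s, fun x => ?_⟩
        rw [Finset.sum_insert hs, h, Fin.prod_univ_two, h0, h1]; ring
  obtain ⟨c, d, e, h⟩ := key p.support subset_rfl
  exact ⟨c, d, e, fun x => by rw [hv, MvPolynomial.eval_eq', h]⟩

/-- The midpoint rule is exact for affine functions. It turns the midpoint conditions defining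
`V_h¹` into conditions on edge means, which conforming functions satisfy too. -/
lemma edgeAvg_eq_midpoint {v : Plane → ℝ} (hv : v ∈ polySpace 1) (b c : Plane) :
    edgeAvg b c v = v (midpoint ℝ b c) := by
  obtain ⟨k, d, e, h⟩ := eq_affine_of_mem_polySpace_one hv
  have e1 : ∀ t : ℝ, v (AffineMap.lineMap b c t) =
      (k + d * b 0 + e * b 1) + t * (d * (c 0 - b 0) + e * (c 1 - b 1)) := by
    intro t
    rw [h, AffineMap.lineMap_apply_module]
    simp
    ring
  have e2 : v (midpoint ℝ b c) =
      (k + d * b 0 + e * b 1) + (1 / 2) * (d * (c 0 - b 0) + e * (c 1 - b 1)) := by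
    rw [← e1, midpoint]
    norm_num
  unfold edgeAvg
  simp_rw [e1]
  rw [e2, intervalIntegral.integral_add (by simp) (Continuous.intervalIntegrable (by fun_prop) _ _),
    intervalIntegral.integral_mul_const]
  simp

lemma edgeAvg_add {g k : Plane → ℝ} (hg : Continuous g) (hk : Continuous k) (b c : Plane) :
    edgeAvg b c (g + k) = edgeAvg b c g + edgeAvg b c k := by
  unfold edgeAvg
  have hl : Continuous fun t : ℝ => AffineMap.lineMap b c t := AffineMap.lineMap_continuous
  exact intervalIntegral.integral_add ((hg.comp hl).intervalIntegrable _ _)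
    ((hk.comp hl).intervalIntegrable _ _)

lemma refBasis_comp_mem_polySpace (F : Plane →ᵃ[ℝ] Plane) (i : Fin 3) :
    refBasis i ∘ F ∈ polySpace 2 := by
  have hF : ∀ j : Fin 2, (fun x => F x j) ∈ polySpace 1 := fun j =>
    affine_mem_polySpace ((EuclideanSpace.projₗ (𝕜 := ℝ) j).toAffineMap.comp F)
  have hc := const_mem_polySpace 1
  have h2 : ∀ j : Fin 2, (fun x => 2 * F x j) ∈ polySpace 1 := fun j =>
    (polySpace 1).smul_mem 2 (hF j)
  fin_cases i
  · exact mul_mem_polySpace ((polySpace 1).add_mem ((polySpace 1).add_mem (hc (-1)) (h2 0)) (h2 1))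
      ((polySpace 1).add_mem ((polySpace 1).add_mem (hc (-1)) (hF 0)) (hF 1))
  · exact mul_mem_polySpace ((polySpace 1).sub_mem (h2 0) (hc 1)) (hF 0)
  · exact mul_mem_polySpace ((polySpace 1).sub_mem (h2 1) (hc 1)) (hF 1)

lemma vertexQuadratics_le (K : Finset Plane) : vertexQuadratics K ≤ polySpace 2 := by
  refine Submodule.span_le.2 ?_
  rintro q ⟨F, i, -, rfl⟩
  exact refBasis_comp_mem_polySpace F.symm.toAffineMap i

/-- Evaluation of polynomials as a linear map to functions on the plane. -/
def polyEval : MvPolynomial (Fin 2) ℝ →ₗ[ℝ] Plane → ℝ where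
  toFun p x := MvPolynomial.eval (fun i => x i) p
  map_add' p q := by ext x; simp
  map_smul' c p := by ext x; simp [MvPolynomial.smul_eval]

instance (k : ℕ) : FiniteDimensional ℝ (polySpace k) := by
  have : polySpace k ≤ (MvPolynomial.restrictTotalDegree (Fin 2) ℝ k).map polyEval := by
    rintro v ⟨p, hp, hv⟩
    exact ⟨p, (MvPolynomial.mem_restrictTotalDegree _ _ _).2 hp, funext fun x => (hv x).symm⟩
  exact Submodule.finiteDimensional_of_le this

/-- The conclusion concerns the whole plane, because a discrete function is a polynomial on the
plane for each cell; it extends from `U` by analyticity. -/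
lemma eq_const_of_partialDeriv_eq_zero {k : ℕ} {v : Plane → ℝ} (hv : v ∈ polySpace k)
    {U : Set Plane} (hU : IsOpen U) (hc : Convex ℝ U) (hne : U.Nonempty)
    (h : ∀ x ∈ U, ∀ j, partialDeriv j v x = 0) : ∃ c, v = fun _ => c := by
  have hd : Differentiable ℝ v := (contDiff_of_mem_polySpace (n := 1) hv).differentiable one_ne_zero
  obtain ⟨c, hc'⟩ := hU.exists_is_const_of_fderiv_eq_zero hc.isPreconnected hd.differentiableOn
    (fun x hx => by
      ext w
      rw [fderiv_apply_eq_sum]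
      simp [h x hx])
  obtain ⟨x, hx⟩ := hne
  refine ⟨c, (analyticOnNhd_of_mem_polySpace hv).eq_of_eventuallyEq (z₀ := x)
    (analyticOnNhd_of_mem_polySpace (const_mem_polySpace 0 c)) ?_⟩
  filter_upwards [hU.mem_nhds hx] with y hy using hc' y hy

/-! ### The discrete spaces -/

variable {Ω : Set Plane} (τ : Triangulation Ω)

/-- If some point of the segment were in `Ω`, the midpoint would lie between it and an endpoint in
the closure, hence in the interior by convexity. -/
lemma segment_subset_frontier (ho : IsOpen Ω) (hc : Convex ℝ Ω) {a b : Plane}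
    (ha : a ∈ closure Ω) (hb : b ∈ closure Ω) (h : midpoint ℝ a b ∉ Ω) :
    segment ℝ a b ⊆ frontier Ω := by
  intro x hx
  have hxc : x ∈ closure Ω := hc.closure.segment_subset ha hb hx
  rw [ho.frontier_eq]
  refine ⟨hxc, fun hxΩ => h ?_⟩
  rw [segment_eq_image_lineMap] at hx
  obtain ⟨t, ⟨ht0, ht1⟩, rfl⟩ := hx
  rw [AffineMap.lineMap_apply_module] at hxΩ
  rw [← ho.interior_eq] at hxΩ ⊢
  have hmid : midpoint ℝ a b = (1 / 2 : ℝ) • a + (1 / 2 : ℝ) • b := by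
    rw [midpoint_eq_smul_add, smul_add]; norm_num
  -- For `t ≤ 1/2` the midpoint is `1 / (2 (1 - t))` times the given point plus the remaining weight
  -- times `b`; otherwise `a` takes the role of `b`.
  rcases le_total t (1 / 2) with h2 | h2
  · have h1t : (1 - t) ≠ 0 := by linarith
    have := hc.combo_interior_closure_mem_interior hxΩ hb (a := 1 / (2 * (1 - t)))
      (b := 1 - 1 / (2 * (1 - t))) (by apply one_div_pos.2; linarith) (by
        rw [sub_nonneg, div_le_one (by linarith)]; linarith) (by ring)
    convert this using 1
    rw [hmid]
    match_scalars <;> field_simp <;> ring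
  · have h1t : t ≠ 0 := by linarith
    have := hc.combo_interior_closure_mem_interior hxΩ ha (a := 1 / (2 * t))
      (b := 1 - 1 / (2 * t)) (by apply one_div_pos.2; linarith) (by
        rw [sub_nonneg, div_le_one (by linarith)]; linarith) (by ring)
    convert this using 1
    rw [hmid]
    match_scalars <;> field_simp <;> ring

lemma cellBasis_mem_closure (K : τ.cells) (i : Fin 3) : cellBasis τ K i ∈ closure Ω :=
  hull_subset_closure τ K (subset_convexHull ℝ _ (cellBasis_mem τ K i))

lemma segment_subset_frontier_of_edgeMid (ho : IsOpen Ω) (hc : Convex ℝ Ω) {p : τ.cells × Fin 3}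
    (h : edgeMid τ p ∉ Ω) :
    segment ℝ (cellBasis τ p.1 (p.2 + 1)) (cellBasis τ p.1 (p.2 + 2)) ⊆ frontier Ω :=
  segment_subset_frontier ho hc (cellBasis_mem_closure τ _ _) (cellBasis_mem_closure τ _ _) h

/-- The edge means of a piecewise function. -/
def edgeMeans (v : Piecewise τ) (p : τ.cells × Fin 3) : ℝ := cellEdgeAvg τ p (v p.1)

lemma edgeConsistent_of_mem_spaceNC1 (ho : IsOpen Ω) (hc : Convex ℝ Ω) {v : Piecewise τ}
    (hv : v ∈ spaceNC1 τ) : EdgeConsistent τ (edgeMeans τ v) := by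
  obtain ⟨h1, h2, h3⟩ := hv
  have e : ∀ p, edgeMeans τ v p = v p.1 (edgeMid τ p) := fun p =>
    edgeAvg_eq_midpoint (h1 p.1) _ _
  refine ⟨fun p q hpq => ?_, fun p hp => ?_⟩
  · have hp : ∀ x ∈ cellEdge τ p, x ∈ q.1.1 := fun x hx =>
      cellEdge_subset τ q (hpq ▸ hx)
    have hm : edgeMid τ p = edgeMid τ q := by
      unfold edgeMid
      rcases pair_cases hpq with ⟨h4, h5⟩ | ⟨h4, h5⟩
      · rw [h4, h5]
      · rw [h4, h5, midpoint_comm]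
    rw [e, e, ← hm]
    exact h2 p.1 q.1 _ _ (cellBasis_ne τ p.1 p.2) (cellBasis_mem τ _ _) (cellBasis_mem τ _ _)
      (hp _ (Finset.mem_insert_self _ _))
      (hp _ (Finset.mem_insert_of_mem (Finset.mem_singleton_self _)))
  · rw [e]
    exact h3 p.1 _ _ (cellBasis_ne τ p.1 p.2) (cellBasis_mem τ _ _) (cellBasis_mem τ _ _)
      (segment_subset_frontier_of_edgeMid τ ho hc hp)

lemma segment_subset_hull (p : τ.cells × Fin 3) :
    segment ℝ (cellBasis τ p.1 (p.2 + 1)) (cellBasis τ p.1 (p.2 + 2)) ⊆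
      convexHull ℝ (p.1.1 : Set Plane) := by
  rw [← convexHull_cellEdge]
  exact convexHull_mono (Finset.coe_subset.2 (cellEdge_subset τ p))

lemma edgeConsistent_of_mem_conformingSpace (ho : IsOpen Ω) (hc : Convex ℝ Ω)
    {D : τ.cells → Submodule ℝ (Plane → ℝ)} {v : Piecewise τ}
    (hv : v ∈ conformingSpace τ D) : EdgeConsistent τ (edgeMeans τ v) := by
  obtain ⟨-, h2, h3⟩ := hv
  refine ⟨fun p q hpq => ?_, fun p hp => ?_⟩
  · have hseg : ∀ r, segment ℝ (cellBasis τ r.1 (r.2 + 1)) (cellBasis τ r.1 (r.2 + 2)) =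
      convexHull ℝ (cellEdge τ r : Set Plane) := fun r => (convexHull_cellEdge τ r).symm
    unfold edgeMeans
    rw [cellEdgeAvg_congr τ hpq]
    refine edgeAvg_congr fun x hx => ?_
    refine h2 _ _ x ?_ (segment_subset_hull τ q hx)
    refine segment_subset_hull τ p ?_
    rwa [hseg, hpq, ← hseg]
  · have : edgeMeans τ v p = cellEdgeAvg τ p (fun _ => 0) :=
      edgeAvg_congr fun x hx => h3 _ x (segment_subset_hull τ p hx)
        (segment_subset_frontier_of_edgeMid τ ho hc hp hx)
    rw [this]
    simp [cellEdgeAvg, edgeAvg]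

/-- What the analysis uses of the discrete space: it contains the nonconforming space, and
consists of piecewise quadratic functions with consistent edge means. -/
structure Admissible (Vh : Submodule ℝ (Piecewise τ)) : Prop where
  le : spaceNC1 τ ≤ Vh
  poly : ∀ v ∈ Vh, ∀ K, v K ∈ polySpace 2
  edge : ∀ v ∈ Vh, EdgeConsistent τ (edgeMeans τ v)

lemma admissible_sup (ho : IsOpen Ω) (hc : Convex ℝ Ω) (D : τ.cells → Submodule ℝ (Plane → ℝ))
    (hD : ∀ K, D K ≤ polySpace 2) : Admissible τ (spaceNC1 τ ⊔ conformingSpace τ D) := by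
  refine ⟨le_sup_left, fun v hv K => ?_, fun v hv => ?_⟩
  · obtain ⟨v1, h1, v2, h2, rfl⟩ := Submodule.mem_sup.1 hv
    exact (polySpace 2).add_mem (polySpace_mono one_le_two (h1.1 K)) (hD K (h2.1 K))
  · obtain ⟨v1, h1, v2, h2, rfl⟩ := Submodule.mem_sup.1 hv
    have e1 := edgeConsistent_of_mem_spaceNC1 τ ho hc h1
    have e2 := edgeConsistent_of_mem_conformingSpace τ ho hc h2
    have e : ∀ p, edgeMeans τ (v1 + v2) p = edgeMeans τ v1 p + edgeMeans τ v2 p := fun p =>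
      edgeAvg_add (contDiff_of_mem_polySpace (n := 0) (h1.1 p.1)).continuous
        (contDiff_of_mem_polySpace (n := 0) (hD _ (h2.1 p.1))).continuous _ _
    exact ⟨fun p q hpq => by rw [e, e, e1.1 p q hpq, e2.1 p q hpq],
      fun p hp => by rw [e, e1.2 p hp, e2.2 p hp, add_zero]⟩

lemma finiteDimensional_of_poly {Vh : Submodule ℝ (Piecewise τ)}
    (h : ∀ v ∈ Vh, ∀ K, v K ∈ polySpace 2) : FiniteDimensional ℝ Vh := by
  let f : Vh →ₗ[ℝ] (τ.cells → polySpace 2) :=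
    { toFun := fun v K => ⟨v.1 K, h v.1 v.2 K⟩
      map_add' := fun v w => rfl
      map_smul' := fun c v => rfl }
  refine FiniteDimensional.of_injective f fun v w hvw => Subtype.ext (funext fun K => ?_)
  exact congrArg (fun u : τ.cells → polySpace 2 => (u K).1) hvw

/-! #### The nonconforming interpolant -/

/-- The nonconforming interpolant of a function, given by its edge means. -/
def interpolant (g : Plane → ℝ) : Piecewise τ := fun K x =>
  ∑ i, cellEdgeAvg τ (K, i) g * (1 - 2 * (cellBasis τ K).coord i x)

lemma interpolant_poly (g : Plane → ℝ) (K : τ.cells) : interpolant τ g K ∈ polySpace 1 := by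
  have : interpolant τ g K = ∑ i, cellEdgeAvg τ (K, i) g •
      ((fun _ => (1 : ℝ)) - (2 : ℝ) • ((cellBasis τ K).coord i : Plane → ℝ)) := by
    funext x
    simp [interpolant]
  rw [this]
  exact Submodule.sum_mem _ fun i _ => Submodule.smul_mem _ _ (Submodule.sub_mem _
    (const_mem_polySpace 1 1) (Submodule.smul_mem _ _ (affine_mem_polySpace _)))

lemma coord_midpoint (B : AffineBasis (Fin 3) ℝ Plane) (i k l : Fin 3) :
    B.coord i (midpoint ℝ (B k) (B l)) =
      ((if i = k then 1 else 0) + (if i = l then 1 else 0)) / 2 := by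
  rw [AffineMap.map_midpoint, B.coord_apply, B.coord_apply, midpoint_eq_smul_add]
  simp only [invOf_eq_inv, smul_eq_mul]
  ring

/-- The function `1 - 2 λ_i` is `1` at the midpoint of the side opposite to vertex `i`, where `λ_i =
0`, and `0` at the other two midpoints, where `λ_i = 1/2`. -/
lemma interpolant_midpoint (g : Plane → ℝ) (K : τ.cells) {a b : Plane} (hab : a ≠ b)
    (ha : a ∈ K.1) (hb : b ∈ K.1) : interpolant τ g K (midpoint ℝ a b) = edgeAvg a b g := by
  have ha' : a ∈ Set.range (cellBasis τ K) := by rw [range_cellBasis]; exact ha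
  have hb' : b ∈ Set.range (cellBasis τ K) := by rw [range_cellBasis]; exact hb
  obtain ⟨k, rfl⟩ := ha'
  obtain ⟨l, rfl⟩ := hb'
  have hkl : k ≠ l := fun h => hab (by rw [h])
  have hsym := edgeAvg_symm (cellBasis τ K k) (cellBasis τ K l) g
  simp only [interpolant, coord_midpoint, Fin.sum_univ_three, cellEdgeAvg]
  fin_cases k <;> fin_cases l <;> first | exact absurd rfl hkl | skip
  all_goals
    simp only [Fin.zero_eta, Fin.mk_one, Fin.reduceFinMk] at hsym ⊢
    simp [show (1 : Fin 3) + 2 = 0 from rfl, show (2 : Fin 3) + 2 = 1 from rfl,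
      show (2 : Fin 3) + 1 = 0 from rfl, show (1 : Fin 3) + 1 = 2 from rfl]
    try exact hsym.symm

lemma interpolant_mem (ho : IsOpen Ω) {φ : Plane → ℝ} (hφ : IsTestFun Ω φ) :
    interpolant τ φ ∈ spaceNC1 τ := by
  refine ⟨interpolant_poly τ φ, fun K L a b hab h1 h2 h3 h4 => ?_, fun K a b hab h1 h2 h3 => ?_⟩
  · rw [interpolant_midpoint τ φ K hab h1 h2, interpolant_midpoint τ φ L hab h3 h4]
  · rw [interpolant_midpoint τ φ K hab h1 h2]
    have : edgeAvg a b φ = edgeAvg a b (fun _ => 0) := edgeAvg_congr fun x hx =>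
      hφ.eq_zero fun hxΩ => by
        have := h3 hx
        rw [ho.frontier_eq] at this
        exact this.2 hxΩ
    rw [this]
    simp [edgeAvg]

lemma partialDeriv_affine (A : Plane →ᵃ[ℝ] ℝ) (j : Fin 2) (x : Plane) :
    partialDeriv j A x = A.linear (EuclideanSpace.single j 1) := by
  unfold partialDeriv
  have h : HasFDerivAt (A : Plane → ℝ) A.linear.toContinuousLinearMap x := by
    have e : (A : Plane → ℝ) = fun y => A.linear.toContinuousLinearMap y + A 0 := by
      funext y
      have := A.map_vadd 0 y
      simpa using this
    rw [e]
    exact A.linear.toContinuousLinearMap.hasFDerivAt.add_const _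
  rw [h.fderiv]
  rfl

lemma differentiable_affine (A : Plane →ᵃ[ℝ] ℝ) : Differentiable ℝ (A : Plane → ℝ) :=
  (contDiff_of_mem_polySpace (n := 1) (affine_mem_polySpace A)).differentiable one_ne_zero

/-- The gradient of the interpolant is the mean of the gradient. -/
lemma partialDeriv_interpolant {g : Plane → ℝ} (hg : ContDiff ℝ 1 g) (K : τ.cells) (j : Fin 2)
    (x : Plane) : partialDeriv j (interpolant τ g K) x =
      (∫ y in τ.cell K, partialDeriv j g y) / area (cellBasis τ K) := by
  have h1 : partialDeriv j (interpolant τ g K) x =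
      ∑ i, cellEdgeAvg τ (K, i) g * (-(2 * baryDeriv (cellBasis τ K) i j)) := by
    have hd : ∀ i, HasFDerivAt (fun x => cellEdgeAvg τ (K, i) g *
        (1 - 2 * (cellBasis τ K).coord i x)) (cellEdgeAvg τ (K, i) g •
        (-((2 : ℝ) • fderiv ℝ ((cellBasis τ K).coord i) x))) x := fun i =>
      (((differentiable_affine ((cellBasis τ K).coord i) x).hasFDerivAt.const_mul 2).const_sub
        1).const_mul _
    have hs := HasFDerivAt.fun_sum (u := Finset.univ) fun i _ => hd i
    unfold partialDeriv interpolant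
    rw [hs.fderiv]
    simp only [sum_apply, smul_apply,
      neg_apply, smul_eq_mul, baryDeriv]
    simp_rw [← partialDeriv_affine _ _ x]
    rfl
  have hA := (area_pos (cellBasis τ K)).ne'
  -- The gradient of the interpolant is `-2` times the sum of edge means times `∇λ_i`, which is also
  -- what Gauss' formula gives for the cell mean of `∇g`.
  rw [h1, ← tri_cellBasis, integral_partialDeriv_tri_smooth _ hg, eq_div_iff hA, Finset.sum_mul,
    ← Finset.sum_neg_distrib]
  refine Finset.sum_congr rfl fun i _ => ?_
  simp only [cellEdgeAvg]
  ring

/-! #### The broken gradient is injective -/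

/-- A compactly supported `g` would make the integral vanish. Hence `g` is an antiderivative in `x
0` of a product of bump functions, and only `partialDeriv 0 g` is localised in `U`. -/
lemma exists_partialDeriv_pos {U : Set Plane} (hU : IsOpen U) (hne : U.Nonempty) :
    ∃ g : Plane → ℝ, ContDiff ℝ 1 g ∧ (∀ x ∉ U, partialDeriv 0 g x = 0) ∧
      0 < ∫ x in U, partialDeriv 0 g x := by
  obtain ⟨c, hc⟩ := hne
  obtain ⟨r, hr, hball⟩ := Metric.isOpen_iff.1 hU c hc
  let β : ∀ i : Fin 2, ContDiffBump (c i) := fun i =>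
    { rIn := r / 4, rOut := r / 2, rIn_pos := by positivity, rIn_lt_rOut := by linarith }
  have hβ : ∀ i, ContDiff ℝ 1 (β i) := fun i => (β i).contDiff
  set A : ℝ → ℝ := fun s => ∫ t in (0 : ℝ)..s, β 0 t with hA
  have hAd : ∀ s, HasDerivAt A (β 0 s) s := fun s =>
    intervalIntegral.integral_hasDerivAt_right ((β 0).continuous.intervalIntegrable _ _)
      ((β 0).continuous.stronglyMeasurableAtFilter _ _) (β 0).continuous.continuousAt
  have hA1 : ContDiff ℝ 1 A := by
    rw [contDiff_one_iff_deriv]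
    refine ⟨fun s => (hAd s).differentiableAt, ?_⟩
    rw [show deriv A = β 0 from funext fun s => (hAd s).deriv]
    exact (β 0).continuous
  have hp : ∀ i : Fin 2, ContDiff ℝ 1 fun x : Plane => x i := fun i =>
    contDiff_of_mem_polySpace (coord_mem_polySpace i)
  have hder : ∀ x : Plane, partialDeriv 0 (fun x : Plane => A (x 0) * β 1 (x 1)) x =
      β 0 (x 0) * β 1 (x 1) := by
    intro x
    let P : Fin 2 → Plane →L[ℝ] ℝ := fun i => EuclideanSpace.proj i
    have hP0 : P 0 (EuclideanSpace.single 0 1) = 1 := by simp [P]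
    have hP1 : P 1 (EuclideanSpace.single 0 1) = 0 := by simp [P]
    have e0 : HasFDerivAt (fun x : Plane => x 0) (P 0) x := (P 0).hasFDerivAt
    have e1 : HasFDerivAt (fun x : Plane => x 1) (P 1) x := (P 1).hasFDerivAt
    have h1 := (hAd (x 0)).comp_hasFDerivAt x e0
    have h2 := (((hβ 1).differentiable one_ne_zero (x 1)).hasDerivAt).comp_hasFDerivAt x e1
    have h3 := h1.mul h2
    unfold partialDeriv
    have h4 : fderiv ℝ (fun x : Plane => A (x 0) * β 1 (x 1)) x = _ := h3.fderiv
    rw [h4]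
    simp only [add_apply, smul_apply, Function.comp_apply, hP0, hP1, smul_eq_mul]
    ring
  have hzero : ∀ x ∉ U, β 0 (x 0) * β 1 (x 1) = 0 := by
    intro x hx
    by_contra hne
    have h0 : dist (x 0) (c 0) < r / 2 := by
      by_contra h
      exact hne (by rw [(β 0).zero_of_le_dist (not_lt.1 h), zero_mul])
    have h1 : dist (x 1) (c 1) < r / 2 := by
      by_contra h
      exact hne (by rw [(β 1).zero_of_le_dist (not_lt.1 h), mul_zero])
    refine hx (hball ?_)
    rw [Metric.mem_ball, EuclideanSpace.dist_eq, Fin.sum_univ_two, Real.sqrt_lt' hr]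
    nlinarith [dist_nonneg (x := x 0) (y := c 0), dist_nonneg (x := x 1) (y := c 1)]
  refine ⟨fun x => A (x 0) * β 1 (x 1), (hA1.comp (hp 0)).mul ((hβ 1).comp (hp 1)),
    fun x hx => by rw [hder, hzero x hx], ?_⟩
  simp_rw [hder]
  rw [setIntegral_eq_integral_of_forall_compl_eq_zero hzero]
  have hcont : Continuous fun x : Plane => β 0 (x 0) * β 1 (x 1) :=
    ((β 0).continuous.comp (hp 0).continuous).mul ((β 1).continuous.comp (hp 1).continuous)
  refine hcont.integral_pos_of_hasCompactSupport_nonneg_nonzero ?_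
    (fun x => mul_nonneg (β 0).nonneg (β 1).nonneg) (x := c) ?_
  · refine HasCompactSupport.intro (isCompact_closedBall c r) fun x hx => ?_
    by_contra hne
    have h0 : dist (x 0) (c 0) < r / 2 := by
      by_contra h
      exact hne (by rw [(β 0).zero_of_le_dist (not_lt.1 h), zero_mul])
    have h1 : dist (x 1) (c 1) < r / 2 := by
      by_contra h
      exact hne (by rw [(β 1).zero_of_le_dist (not_lt.1 h), mul_zero])
    refine hx ?_
    rw [Metric.mem_closedBall, EuclideanSpace.dist_eq, Fin.sum_univ_two, Real.sqrt_le_left hr.le]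
    nlinarith [dist_nonneg (x := x 0) (y := c 0), dist_nonneg (x := x 1) (y := c 1)]
  · rw [(β 0).one_of_mem_closedBall (Metric.mem_closedBall_self (β 0).rIn_pos.le),
      (β 1).one_of_mem_closedBall (Metric.mem_closedBall_self (β 1).rIn_pos.le)]
    norm_num

lemma nonempty_cell (K : τ.cells) : (τ.cell K).Nonempty := by
  rw [← tri_cellBasis]; exact nonempty_tri _

lemma convex_cell (K : τ.cells) : Convex ℝ (τ.cell K) := (convex_convexHull ℝ _).interior

/-- On each cell `v` is a constant `c L`, so the jump identity for a smooth `g` reads `∑ c L ∫_L ∂_0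
g = 0`. A `g` whose derivative lives in the single cell `K` isolates `c K`. This replaces passing
from cell to cell until the boundary is reached. -/
lemma eq_zero_of_partialDeriv_eq_zero (ho : IsOpen Ω) (hc : Convex ℝ Ω)
    (hb : Bornology.IsBounded Ω) {v : Piecewise τ} (hp : ∀ K, v K ∈ polySpace 2)
    (he : EdgeConsistent τ (edgeMeans τ v))
    (h : ∀ K, ∀ x ∈ τ.cell K, ∀ j, partialDeriv j (v K) x = 0) : v = 0 := by
  have hconst : ∀ K, ∃ c, v K = fun _ => c := fun K =>
    eq_const_of_partialDeriv_eq_zero (hp K) (isOpen_cell τ K) (convex_cell τ K)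
      (nonempty_cell τ K) (h K)
  choose c hcv using hconst
  have hm : ∀ p, edgeMeans τ v p = c p.1 := fun p => by
    simp [edgeMeans, cellEdgeAvg, edgeAvg, hcv]
  funext K
  obtain ⟨g, hg, hg0, hgpos⟩ := exists_partialDeriv_pos (isOpen_cell τ K) (nonempty_cell τ K)
  have hsum := sum_sideInt_smooth τ ho hc hb he 0 hg
  have e : ∀ L, ∑ i, edgeMeans τ v (L, i) * baryDeriv (cellBasis τ L) i 0 *
      sideInt (cellBasis τ L) i g (fun k => partialDeriv k g) =
      -(c L * ∫ x in τ.cell L, partialDeriv 0 g x) := by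
    intro L
    rw [← tri_cellBasis, integral_partialDeriv_tri _
      (memLp_two_of_continuous (isBounded_tri _) hg.continuous)
      (fun k => memLp_two_of_continuous (isBounded_tri _) (continuous_partialDeriv hg k)),
      mul_neg, neg_neg, Finset.mul_sum]
    refine Finset.sum_congr rfl fun i _ => ?_
    rw [hm]
    ring
  simp_rw [e] at hsum
  rw [Finset.sum_eq_single K] at hsum
  · have : c K = 0 := by
      have h0 : c K * ∫ x in τ.cell K, partialDeriv 0 g x = 0 := by linarith
      exact (mul_eq_zero.1 h0).resolve_right hgpos.ne'
    rw [hcv K, this]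
    rfl
  · intro L _ hLK
    rw [setIntegral_eq_zero_of_forall_eq_zero fun x hx => hg0 x fun hxK =>
      Set.disjoint_left.1 (disjoint_cell τ hLK) hx hxK]
    simp
  · intro h
    exact absurd (Finset.mem_univ K) h

end

section

/-! ### The consistency error on one triangle -/

section Local

variable (B : AffineBasis (Fin 3) ℝ Plane)

/-- The squared `L²`-norm of a vector field on a triangle. -/
def vecSq (G : Fin 2 → Plane → ℝ) : ℝ := ∑ k, ∫ x in tri B, G k x ^ 2

lemma vecSq_nonneg (G : Fin 2 → Plane → ℝ) : 0 ≤ vecSq B G :=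
  Finset.sum_nonneg fun _ _ => integral_nonneg fun _ => sq_nonneg _

lemma sqrt_integral_le_sqrt_vecSq (G : Fin 2 → Plane → ℝ) (k : Fin 2) :
    √(∫ x in tri B, G k x ^ 2) ≤ √(vecSq B G) :=
  Real.sqrt_le_sqrt (Finset.single_le_sum
    (f := fun k => ∫ x in tri B, G k x ^ 2)
    (fun _ _ => integral_nonneg fun _ => sq_nonneg _) (Finset.mem_univ k))

/-- The moment of a vector field with respect to the vertex `i`. -/
def moment (i : Fin 3) (G : Fin 2 → Plane → ℝ) : ℝ :=
  ∫ x in tri B, ∑ k, (x k - B i k) * G k x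

variable {d : ℝ}

lemma sideInt_eq_add_moment (i : Fin 3) {g : Plane → ℝ} {G : Fin 2 → Plane → ℝ}
    (hg : MemLp g 2 (volume.restrict (tri B)))
    (hG : ∀ k, MemLp (G k) 2 (volume.restrict (tri B))) :
    sideInt B i g G = 2 * (∫ x in tri B, g x) + moment B i G := by
  have hx : ∀ k : Fin 2, MemLp (fun x : Plane => x k - B i k) 2 (volume.restrict (tri B)) :=
    fun k => memLp_two_of_continuous (isBounded_tri B) (by fun_prop)
  rw [sideInt, moment, integral_add ((hg.integrable (by norm_num)).const_mul 2)
    (integrable_finsetSum _ fun k _ => integrable_mul_of_memLp (hx k) (hG k)), integral_const_mul]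

/-- Cauchy–Schwarz in each of the two components, with `|x k - B i k| ≤ d`. -/
lemma abs_moment_le (hd : ∀ x ∈ tri B, ∀ i, dist x (B i) ≤ d) (hd0 : 0 ≤ d) (i : Fin 3)
    {G : Fin 2 → Plane → ℝ} (hG : ∀ k, MemLp (G k) 2 (volume.restrict (tri B))) :
    |moment B i G| ≤ 2 * (d * √(area B) * √(vecSq B G)) := by
  have hx : ∀ k : Fin 2, MemLp (fun x : Plane => x k - B i k) 2 (volume.restrict (tri B)) :=
    fun k => memLp_two_of_continuous (isBounded_tri B) (by fun_prop)
  have h1 : ∀ k : Fin 2, |∫ x in tri B, (x k - B i k) * G k x| ≤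
      d * √(area B) * √(vecSq B G) := by
    intro k
    refine (abs_integral_mul_le (hx k) (hG k)).trans ?_
    refine mul_le_mul ?_ (sqrt_integral_le_sqrt_vecSq B G k) (Real.sqrt_nonneg _) (by positivity)
    · have : ∫ x in tri B, (x k - B i k) ^ 2 ≤ ∫ x in tri B, d ^ 2 := by
        refine setIntegral_mono_on (hx k).integrable_sq (integrable_const _)
          (isOpen_tri B).measurableSet fun x hxK => ?_
        have h2 : |x k - B i k| ≤ d := by
          have := PiLp.norm_apply_le (x - B i) k
          rw [← dist_eq_norm] at this
          exact this.trans (hd x hxK i)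
        rw [← sq_abs]
        exact pow_le_pow_left₀ (abs_nonneg _) h2 2
      refine (Real.sqrt_le_sqrt this).trans (le_of_eq ?_)
      rw [setIntegral_const, smul_eq_mul, mul_comm, Real.sqrt_mul (sq_nonneg d),
        Real.sqrt_sq hd0]
      rfl
  rw [moment, integral_finsetSum _ fun k _ => integrable_mul_of_memLp (hx k) (hG k),
    Fin.sum_univ_two]
  refine (abs_add_le _ _).trans ?_
  linarith [h1 0, h1 1]

/-- The consistency functional on one triangle. -/
def cellDefect (q : Fin 2 → Plane → ℝ) (D : Fin 2 → Fin 2 → Plane → ℝ) (w : Plane → ℝ) : ℝ :=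
  (∑ j, ((∫ x in tri B, q j x * partialDeriv j w x) + ∫ x in tri B, D j j x * w x)) +
    ∑ j, ∑ i, edgeAvg (B (i + 1)) (B (i + 2)) w * baryDeriv B i j * sideInt B i (q j) (D j)

variable {q : Fin 2 → Plane → ℝ} {D : Fin 2 → Fin 2 → Plane → ℝ} {w : Plane → ℝ}

/-- The defect ignores constants added to `q` or `w`. Subtracting cell means turns `sideInt` of `q
j` into a moment of `D j`, and the edge mean of `w` into a moment of its gradient over `2|K|`. Every
term is then a product of two quantities controlled by first derivatives of `q` and `w`. -/
lemma cellDefect_eq (hq : ∀ j, MemLp (q j) 2 (volume.restrict (tri B)))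
    (hD : ∀ j k, MemLp (D j k) 2 (volume.restrict (tri B))) (hw : ContDiff ℝ 1 w) :
    cellDefect B q D w = ∑ j, ((∫ x in tri B,
        (q j x - (∫ y in tri B, q j y) / area B) * partialDeriv j w x) +
      (∫ x in tri B, D j j x * (w x - (∫ y in tri B, w y) / area B)) +
      ∑ i, (moment B i (fun k => partialDeriv k w) / (2 * area B)) * baryDeriv B i j *
        moment B i (D j)) := by
  have hA := (area_pos B).ne'
  have mw : MemLp w 2 (volume.restrict (tri B)) :=
    memLp_two_of_continuous (isBounded_tri B) hw.continuous
  have mdw : ∀ j, MemLp (partialDeriv j w) 2 (volume.restrict (tri B)) := fun j =>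
    memLp_two_of_continuous (isBounded_tri B) (continuous_partialDeriv hw j)
  unfold cellDefect
  rw [← Finset.sum_add_distrib]
  refine Finset.sum_congr rfl fun j _ => ?_
  set c := (∫ y in tri B, w y) / area B with hc
  set qb := (∫ y in tri B, q j y) / area B with hqb
  set m : Fin 3 → ℝ := fun i => edgeAvg (B (i + 1)) (B (i + 2)) w with hm
  have e1 : ∫ x in tri B, (q j x - qb) * partialDeriv j w x =
      (∫ x in tri B, q j x * partialDeriv j w x) - qb * ∫ x in tri B, partialDeriv j w x := by
    simp_rw [sub_mul]
    rw [integral_sub (integrable_mul_of_memLp (hq j) (mdw j))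
      (((mdw j).integrable (by norm_num)).const_mul _), integral_const_mul]
  have e2 : ∫ x in tri B, D j j x * (w x - c) =
      (∫ x in tri B, D j j x * w x) - c * ∫ x in tri B, D j j x := by
    simp_rw [mul_sub]
    rw [integral_sub (integrable_mul_of_memLp (hD j j) mw)
      (((hD j j).integrable (by norm_num)).mul_const _), integral_mul_const]
    ring
  have e3 := integral_partialDeriv_tri_smooth B hw j
  have e4 := integral_partialDeriv_tri B (hq j) (hD j) j
  have e5 : ∀ i, sideInt B i (q j) (D j) = 2 * (qb * area B) + moment B i (D j) := fun i => by
    rw [sideInt_eq_add_moment B i (hq j) (hD j), hqb, div_mul_cancel₀ _ hA]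
  have e6 : ∀ i, moment B i (fun k => partialDeriv k w) / (2 * area B) = m i - c := fun i => by
    have h1 := sideInt_eq B i hw
    rw [sideInt_eq_add_moment B i mw mdw] at h1
    have h2 : c * area B = ∫ y in tri B, w y := by rw [hc, div_mul_cancel₀ _ hA]
    rw [div_eq_iff (by positivity)]
    change _ = 2 * area B * m i at h1
    rw [← h2] at h1
    linear_combination h1
  have e0 := sum_baryDeriv B j
  rw [e1, e2, e3, e4]
  simp_rw [e5, e6]
  change _ + ∑ i, m i * baryDeriv B i j * (2 * (qb * area B) + moment B i (D j)) = _ -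
    qb * (-∑ i, baryDeriv B i j * (2 * area B * m i)) + _ + _
  simp only [Fin.sum_univ_three] at e0 ⊢
  linear_combination (-2 * c * qb * area B) * e0

/-- A barycentric coordinate stays in `[0, 1]` on the ball, so a step of length `ρ / 2` from the
centre, which remains in the open ball, changes it by at most `1`. -/
lemma abs_baryDeriv_le {x : Plane} {ρ : ℝ} (hρ : 0 < ρ)
    (h : Metric.ball x ρ ⊆ convexHull ℝ (Set.range B)) (i : Fin 3) (j : Fin 2) :
    |baryDeriv B i j| ≤ 2 / ρ := by
  have h01 : ∀ y ∈ Metric.ball x ρ, 0 ≤ B.coord i y ∧ B.coord i y ≤ 1 := by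
    intro y hy
    have h1 := h hy
    rw [AffineBasis.convexHull_eq_nonneg_coord] at h1
    refine ⟨h1 i, ?_⟩
    rw [← B.sum_coord_apply_eq_one y]
    exact Finset.single_le_sum (f := fun i => B.coord i y) (fun k _ => h1 k) (Finset.mem_univ i)
  have hx := h01 x (Metric.mem_ball_self hρ)
  have hy := h01 ((ρ / 2) • (EuclideanSpace.single j (1 : ℝ) : Plane) +ᵥ x) (by
    rw [Metric.mem_ball, dist_eq_norm, vadd_eq_add, add_sub_cancel_right, norm_smul]
    simp only [PiLp.norm_single, norm_one, mul_one, Real.norm_eq_abs]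
    rw [abs_of_pos (by positivity)]
    linarith)
  rw [AffineMap.map_vadd, map_smul, vadd_eq_add, smul_eq_mul] at hy
  change 0 ≤ ρ / 2 * baryDeriv B i j + _ ∧ ρ / 2 * baryDeriv B i j + _ ≤ 1 at hy
  rw [abs_le, le_div_iff₀ hρ, ← neg_div, div_le_iff₀ hρ]
  constructor <;> linarith [hx.1, hx.2, hy.1, hy.2]

/-- For each `j`, Poincaré bounds each of the first two terms of `cellDefect_eq` with constant `2`.
Each of the three moment products costs `4 |γ|`: the areas cancel, and one factor `d / ρ`, from the
gradient of the barycentric coordinate, is at most `|γ|`. Summing over the two values of `j` gives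
`2 (4 + 12 |γ|)`. -/
theorem abs_cellDefect_le {γ ρ : ℝ} {x₀ : Plane} (hρ : 0 < ρ)
    (hball : Metric.ball x₀ ρ ⊆ convexHull ℝ (Set.range B))
    (hd : Metric.diam (convexHull ℝ (Set.range B)) = d) (hdγ : d ≤ γ * ρ)
    (hq : ∀ j, MemLp (q j) 2 (volume.restrict (tri B)))
    (hD : ∀ j k, MemLp (D j k) 2 (volume.restrict (tri B)))
    (hqD : ∀ j k, HasWeakDeriv (tri B) k (q j) (D j k)) (hw : ContDiff ℝ 1 w) :
    |cellDefect B q D w| ≤ (8 + 24 * |γ|) *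
      (d * (√(∑ j, vecSq B (D j)) * √(vecSq B (fun k => partialDeriv k w)))) := by
  have hd0 : 0 ≤ d := hd ▸ Metric.diam_nonneg
  have hbdd : Bornology.IsBounded (convexHull ℝ (Set.range B)) :=
    isBounded_convexHull.2 (Set.finite_range B).isBounded
  have hdd : ∀ x ∈ tri B, ∀ y ∈ tri B, dist x y ≤ d := fun x hx y hy =>
    hd ▸ Metric.dist_le_diam_of_mem hbdd (interior_subset hx) (interior_subset hy)
  have hdv : ∀ x ∈ tri B, ∀ i, dist x (B i) ≤ d := fun x hx i =>
    hd ▸ Metric.dist_le_diam_of_mem hbdd (interior_subset hx)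
      (subset_convexHull ℝ _ (Set.mem_range_self i))
  have hApos := area_pos B
  have mw : MemLp w 2 (volume.restrict (tri B)) :=
    memLp_two_of_continuous (isBounded_tri B) hw.continuous
  have mdw : ∀ j, MemLp (partialDeriv j w) 2 (volume.restrict (tri B)) := fun j =>
    memLp_two_of_continuous (isBounded_tri B) (continuous_partialDeriv hw j)
  have hwD : ∀ k, HasWeakDeriv (tri B) k w (partialDeriv k w) := fun k =>
    hasWeakDeriv_of_contDiff _ k hw
  set Q := √(∑ j, vecSq B (D j)) with hQ
  set W := √(vecSq B (fun k => partialDeriv k w)) with hW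
  have hQ0 : 0 ≤ Q := Real.sqrt_nonneg _
  have hW0 : 0 ≤ W := Real.sqrt_nonneg _
  have hDQ : ∀ j, √(vecSq B (D j)) ≤ Q := fun j => Real.sqrt_le_sqrt
    (Finset.single_le_sum (f := fun j => vecSq B (D j)) (fun k _ => vecSq_nonneg B _)
      (Finset.mem_univ j))
  -- The Poincaré inequality in terms of norms, with `√2` rounded up to `2`.
  have hsq : ∀ {X Y : ℝ}, 0 ≤ Y → X ≤ 2 * d ^ 2 * Y → √X ≤ 2 * d * √Y := by
    intro X Y hY h
    refine (Real.sqrt_le_sqrt h).trans ?_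
    rw [Real.sqrt_mul (by positivity), Real.sqrt_mul (by norm_num), Real.sqrt_sq hd0]
    have : √2 ≤ 2 := by rw [Real.sqrt_le_left (by norm_num)]; norm_num
    gcongr
  have t1 : ∀ j, |∫ x in tri B, (q j x - (∫ y in tri B, q j y) / area B) *
      partialDeriv j w x| ≤ 2 * (d * (Q * W)) := by
    intro j
    refine (abs_integral_mul_le ((hq j).sub (memLp_const _)) (mdw j)).trans ?_
    have h1 := hsq (vecSq_nonneg B (D j)) (poincare (isOpen_tri B) (convex_tri B)
      (isBounded_tri B) hdd (hq j) (hD j) (hqD j))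
    have h2 : 2 * d * √(vecSq B (D j)) ≤ 2 * d * Q := by gcongr; exact hDQ j
    calc _ ≤ (2 * d * Q) * W := mul_le_mul (h1.trans h2)
          (sqrt_integral_le_sqrt_vecSq B (fun k => partialDeriv k w) j) (Real.sqrt_nonneg _)
          (by positivity)
      _ = _ := by ring
  have t2 : ∀ j, |∫ x in tri B, D j j x * (w x - (∫ y in tri B, w y) / area B)| ≤
      2 * (d * (Q * W)) := by
    intro j
    refine (abs_integral_mul_le (hD j j) (mw.sub (memLp_const _))).trans ?_
    have h1 := hsq (vecSq_nonneg B (fun k => partialDeriv k w)) (poincare (isOpen_tri B)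
      (convex_tri B) (isBounded_tri B) hdd mw mdw hwD)
    calc _ ≤ Q * (2 * d * W) := mul_le_mul
          ((sqrt_integral_le_sqrt_vecSq B (D j) j).trans (hDQ j)) h1 (Real.sqrt_nonneg _) hQ0
      _ = _ := by ring
  have t3 : ∀ j i, |(moment B i (fun k => partialDeriv k w) / (2 * area B)) * baryDeriv B i j *
      moment B i (D j)| ≤ 4 * |γ| * (d * (Q * W)) := by
    intro j i
    have h1 := abs_moment_le B hdv hd0 i mdw
    have h2 := abs_moment_le B hdv hd0 i (hD j)
    have h3 := abs_baryDeriv_le B hρ hball i j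
    have h2' : |moment B i (D j)| ≤ 2 * (d * √(area B) * Q) := h2.trans (by gcongr; exact hDQ j)
    rw [abs_mul, abs_mul, abs_div, abs_of_pos (by positivity : 0 < 2 * area B)]
    have hs : √(area B) * √(area B) = area B := Real.mul_self_sqrt hApos.le
    have h4 : d ≤ |γ| * ρ := hdγ.trans (by gcongr; exact le_abs_self γ)
    calc _ ≤ (2 * (d * √(area B) * W) / (2 * area B)) * (2 / ρ) * (2 * (d * √(area B) * Q)) := by
          gcongr
      _ = 4 * d * (d / ρ) * (Q * W) * ((√(area B) * √(area B)) / area B) := by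
          field_simp; ring
      _ = 4 * d * (d / ρ) * (Q * W) := by rw [hs, div_self hApos.ne', mul_one]
      _ ≤ 4 * d * |γ| * (Q * W) := by
          gcongr
          rwa [div_le_iff₀ hρ]
      _ = _ := by ring
  rw [cellDefect_eq B hq hD hw]
  have t4 : ∀ j, |(∫ x in tri B, (q j x - (∫ y in tri B, q j y) / area B) * partialDeriv j w x) +
      (∫ x in tri B, D j j x * (w x - (∫ y in tri B, w y) / area B)) +
      ∑ i, (moment B i (fun k => partialDeriv k w) / (2 * area B)) * baryDeriv B i j *
        moment B i (D j)| ≤ (4 + 12 * |γ|) * (d * (Q * W)) := by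
    intro j
    have h5 : |∑ i, (moment B i (fun k => partialDeriv k w) / (2 * area B)) * baryDeriv B i j *
        moment B i (D j)| ≤ 12 * |γ| * (d * (Q * W)) := by
      refine (Finset.abs_sum_le_sum_abs _ _).trans ?_
      refine (Finset.sum_le_sum fun i _ => t3 j i).trans (le_of_eq ?_)
      simp
      ring
    refine (abs_add_three _ _ _).trans ?_
    linarith [t1 j, t2 j]
  refine (Finset.abs_sum_le_sum_abs _ _).trans ?_
  rw [Fin.sum_univ_two]
  linarith [t4 0, t4 1]

end Local

end

section

/-! ### The space of broken gradients -/

variable {Ω : Set Plane} (τ : Triangulation Ω)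

/-- Square-integrable piecewise vector fields. -/
abbrev GradSpace : Type :=
  PiLp 2 fun p : τ.cells × Fin 2 => Lp ℝ 2 (volume.restrict (τ.cell p.1))

/-- The piecewise vector field with given components. -/
def toGrad (G : τ.cells → Fin 2 → Plane → ℝ)
    (hG : ∀ K i, MemLp (G K i) 2 (volume.restrict (τ.cell K))) : GradSpace τ :=
  WithLp.toLp 2 fun p => (hG p.1 p.2).toLp (G p.1 p.2)

variable {τ} in
lemma inner_toGrad {G H : τ.cells → Fin 2 → Plane → ℝ}
    (hG : ∀ K i, MemLp (G K i) 2 (volume.restrict (τ.cell K)))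
    (hH : ∀ K i, MemLp (H K i) 2 (volume.restrict (τ.cell K))) :
    inner ℝ (toGrad τ G hG) (toGrad τ H hH) =
      ∑ K, ∑ i, ∫ x in τ.cell K, G K i x * H K i x := by
  rw [PiLp.inner_apply, Fintype.sum_prod_type]
  exact Finset.sum_congr rfl fun K _ => Finset.sum_congr rfl fun i _ => inner_toLp (hG K i) (hH K i)

variable {τ} in
lemma norm_toGrad_sq {G : τ.cells → Fin 2 → Plane → ℝ}
    (hG : ∀ K i, MemLp (G K i) 2 (volume.restrict (τ.cell K))) :
    ‖toGrad τ G hG‖ ^ 2 = ∑ K, ∑ i, ∫ x in τ.cell K, G K i x ^ 2 := by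
  rw [← real_inner_self_eq_norm_sq, inner_toGrad]
  simp_rw [sq]

variable {τ} in
lemma toGrad_sub {G H : τ.cells → Fin 2 → Plane → ℝ}
    (hG : ∀ K i, MemLp (G K i) 2 (volume.restrict (τ.cell K)))
    (hH : ∀ K i, MemLp (H K i) 2 (volume.restrict (τ.cell K))) :
    toGrad τ (fun K i x => G K i x - H K i x) (fun K i => (hG K i).sub (hH K i)) =
      toGrad τ G hG - toGrad τ H hH := rfl

/-- Removes the arbitrary representatives inside `brokenForm`: any square-integrable weak gradients
on the cells may be used instead, such as classical ones for polynomials and the restriction of the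
global one for `u`. -/
lemma brokenForm_eq_inner {v w : Piecewise τ} {G H : τ.cells → Fin 2 → Plane → ℝ}
    (hG : ∀ K i, MemLp (G K i) 2 (volume.restrict (τ.cell K)))
    (hH : ∀ K i, MemLp (H K i) 2 (volume.restrict (τ.cell K)))
    (hv : ∀ K i, HasWeakDeriv (τ.cell K) i (v K) (G K i))
    (hw : ∀ K i, HasWeakDeriv (τ.cell K) i (w K) (H K i)) :
    brokenForm τ v w = inner ℝ (toGrad τ G hG) (toGrad τ H hH) := by
  rw [inner_toGrad, brokenForm]
  refine Finset.sum_congr rfl fun K _ => ?_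
  rw [← integral_finsetSum _ fun i _ => integrable_mul_of_memLp (hG K i) (hH K i)]
  refine integral_congr_ae ?_
  have h1 := ae_all_iff.2 fun i => (hv K i).weakDeriv_ae_eq (isOpen_cell τ K)
  have h2 := ae_all_iff.2 fun i => (hw K i).weakDeriv_ae_eq (isOpen_cell τ K)
  filter_upwards [h1, h2] with x hx1 hx2
  exact Finset.sum_congr rfl fun i _ => by rw [hx1 i, hx2 i]

lemma isBounded_cell (K : τ.cells) : Bornology.IsBounded (τ.cell K) := by
  rw [← tri_cellBasis]; exact isBounded_tri _

/-- Piecewise quadratic functions. -/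
def piecewiseQuad : Submodule ℝ (Piecewise τ) := Submodule.pi Set.univ fun _ => polySpace 2

variable {τ} in
lemma piecewiseQuad_poly (v : piecewiseQuad τ) (K : τ.cells) : v.1 K ∈ polySpace 2 :=
  v.2 K (Set.mem_univ K)

variable {τ} in
lemma piecewiseQuad_contDiff (v : piecewiseQuad τ) (K : τ.cells) : ContDiff ℝ 1 (v.1 K) :=
  contDiff_of_mem_polySpace (piecewiseQuad_poly v K)

variable {τ} in
lemma piecewiseQuad_memLp (v : piecewiseQuad τ) (K : τ.cells) (i : Fin 2) :
    MemLp (partialDeriv i (v.1 K)) 2 (volume.restrict (τ.cell K)) :=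
  memLp_two_of_continuous (isBounded_cell τ K)
    (continuous_partialDeriv (piecewiseQuad_contDiff v K) i)

/-- The broken gradient of a piecewise quadratic function. -/
def brokenGrad : piecewiseQuad τ →ₗ[ℝ] GradSpace τ where
  toFun v := toGrad τ (fun K i => partialDeriv i (v.1 K)) (piecewiseQuad_memLp v)
  map_add' v w := by
    ext1 p
    change (piecewiseQuad_memLp (v + w) p.1 p.2).toLp _ =
      (piecewiseQuad_memLp v p.1 p.2).toLp _ + (piecewiseQuad_memLp w p.1 p.2).toLp _
    rw [← MemLp.toLp_add, MemLp.toLp_eq_toLp_iff]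
    refine Eventually.of_forall fun x => ?_
    change fderiv ℝ (v.1 p.1 + w.1 p.1) x _ = _
    rw [fderiv_add ((piecewiseQuad_contDiff v p.1).differentiable one_ne_zero x)
      ((piecewiseQuad_contDiff w p.1).differentiable one_ne_zero x)]
    rfl
  map_smul' c v := by
    ext1 p
    change (piecewiseQuad_memLp (c • v) p.1 p.2).toLp _ =
      c • (piecewiseQuad_memLp v p.1 p.2).toLp _
    rw [← MemLp.toLp_const_smul, MemLp.toLp_eq_toLp_iff]
    refine Eventually.of_forall fun x => ?_
    change fderiv ℝ (c • v.1 p.1) x _ = _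
    rw [fderiv_const_smul ((piecewiseQuad_contDiff v p.1).differentiable one_ne_zero x)]
    rfl

lemma brokenForm_eq_brokenGrad (v w : piecewiseQuad τ) :
    brokenForm τ v.1 w.1 = inner ℝ (brokenGrad τ v) (brokenGrad τ w) :=
  brokenForm_eq_inner τ (piecewiseQuad_memLp v) (piecewiseQuad_memLp w)
    (fun K i => hasWeakDeriv_of_contDiff _ i (piecewiseQuad_contDiff v K))
    (fun K i => hasWeakDeriv_of_contDiff _ i (piecewiseQuad_contDiff w K))

/-! ### Unique solvability of the discrete problem -/

variable {Vh : Submodule ℝ (Piecewise τ)}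

lemma Admissible.le_piecewiseQuad (h : Admissible τ Vh) : Vh ≤ piecewiseQuad τ :=
  fun v hv K _ => h.poly v hv K

/-- A vanishing `L²` class of a continuous gradient means a vanishing gradient at every point of the
open cell; consistency of the edge means does the rest. -/
lemma brokenGrad_injective (ho : IsOpen Ω) (hc : Convex ℝ Ω) (hb : Bornology.IsBounded Ω)
    (h : Admissible τ Vh) :
    Function.Injective (brokenGrad τ ∘ₗ Submodule.inclusion h.le_piecewiseQuad) := by
  rw [injective_iff_map_eq_zero]
  intro v hv
  refine Subtype.ext (eq_zero_of_partialDeriv_eq_zero τ ho hc hb (h.poly v.1 v.2)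
    (h.edge v.1 v.2) fun K x hx j => ?_)
  have hcd : ContDiff ℝ 1 (v.1 K) := contDiff_of_mem_polySpace (h.poly v.1 v.2 K)
  have hm : MemLp (partialDeriv j (v.1 K)) 2 (volume.restrict (τ.cell K)) :=
    memLp_two_of_continuous (isBounded_cell τ K) (continuous_partialDeriv hcd j)
  have h1 : hm.toLp _ = 0 := congrArg (fun g : GradSpace τ => g (K, j)) hv
  have h2 : partialDeriv j (v.1 K) =ᵐ[volume.restrict (τ.cell K)] 0 :=
    hm.coeFn_toLp.symm.trans ((Lp.eq_zero_iff_ae_eq_zero).1 h1)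
  exact Measure.eqOn_open_of_ae_eq h2 (isOpen_cell τ K)
    (continuous_partialDeriv hcd j).continuousOn continuousOn_const hx

/-- Unique solvability of a Galerkin system in a finite-dimensional space. -/
lemma existsUnique_inner_eq {V E : Type*} [AddCommGroup V] [Module ℝ V] [FiniteDimensional ℝ V]
    [NormedAddCommGroup E] [InnerProductSpace ℝ E] {g : V →ₗ[ℝ] E} (hg : Function.Injective g)
    (F : V →ₗ[ℝ] ℝ) : ∃! v, ∀ w, inner ℝ (g v) (g w) = F w := by
  -- The Gram map is injective since `T v v = ‖g v‖²`, hence bijective onto the dual by equality of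
  -- dimensions.
  let T : V →ₗ[ℝ] Module.Dual ℝ V := (LinearMap.lcomp ℝ ℝ g) ∘ₗ (innerₗ E) ∘ₗ g
  have hT : ∀ v w, T v w = inner ℝ (g v) (g w) := fun v w => rfl
  have hinj : Function.Injective T := by
    rw [injective_iff_map_eq_zero]
    intro v hv
    have h1 : inner ℝ (g v) (g v) = 0 := by rw [← hT, hv]; rfl
    exact hg (by rw [inner_self_eq_zero.1 h1, map_zero])
  have hsurj : Function.Surjective T :=
    (LinearMap.injective_iff_surjective_of_finrank_eq_finrank Subspace.dual_finrank_eq.symm).1 hinj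
  obtain ⟨v, hv⟩ := hsurj F
  refine ⟨v, fun w => by rw [← hT, hv], fun v' hv' => hinj ?_⟩
  rw [hv]
  ext w
  rw [hT, hv' w]

lemma integrable_load (ho : IsOpen Ω) (hc : Convex ℝ Ω) {f : Plane → ℝ} (hf : MemL2 Ω f)
    {g : Plane → ℝ} (hg : Continuous g) (K : τ.cells) :
    Integrable (fun x => f x * g x) (volume.restrict (τ.cell K)) :=
  integrable_mul_of_memLp
    (hf.mono_measure (Measure.restrict_mono (cell_subset τ ho hc K) le_rfl))
    (memLp_two_of_continuous (isBounded_cell τ K) hg)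

/-- The load as a linear functional. -/
def loadMap (ho : IsOpen Ω) (hc : Convex ℝ Ω) {f : Plane → ℝ} (hf : MemL2 Ω f) :
    piecewiseQuad τ →ₗ[ℝ] ℝ where
  toFun v := brokenLoad τ f v.1
  map_add' v w := by
    unfold brokenLoad
    rw [← Finset.sum_add_distrib]
    refine Finset.sum_congr rfl fun K _ => ?_
    rw [← integral_add (integrable_load τ ho hc hf (piecewiseQuad_contDiff v K).continuous K)
      (integrable_load τ ho hc hf (piecewiseQuad_contDiff w K).continuous K)]
    refine integral_congr_ae (Eventually.of_forall fun x => ?_)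
    exact mul_add (f x) (v.1 K x) (w.1 K x)
  map_smul' c v := by
    unfold brokenLoad
    rw [RingHom.id_apply, smul_eq_mul, Finset.mul_sum]
    refine Finset.sum_congr rfl fun K _ => ?_
    rw [← integral_const_mul]
    refine integral_congr_ae (Eventually.of_forall fun x => ?_)
    exact mul_left_comm (f x) c (v.1 K x)

theorem existsUnique_discreteSolution (ho : IsOpen Ω) (hc : Convex ℝ Ω)
    (hb : Bornology.IsBounded Ω) (h : Admissible τ Vh) {f : Plane → ℝ} (hf : MemL2 Ω f) :
    ∃! uh, IsDiscreteSolution τ Vh f uh := by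
  have := finiteDimensional_of_poly τ h.poly
  set ι := Submodule.inclusion h.le_piecewiseQuad
  obtain ⟨v, hv, huniq⟩ := existsUnique_inner_eq (brokenGrad_injective τ ho hc hb h)
    (loadMap τ ho hc hf ∘ₗ ι)
  refine ⟨v.1, ⟨v.2, fun w hw => ?_⟩, fun v' hv' => ?_⟩
  · exact (brokenForm_eq_brokenGrad τ (ι v) (ι ⟨w, hw⟩)).trans (hv ⟨w, hw⟩)
  · refine congrArg Subtype.val (huniq ⟨v', hv'.1⟩ fun w => ?_)
    exact (brokenForm_eq_brokenGrad τ (ι ⟨v', hv'.1⟩) (ι w)).symm.trans (hv'.2 w.1 w.2)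

/-! ### The continuous solution -/

lemma IsTestFun.memH10 {Ω : Set Plane} (ho : IsOpen Ω) (hb : Bornology.IsBounded Ω)
    {φ : Plane → ℝ} (h : IsTestFun Ω φ) : MemH10 Ω φ := by
  have h1 : ContDiff ℝ 1 φ := h.1.of_le (by simp)
  have hw := fun i => hasWeakDeriv_of_contDiff Ω i h1
  have hae := fun i => (hw i).weakDeriv_ae_eq ho
  refine ⟨⟨memLp_two_of_continuous hb h1.continuous, fun i => ⟨⟨_, hw i⟩, ?_⟩⟩,
    fun _ => φ, fun _ => h, by simp, fun i => ?_⟩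
  · exact (memLp_congr_ae (hae i)).2
      (memLp_two_of_continuous hb (continuous_partialDeriv h1 i))
  · have : eLpNorm (fun x => weakDeriv Ω i φ x - partialDeriv i φ x) 2 (volume.restrict Ω) = 0 := by
      rw [eLpNorm_congr_ae (g := fun _ => (0 : ℝ))]
      · simp
      · filter_upwards [hae i] with x hx
        rw [hx, sub_self]
    simp [this]

/-- The strong form of the equation. -/
lemma ae_eq_neg_laplacian {Ω : Set Plane} (ho : IsOpen Ω) (hb : Bornology.IsBounded Ω)
    {f u : Plane → ℝ} (hf : MemL2 Ω f) (hu : IsWeakSolution Ω f u) {D : Fin 2 → Plane → ℝ}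
    (hq : ∀ j, MemL2 Ω (weakDeriv Ω j u))
    (hD : ∀ j, MemL2 Ω (D j)) (hw : ∀ j, HasWeakDeriv Ω j (weakDeriv Ω j u) (D j)) :
    f =ᵐ[volume.restrict Ω] fun x => -∑ j, D j x := by
  have hlf : LocallyIntegrableOn f Ω := locallyIntegrableOn_of_locallyIntegrable_restrict
    (hf.locallyIntegrable (by norm_num))
  have hloc : LocallyIntegrableOn (fun x => f x + ∑ j, D j x) Ω := by
    simp only [Fin.sum_univ_two]
    exact hlf.add ((hw 0).2.1.add (hw 1).2.1)
  have key := ho.ae_eq_zero_of_integral_contDiff_smul_eq_zero hloc fun φ hφ hφc hφs => by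
    have hT : IsTestFun Ω φ := ⟨hφ, hφc, hφs⟩
    have h1 : ContDiff ℝ 1 φ := hφ.of_le (by simp)
    have hφ2 : MemLp φ 2 (volume.restrict Ω) := memLp_two_of_continuous hb h1.continuous
    have hφd := fun i => memLp_two_of_continuous hb (continuous_partialDeriv h1 i)
    have hae := ae_all_iff.2 fun i => (hasWeakDeriv_of_contDiff Ω i h1).weakDeriv_ae_eq ho
    have e1 : ∫ x in Ω, ∑ i, weakDeriv Ω i u x * weakDeriv Ω i φ x =
        ∑ i, ∫ x in Ω, weakDeriv Ω i u x * partialDeriv i φ x := by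
      rw [← integral_finsetSum _ fun i _ => integrable_mul_of_memLp (hq i) (hφd i)]
      refine integral_congr_ae ?_
      filter_upwards [hae] with x hx
      exact Finset.sum_congr rfl fun i _ => by rw [hx i]
    have e2 : ∫ x in Ω, (f x + ∑ j, D j x) * φ x =
        (∫ x in Ω, f x * φ x) + ∑ j, ∫ x in Ω, D j x * φ x := by
      rw [← integral_finsetSum _ fun i _ => integrable_mul_of_memLp (hD i) hφ2,
        ← integral_add (integrable_mul_of_memLp hf hφ2)
          (integrable_finsetSum _ fun i _ => integrable_mul_of_memLp (hD i) hφ2)]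
      simp_rw [add_mul, Finset.sum_mul]
    have e3 : ∫ x, φ x • (f x + ∑ j, D j x) = ∫ x in Ω, (f x + ∑ j, D j x) * φ x := by
      rw [setIntegral_eq_integral_of_forall_compl_eq_zero fun x hx => by
        rw [image_eq_zero_of_notMem_tsupport fun h => hx (hφs h), mul_zero]]
      simp_rw [smul_eq_mul, mul_comm]
    rw [e3, e2, ← hu.2 φ (hT.memH10 ho hb), e1, Finset.sum_congr rfl fun i _ => (hw i).2.2 φ hT]
    simp
  rw [EventuallyEq, ae_restrict_iff' ho.measurableSet]
  filter_upwards [key] with x hx hxΩ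
  linarith [hx hxΩ]

end

section

/-! ### The error estimate -/

variable {Ω : Set Plane} (τ : Triangulation Ω)

lemma diam_le_meshSize (K : τ.cells) :
    Metric.diam (convexHull ℝ (K.1 : Set Plane)) ≤ τ.meshSize :=
  le_ciSup (f := fun K : τ.cells => Metric.diam (convexHull ℝ (K.1 : Set Plane)))
    (Set.finite_range _).bddAbove K

lemma meshSize_nonneg : 0 ≤ τ.meshSize := Real.iSup_nonneg fun _ => Metric.diam_nonneg

lemma MemL2.cell {τ : Triangulation Ω} (ho : IsOpen Ω) (hc : Convex ℝ Ω) {g : Plane → ℝ}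
    (hg : MemL2 Ω g) (K : τ.cells) : MemLp g 2 (volume.restrict (τ.cell K)) :=
  hg.mono_measure (Measure.restrict_mono (cell_subset τ ho hc K) le_rfl)

variable {q : Fin 2 → Plane → ℝ} {D : Fin 2 → Fin 2 → Plane → ℝ}

lemma sum_vecSq (ho : IsOpen Ω) (hc : Convex ℝ Ω) (hD : ∀ j k, MemL2 Ω (D j k)) :
    ∑ K, ∑ j, vecSq (cellBasis τ K) (D j) = ∑ j, ∑ k, ∫ x in Ω, D j k x ^ 2 := by
  simp only [vecSq, tri_cellBasis]
  rw [Finset.sum_comm]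
  refine Finset.sum_congr rfl fun j _ => ?_
  rw [Finset.sum_comm]
  exact Finset.sum_congr rfl fun k _ => sum_integral_cell τ ho hc (hD j k).integrable_sq

lemma norm_brokenGrad_sq (v : piecewiseQuad τ) : ‖brokenGrad τ v‖ ^ 2 =
    ∑ K, vecSq (cellBasis τ K) (fun k => partialDeriv k (v.1 K)) := by
  simp only [vecSq, tri_cellBasis]
  exact norm_toGrad_sq (piecewiseQuad_memLp v)

/-- The strong equation turns the load into integrals of `D j j`, and the edge terms contained in
the cell defects sum to zero by `sum_sideInt`. With these terms included, the consistency error can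
be estimated triangle by triangle. -/
lemma inner_sub_brokenLoad_eq (ho : IsOpen Ω) (hc : Convex ℝ Ω) (hb : Bornology.IsBounded Ω)
    (hq : ∀ j, MemL2 Ω (q j)) (hD : ∀ j k, MemL2 Ω (D j k))
    (hw : ∀ j k, HasWeakDeriv Ω k (q j) (D j k)) {f : Plane → ℝ}
    (hf : f =ᵐ[volume.restrict Ω] fun x => -∑ j, D j j x) (v : piecewiseQuad τ)
    (hv : EdgeConsistent τ (edgeMeans τ v.1)) :
    inner ℝ (toGrad τ (fun _ => q) fun K j => (hq j).cell ho hc K) (brokenGrad τ v) -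
      brokenLoad τ f v.1 = ∑ K, cellDefect (cellBasis τ K) q D (v.1 K) := by
  have hload : brokenLoad τ f v.1 = -∑ K, ∑ j, ∫ x in τ.cell K, D j j x * v.1 K x := by
    rw [brokenLoad, ← Finset.sum_neg_distrib]
    refine Finset.sum_congr rfl fun K _ => ?_
    rw [← integral_finsetSum _ fun j _ => integrable_load τ ho hc (hD j j)
      (piecewiseQuad_contDiff v K).continuous K, ← integral_neg]
    refine integral_congr_ae ?_
    filter_upwards [ae_restrict_of_ae_restrict_of_subset (cell_subset τ ho hc K) hf] with x hx
    rw [hx, neg_mul, Finset.sum_mul]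
  have hside : ∑ K, ∑ j, ∑ i, edgeAvg (cellBasis τ K (i + 1)) (cellBasis τ K (i + 2)) (v.1 K) *
      baryDeriv (cellBasis τ K) i j * sideInt (cellBasis τ K) i (q j) (D j) = 0 := by
    rw [Finset.sum_comm]
    exact Finset.sum_eq_zero fun j _ => sum_sideInt τ ho hc hb hv j (hq j) (hD j) (hw j)
  unfold cellDefect
  rw [Finset.sum_add_distrib, hside, hload, brokenGrad, LinearMap.coe_mk, AddHom.coe_mk,
    inner_toGrad]
  simp only [tri_cellBasis, Finset.sum_add_distrib]
  ring

/-- The consistency error. -/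
theorem abs_inner_sub_brokenLoad_le (ho : IsOpen Ω) (hc : Convex ℝ Ω)
    (hb : Bornology.IsBounded Ω) {γ : ℝ} (hτ : τ.ShapeRegular γ)
    (hq : ∀ j, MemL2 Ω (q j)) (hD : ∀ j k, MemL2 Ω (D j k))
    (hw : ∀ j k, HasWeakDeriv Ω k (q j) (D j k)) {f : Plane → ℝ}
    (hf : f =ᵐ[volume.restrict Ω] fun x => -∑ j, D j j x) (v : piecewiseQuad τ)
    (hv : EdgeConsistent τ (edgeMeans τ v.1)) :
    |inner ℝ (toGrad τ (fun _ => q) fun K j => (hq j).cell ho hc K) (brokenGrad τ v) -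
      brokenLoad τ f v.1| ≤ (8 + 24 * |γ|) *
        (τ.meshSize * (√(∑ j, ∑ k, ∫ x in Ω, D j k x ^ 2) * ‖brokenGrad τ v‖)) := by
  rw [inner_sub_brokenLoad_eq τ ho hc hb hq hD hw hf v hv, ← sum_vecSq τ ho hc hD,
    ← Real.sqrt_sq (norm_nonneg (brokenGrad τ v)), norm_brokenGrad_sq]
  have hcell : ∀ K, |cellDefect (cellBasis τ K) q D (v.1 K)| ≤ (8 + 24 * |γ|) * (τ.meshSize *
      (√(∑ j, vecSq (cellBasis τ K) (D j)) *
        √(vecSq (cellBasis τ K) (fun k => partialDeriv k (v.1 K))))) := fun K => by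
    obtain ⟨x₀, ρ, hρ, hball, hd⟩ := hτ K.1 K.2
    rw [← range_cellBasis τ K] at hball
    refine (abs_cellDefect_le (cellBasis τ K) hρ hball (by rw [range_cellBasis]) hd
      (fun j => ?_) (fun j k => ?_) (fun j k => ?_) (piecewiseQuad_contDiff v K)).trans ?_
    · rw [tri_cellBasis]; exact (hq j).cell ho hc K
    · rw [tri_cellBasis]; exact (hD j k).cell ho hc K
    · rw [tri_cellBasis]; exact (hw j k).mono (cell_subset τ ho hc K)
    · gcongr
      exact diam_le_meshSize τ K
  refine (Finset.abs_sum_le_sum_abs _ _).trans ((Finset.sum_le_sum fun K _ => hcell K).trans ?_)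
  rw [← Finset.mul_sum, ← Finset.mul_sum]
  have := meshSize_nonneg τ
  gcongr
  exact Real.sum_sqrt_mul_sqrt_le _ (fun K => Finset.sum_nonneg fun j _ => vecSq_nonneg _ _)
    fun K => vecSq_nonneg _ _

lemma integral_sub_const_sq {α : Type*} [MeasurableSpace α] {μ : Measure α} [IsFiniteMeasure μ]
    {g : α → ℝ} (hg : MemLp g 2 μ) (c : ℝ) : ∫ x, (g x - c) ^ 2 ∂μ =
      (∫ x, g x ^ 2 ∂μ) - 2 * c * (∫ x, g x ∂μ) + μ.real Set.univ * c ^ 2 := by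
  have h1 : Integrable g μ := hg.integrable one_le_two
  have h2 : Integrable (fun x => g x ^ 2) μ := hg.integrable_sq
  have h3 : Integrable (fun x => 2 * c * g x) μ := h1.const_mul _
  have e : ∀ x, (g x - c) ^ 2 = g x ^ 2 - 2 * c * g x + c ^ 2 := fun x => by ring
  simp_rw [e]
  rw [integral_add (h2.sub' h3) (integrable_const _), integral_sub h2 h3, integral_const_mul,
    integral_const, smul_eq_mul]

/-- Approximation by interpolants of test functions. -/
theorem exists_approximation (ho : IsOpen Ω) (hc : Convex ℝ Ω)
    {u : Plane → ℝ} (hu : MemH10 Ω u) (hq : ∀ j, MemL2 Ω (weakDeriv Ω j u))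
    (hD : ∀ j k, MemL2 Ω (D j k))
    (hw : ∀ j k, HasWeakDeriv Ω k (weakDeriv Ω j u) (D j k)) :
    ∃ w : ℕ → piecewiseQuad τ, (∀ n, (w n).1 ∈ spaceNC1 τ) ∧
      ∃ l ≤ 2 * τ.meshSize ^ 2 * ∑ j, ∑ k, ∫ x in Ω, D j k x ^ 2,
        Tendsto (fun n => ‖toGrad τ (fun _ j => weakDeriv Ω j u)
          (fun K j => (hq j).cell ho hc K) - brokenGrad τ (w n)‖ ^ 2) atTop (𝓝 l) := by
  obtain ⟨-, φ, hφ, -, hφu⟩ := hu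
  have hφ1 : ∀ n, ContDiff ℝ 1 (φ n) := fun n => (hφ n).1.of_le (by simp)
  let w : ℕ → piecewiseQuad τ := fun n => ⟨interpolant τ (φ n), fun K _ =>
    polySpace_mono one_le_two (interpolant_poly τ (φ n) K)⟩
  have hfin : ∀ K : τ.cells, IsFiniteMeasure (volume.restrict (τ.cell K)) := fun K =>
    ⟨by simpa using (isBounded_cell τ K).measure_lt_top⟩
  have harea : ∀ K : τ.cells, area (cellBasis τ K) = volume.real (τ.cell K) := fun K => by
    rw [area, tri_cellBasis]
  -- The limit is the squared deviation of `∇u` from its cell means. The interpolant of `u` itself,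
  -- which would need traces, is never formed.
  refine ⟨w, fun n => interpolant_mem τ ho (hφ n), ∑ K : τ.cells, ∑ j, ∫ x in τ.cell K,
    (weakDeriv Ω j u x - (∫ y in τ.cell K, weakDeriv Ω j u y) / volume.real (τ.cell K)) ^ 2,
    ?_, ?_⟩
  · rw [← sum_vecSq τ ho hc hD, Finset.mul_sum]
    refine Finset.sum_le_sum fun K _ => ?_
    rw [Finset.mul_sum]
    refine Finset.sum_le_sum fun j _ => ?_
    simp only [vecSq, tri_cellBasis]
    refine poincare (isOpen_cell τ K) (convex_cell τ K) (isBounded_cell τ K)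
      (fun x hx y hy => ?_) ((hq j).cell ho hc K) (fun k => (hD j k).cell ho hc K)
      fun k => (hw j k).mono (cell_subset τ ho hc K)
    exact (Metric.dist_le_diam_of_mem
      (isBounded_convexHull.2 K.1.finite_toSet.isBounded) (interior_subset hx)
      (interior_subset hy)).trans (diam_le_meshSize τ K)
  · have hnorm : ∀ n, ‖toGrad τ (fun _ j => weakDeriv Ω j u)
        (fun K j => (hq j).cell ho hc K) - brokenGrad τ (w n)‖ ^ 2 =
        ∑ K : τ.cells, ∑ j, ∫ x in τ.cell K, (weakDeriv Ω j u x -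
          (∫ y in τ.cell K, partialDeriv j (φ n) y) / volume.real (τ.cell K)) ^ 2 := fun n => by
      rw [brokenGrad, LinearMap.coe_mk, AddHom.coe_mk, ← toGrad_sub, norm_toGrad_sq]
      refine Finset.sum_congr rfl fun K _ => Finset.sum_congr rfl fun j _ => ?_
      refine integral_congr_ae (Eventually.of_forall fun x => ?_)
      beta_reduce
      rw [partialDeriv_interpolant τ (hφ1 n), harea]
    simp_rw [hnorm]
    refine tendsto_finsetSum _ fun K _ => tendsto_finsetSum _ fun j _ => ?_
    have hm := (hq j).cell ho hc K
    have hlim : Tendsto (fun n => ∫ y in τ.cell K, partialDeriv j (φ n) y) atTop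
        (𝓝 (∫ y in τ.cell K, weakDeriv Ω j u y)) :=
      TendstoL2.integral (TendstoL2.mono_measure (hφu j)
        (Measure.restrict_mono (cell_subset τ ho hc K) le_rfl))
        (fun n => memLp_two_of_continuous (isBounded_cell τ K)
          (continuous_partialDeriv (hφ1 n) j)) hm
    have hlim' := hlim.div_const (volume.real (τ.cell K))
    -- The integral depends on `n` only through the subtracted constant, as a quadratic polynomial,
    -- so convergence of the cell means suffices.
    simp_rw [integral_sub_const_sq hm]
    exact (tendsto_const_nhds.sub ((hlim'.const_mul 2).mul_const _)).add
      ((hlim'.pow 2).const_mul _)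

/-- Strang's estimate. -/
lemma norm_sub_le_of_consistency {E : Type*} [NormedAddCommGroup E] [InnerProductSpace ℝ E]
    {p a b : E} {M L : ℝ} (hL : inner ℝ a (a - b) = L)
    (hM : |inner ℝ p (a - b) - L| ≤ M * ‖a - b‖) (hM0 : 0 ≤ M) :
    ‖p - a‖ ≤ 2 * ‖p - b‖ + M := by
  have h1 : ‖a - b‖ * ‖a - b‖ ≤ (M + ‖p - b‖) * ‖a - b‖ := by
    -- The Galerkin equation replaces the pairing of `a` with `a - b` by `L`, which leaves an
    -- approximation term minus the consistency error.
    have e : ‖a - b‖ * ‖a - b‖ =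
        inner ℝ (p - b) (a - b) - (inner ℝ p (a - b) - L) := by
      rw [← real_inner_self_eq_norm_mul_norm, ← hL, inner_sub_left p b, inner_sub_left a b]
      ring
    linarith [neg_abs_le (inner ℝ p (a - b) - L), real_inner_le_norm (p - b) (a - b)]
  have h2 : ‖a - b‖ ≤ M + ‖p - b‖ := by
    by_contra! h
    nlinarith [norm_nonneg (p - b), norm_nonneg (a - b)]
  have h3 : ‖p - a‖ ≤ ‖p - b‖ + ‖a - b‖ := by
    rw [show p - a = (p - b) - (a - b) by abel]
    exact norm_sub_le _ _
  linarith

/-- The full Hessian counts the mixed derivative twice, the seminorm only once; hence the factor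
`2`. -/
lemma sum_integral_weakDeriv_sq_le (ho : IsOpen Ω) {u : Plane → ℝ} (hu : MemH2 Ω u) :
    ∑ j, ∑ k, ∫ x in Ω, weakDeriv Ω k (weakDeriv Ω j u) x ^ 2 ≤ 2 * seminormH2 Ω u ^ 2 := by
  have h01 : weakDeriv Ω 0 (weakDeriv Ω 1 u) =ᵐ[volume.restrict Ω]
      weakDeriv Ω 1 (weakDeriv Ω 0 u) :=
    (HasWeakDeriv.comm (hasWeakDeriv_weakDeriv (hu.1.2 0).1)
      (hasWeakDeriv_weakDeriv (hu.1.2 1).1)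
      (hasWeakDeriv_weakDeriv ((hu.2 0).2 1).1)).weakDeriv_ae_eq ho
  have h : ∫ x in Ω, weakDeriv Ω 0 (weakDeriv Ω 1 u) x ^ 2 =
      ∫ x in Ω, weakDeriv Ω 1 (weakDeriv Ω 0 u) x ^ 2 := by
    refine integral_congr_ae ?_
    filter_upwards [h01] with x hx
    rw [hx]
  have hnn : ∀ g : Plane → ℝ, 0 ≤ ∫ x in Ω, g x ^ 2 := fun g =>
    integral_nonneg fun _ => sq_nonneg _
  rw [seminormH2, Real.sq_sqrt (add_nonneg (add_nonneg (hnn _) (hnn _)) (hnn _))]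
  simp only [Fin.sum_univ_two, h]
  linarith [hnn (weakDeriv Ω 0 (weakDeriv Ω 0 u)), hnn (weakDeriv Ω 1 (weakDeriv Ω 1 u))]

/-- Strang's estimate is applied with each interpolant `w n`, and only then does `n` tend to
infinity. The approximation part contributes `2 · 2`, the consistency part `2 (8 + 24 |γ|)`, where
the outer `2` is the rounded `√2` from `√T ≤ √2 S`. -/
theorem energyNorm_error_le (ho : IsOpen Ω) (hc : Convex ℝ Ω) (hb : Bornology.IsBounded Ω)
    {γ : ℝ} (hτ : τ.ShapeRegular γ) {Vh : Submodule ℝ (Piecewise τ)} (hV : Admissible τ Vh)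
    {f u : Plane → ℝ} (hf : MemL2 Ω f) (hu : IsWeakSolution Ω f u) (hu2 : MemH2 Ω u)
    {uh : Piecewise τ} (huh : IsDiscreteSolution τ Vh f uh) :
    energyNorm τ (fun K x => u x - uh K x) ≤
      (20 + 48 * |γ|) * τ.meshSize * seminormH2 Ω u := by
  have hq : ∀ j, MemL2 Ω (weakDeriv Ω j u) := fun j => (hu2.1.2 j).2
  have hD : ∀ j k, MemL2 Ω (weakDeriv Ω k (weakDeriv Ω j u)) := fun j k => ((hu2.2 j).2 k).2
  have hw : ∀ j k, HasWeakDeriv Ω k (weakDeriv Ω j u) (weakDeriv Ω k (weakDeriv Ω j u)) :=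
    fun j k => hasWeakDeriv_weakDeriv ((hu2.2 j).2 k).1
  have hstrong := ae_eq_neg_laplacian ho hb hf hu hq (fun j => hD j j) fun j => hw j j
  set T := ∑ j, ∑ k, ∫ x in Ω, weakDeriv Ω k (weakDeriv Ω j u) x ^ 2 with hT
  set S := seminormH2 Ω u
  set h := τ.meshSize
  have hS0 : 0 ≤ S := Real.sqrt_nonneg _
  have hh0 : 0 ≤ h := meshSize_nonneg τ
  have hTS : T ≤ 2 * S ^ 2 := sum_integral_weakDeriv_sq_le ho hu2
  obtain ⟨w, hwV, l, hl, hlim⟩ := exists_approximation τ ho hc hu.1 hq hD hw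
  set p := toGrad τ (fun _ j => weakDeriv Ω j u) (fun K j => (hq j).cell ho hc K)
  let a : piecewiseQuad τ := ⟨uh, hV.le_piecewiseQuad τ huh.1⟩
  have hnorm : energyNorm τ (fun K x => u x - uh K x) = ‖p - brokenGrad τ a‖ := by
    have hs : ∀ K i, HasWeakDeriv (τ.cell K) i (fun x => u x - uh K x)
        (fun x => weakDeriv Ω i u x - partialDeriv i (uh K) x) := fun K i =>
      ((hasWeakDeriv_weakDeriv (hu2.1.2 i).1).mono (cell_subset τ ho hc K)).sub
        (hasWeakDeriv_of_contDiff _ i (piecewiseQuad_contDiff a K))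
    have hm : ∀ K i, MemLp (fun x => weakDeriv Ω i u x - partialDeriv i (uh K) x) 2
        (volume.restrict (τ.cell K)) := fun K i =>
      ((hq i).cell ho hc K).sub (piecewiseQuad_memLp a K i)
    rw [energyNorm, brokenForm_eq_inner τ hm hm hs hs, real_inner_self_eq_norm_sq,
      Real.sqrt_sq (norm_nonneg _)]
    rfl
  have hbound : ∀ n, ‖p - brokenGrad τ a‖ ≤
      2 * √(‖p - brokenGrad τ (w n)‖ ^ 2) + (8 + 24 * |γ|) * (h * √T) := fun n => by
    have hmem : (a - w n).1 ∈ Vh := Vh.sub_mem huh.1 (hV.le (hwV n))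
    have hcons := abs_inner_sub_brokenLoad_le τ ho hc hb hτ hq hD hw hstrong (a - w n)
      (hV.edge _ hmem)
    have hgal := (brokenForm_eq_brokenGrad τ a (a - w n)).symm.trans (huh.2 _ hmem)
    rw [map_sub] at hcons hgal
    rw [Real.sqrt_sq (norm_nonneg _)]
    refine norm_sub_le_of_consistency hgal (hcons.trans_eq ?_) (by positivity)
    ring
  have hfinal : ‖p - brokenGrad τ a‖ ≤ 2 * √l + (8 + 24 * |γ|) * (h * √T) :=
    ge_of_tendsto' ((hlim.sqrt.const_mul 2).add_const _) hbound
  have h1 : √T ≤ 2 * S := Real.sqrt_le_iff.2 ⟨by positivity, by nlinarith [sq_nonneg S]⟩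
  have h2 : √l ≤ 2 * (h * S) := by
    refine Real.sqrt_le_iff.2 ⟨by positivity, hl.trans ?_⟩
    calc 2 * h ^ 2 * T ≤ 2 * h ^ 2 * (2 * S ^ 2) := by gcongr
      _ = (2 * (h * S)) ^ 2 := by ring
  rw [hnorm]
  calc ‖p - brokenGrad τ a‖ ≤ 2 * (2 * (h * S)) + (8 + 24 * |γ|) * (h * (2 * S)) :=
        hfinal.trans (by gcongr)
    _ = (20 + 48 * |γ|) * h * S := by ring

end

end NC1C2

end

theorem mainTheorem1 (γ : ℝ) :
    ∃ C : ℝ, 0 < C ∧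
      ∀ (Ω : Set NC1C2.Plane), NC1C2.IsConvexPolygon Ω →
      ∀ (τ : NC1C2.Triangulation Ω), τ.ShapeRegular γ →
      ∀ (Vh : Submodule ℝ (NC1C2.Piecewise τ)),
        (Vh = NC1C2.spaceNC1 τ ⊔ NC1C2.spaceVertexQuad τ ∨
          Vh = NC1C2.spaceNC1 τ ⊔ NC1C2.spaceC2 τ) →
      ∀ (f u : NC1C2.Plane → ℝ), NC1C2.MemL2 Ω f →
        NC1C2.IsWeakSolution Ω f u → NC1C2.MemH2 Ω u →
        (∃! uh : NC1C2.Piecewise τ, NC1C2.IsDiscreteSolution τ Vh f uh) ∧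
        ∀ uh : NC1C2.Piecewise τ, NC1C2.IsDiscreteSolution τ Vh f uh →
          NC1C2.energyNorm τ (fun K x => u x - uh K x) ≤
            C * τ.meshSize * NC1C2.seminormH2 Ω u := by
  -- The constant of `energyNorm_error_le`; the absolute value keeps it positive for every real `γ`.
  refine ⟨20 + 48 * |γ|, by positivity, fun Ω hΩ τ hτ Vh hVh f u hf hu hu2 => ?_⟩
  have hV : NC1C2.Admissible τ Vh := by
    rcases hVh with rfl | rfl
    · exact NC1C2.admissible_sup τ hΩ.isOpen hΩ.convex _ fun K =>
        NC1C2.vertexQuadratics_le K.1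
    · exact NC1C2.admissible_sup τ hΩ.isOpen hΩ.convex _ fun _ => le_rfl
  exact ⟨NC1C2.existsUnique_discreteSolution τ hΩ.isOpen hΩ.convex hΩ.isBounded hV hf,
    fun uh huh => NC1C2.energyNorm_error_le τ hΩ.isOpen hΩ.convex hΩ.isBounded hτ hV hf hu hu2
      huh⟩
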